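/- **Setting.** Let $X_1,\dots,X_n$ be i.i.d. random vectors in $\mathbb R^d$ ($d\ge 1$) with law $\mathrm P$, $\mathbb E\|X\|^4<\infty$ for $X\sim \mathrm P$. Let $G=\mathbb E(XX^\top)$ with eigenvalues $\lambda_1\ge\dots\ge\lambda_d$, $\|M\|_F=\mathrm{Tr}(M^\top M)^{1/2}$, $s_4^2=\mathbb E(\|X\|^4)^{1/2}$, $$\kappa=\sup_{\theta:\ \mathbb E\langle\theta,X\rangle^2>0}\frac{\mathbb E\langle\theta,X\rangle^4}{(\mathbb E\langle\theta,X\rangle^2)^2},\qquad c=\frac{15}{8\log(2)(\sqrt2-1)}\exp\Bigl(\frac{1+2\sqrt2}{2}\Bigr).$$ Let $a,\epsilon,L>0$, $0<\sigma\le s_4^2$, $K=1+\bigl\lceil a^{-1}\log\frac{n}{72(2+c)\kappa^{1/2}}\bigr\rceil$, $$\zeta(t)=\sqrt{2(\kappa-1)\Bigl(\tfrac{(2+3c)s_4^2}{4(2+c)\kappa^{1/2}t}+\log(K/\epsilon)\Bigr)}\,\cosh(a/4)+\sqrt{\tfrac{2(2+c)\kappa^{1/2}s_4^2}{t}}\,\cosh(a/2),$$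 $$B_*(t)=\frac{n^{-1/2}\zeta(\max\{t,\sigma\})}{1-4n^{-1/2}\zeta(\max\{t,\sigma\})}\ \text{ if } [6+(\kappa-1)^{-1}]\,\zeta(\max\{t,\sigma\})\le\sqrt n,\qquad B_*(t)=+\infty\text{ otherwise},$$ $$B(t)=2\max\{t,\sigma\}\,B_*(\min\{t,s_4^2\})+7\delta\|G\|_F+\sigma.$$ Assume $8\zeta(\sigma)\le\sqrt n$ and $\kappa\ge 3/2$ (so that $B_*<\infty$). Let $\Theta_\delta$ be a finite $\delta$-net of the unit sphere of $\mathbb R^d$. **Estimator.** Let $\psi$ be the odd function with $\psi(t)=-\log(1-t+t^2/2)$ for $0\le t\le1$ and $\psi(t)=\log 2$ for $t\ge1$. For $l>0$ let $\widehat N_l(\theta)=l/\widehat\alpha^2$, where $\widehat\alpha=\sup\{\alpha>0:\ \frac1n\sum_{i=1}^n\psi(\alpha^2\langle\theta,X_i\rangle^2-l)\le0\}\in(0,+\infty]$ and $l/\infty=0$. For $0\le j<K$ let $$l_j=\sqrt{\tfrac{2}{n(\kappa-1)}\Bigl(\tfrac{2+3c}{4(2+c)\kappa^{1/2}e^{-ja}}+\log(K/\epsilon)\Bigr)},\qquad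 \beta_j=\sqrt{2(2+c)\kappa^{1/2}s_4^4\,n\,e^{-(j-1/2)a}},$$ $\xi_j=\kappa l_j/2$, $\mu_j=(\kappa-1)l_j+(2+c)\kappa^{1/2}s_4^2/\beta_j$ and $$\eta_j(t)=\frac{(\kappa-1)l_j}{2}+\frac{(2+c)\kappa^{1/2}s_4^2}{\beta_j}+\frac{(2+3c)s_4^4}{2\beta_j^2l_j}+\frac{\log(K/\epsilon)}{n l_j}+\frac{\beta_j}{2nt}.$$ If $t>0$ and $\xi_j+\mu_j+2\eta_j(t)<1$, put $\Phi_j^-(t)=t(1-\eta_j(t))$ and $\Phi_j^+(t)=t\bigl(1+\frac{\eta_j(t)}{1-\mu_j-2\eta_j(t)}\bigr)^{-1}$; otherwise put $\Phi_j^\pm(t)=0$. The confidence region for $\theta^\top G\theta$ is the set of all $q\ge0$ with $\Phi_j^-(\widehat N_{l_j}(\theta))\le q$ and $\Phi_j^+(q)\le\widehat N_{l_j}(\theta)$ for all $0\le j<K$. Let $Q$ be the symmetric matrix of least Frobenius norm such that $\theta^\top Q\theta$ lies in the confidence region for every $\theta\in\Theta_\delta$ ($Q=0$ if there is none). Let $\widehat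 G=Q_+$ be its positive part, with eigenvalues $\widehat\lambda_1\ge\dots\ge\widehat\lambda_d$ and an orthonormal basis of eigenvectors $q_1,\dots,q_d$, and put $$\widetilde G=\sum_{i=1}^d\widetilde\lambda_i\,q_iq_i^\top,\qquad \widetilde\lambda_i=\bigl[\widehat\lambda_i-B(\widehat\lambda_i)\bigr]_+ .$$ For symmetric $M=U\,\mathrm{diag}(m_1,\dots,m_d)\,U^\top$ with $U$ orthogonal, $f(M)=U\,\mathrm{diag}(f(m_1),\dots,f(m_d))\,U^\top$. **Claim.** With probability at least $1-2\epsilon$, for every $1/L$-Lipschitz function $f:\mathbb R\to\mathbb R$, $$\|f(G)-f(\widetilde G)\|_F\le\min_{r\in\{1,\dots,d\}}L^{-1}\sqrt{13\,r\,B(\lambda_1)^2+2\sum_{i=r+1}^d\lambda_i^2}\,.$$ -/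

import Mathlib

open MeasureTheory ProbabilityTheory
open scoped Matrix

noncomputable section

namespace RobustPCA

/-- The space `ℝ^d` with its Euclidean norm. -/
abbrev Vec (d : ℕ) := EuclideanSpace ℝ (Fin d)

/-! ### Population quantities of a law `P` on `ℝ^d` -/

/-- The quadratic form `θ ↦ θᵀ M θ`. -/
def quad {d : ℕ} (M : Matrix (Fin d) (Fin d) ℝ) (θ : Vec d) : ℝ :=
  θ.ofLp ⬝ᵥ (M *ᵥ θ.ofLp)

/-- The Frobenius norm `‖M‖_F = Tr(Mᵀ M)^{1/2}`. -/
def frob {d : ℕ} (M : Matrix (Fin d) (Fin d) ℝ) : ℝ :=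
  Real.sqrt (Mᵀ * M).trace

/-- The Gram matrix `G = 𝔼[X Xᵀ]`, where `X` has law `P`. -/
def gram {d : ℕ} (P : Measure (Vec d)) : Matrix (Fin d) (Fin d) ℝ :=
  Matrix.of fun i j => ∫ x, x i * x j ∂P

theorem gram_isHermitian {d : ℕ} (P : Measure (Vec d)) : (gram P).IsHermitian := by
  ext i j
  simp [gram, mul_comm]

/-- The eigenvalues of the Gram matrix in non-increasing order, with multiplicity:
`eig P 0 ≥ eig P 1 ≥ … ≥ eig P (d - 1)`, so that `eig P i` is `λ_{i+1}`. -/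
def eig {d : ℕ} (P : Measure (Vec d)) (i : Fin d) : ℝ :=
  (gram_isHermitian P).eigenvalues₀ (Fin.cast (Fintype.card_fin d).symm i)

/-- The kurtosis coefficient `κ`: the supremum of `𝔼⟨θ,X⟩⁴ / (𝔼⟨θ,X⟩²)²` over the directions
`θ` with `𝔼⟨θ,X⟩² > 0`. -/
def kurt {d : ℕ} (P : Measure (Vec d)) : ℝ :=
  sSup ((fun θ : Vec d => (∫ x, (inner ℝ θ x) ^ 4 ∂P) / (∫ x, (inner ℝ θ x) ^ 2 ∂P) ^ 2) ''
    {θ : Vec d | 0 < ∫ x, (inner ℝ θ x) ^ 2 ∂P})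

/-- `s₄² = 𝔼[‖X‖⁴]^{1/2}`. -/
def s4sq {d : ℕ} (P : Measure (Vec d)) : ℝ :=
  Real.sqrt (∫ x, ‖x‖ ^ 4 ∂P)

/-! ### Constants of the estimator

`n` is the sample size; the other numerical parameters are collected in a structure. -/

/-- Numerical parameters: `κ`, `s = s₄²`, the grid step `a`, the confidence parameter `ε`. -/
structure Tuning where
  κ : ℝ
  s : ℝ
  a : ℝ
  ε : ℝ

/-- The parameters `κ` and `s₄²` of the law `P`, together with chosen `a` and `ε`. -/
def tuning {d : ℕ} (P : Measure (Vec d)) (a ε : ℝ) : Tuning where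
  κ := kurt P
  s := s4sq P
  a := a
  ε := ε

/-- The constant `c = 15 / (8 log 2 (√2 - 1)) · exp((1 + 2√2)/2)`. -/
def cst : ℝ :=
  15 / (8 * Real.log 2 * (Real.sqrt 2 - 1)) * Real.exp ((1 + 2 * Real.sqrt 2) / 2)

/-- `K = 1 + ⌈a⁻¹ log(n / (72 (2 + c) κ^{1/2}))⌉`. The hypothesis `8 ζ(σ) ≤ √n` below makes
the logarithm positive, so that the natural ceiling is the usual one. -/
def gridSize (n : ℕ) (T : Tuning) : ℕ :=
  1 + ⌈T.a⁻¹ * Real.log ((n : ℝ) / (72 * (2 + cst) * Real.sqrt T.κ))⌉₊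

/-- The function `ζ`. -/
def zeta (n : ℕ) (T : Tuning) (t : ℝ) : ℝ :=
  Real.sqrt (2 * (T.κ - 1) *
      ((2 + 3 * cst) * T.s / (4 * (2 + cst) * Real.sqrt T.κ * t) +
        Real.log ((gridSize n T : ℝ) / T.ε))) * Real.cosh (T.a / 4) +
    Real.sqrt (2 * (2 + cst) * Real.sqrt T.κ * T.s / t) * Real.cosh (T.a / 2)

open Classical in
/-- The function `B_*`, with the value `+∞` outside the range where the bound is meaningful. -/
def Bstar (n : ℕ) (T : Tuning) (σ t : ℝ) : EReal :=
  if (6 + (T.κ - 1)⁻¹) * zeta n T (max t σ) ≤ Real.sqrt n then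
    (((Real.sqrt n)⁻¹ * zeta n T (max t σ) /
      (1 - 4 * (Real.sqrt n)⁻¹ * zeta n T (max t σ)) : ℝ) : EReal)
  else ⊤

/-- `B(t) = 2 max{t, σ} B_*(min{t, s₄²}) + 7 δ ‖G‖_F + σ`, where the argument `gF` stands for
`‖G‖_F`. It is only used when `8 ζ(σ) ≤ √n` and `κ ≥ 3/2`; then `B_*` is finite everywhere,
since `6 + (κ - 1)⁻¹ ≤ 8` and `ζ` is non-increasing on `[σ, ∞)`, and `toReal` loses nothing. -/
def Bfun (n : ℕ) (T : Tuning) (σ δ gF t : ℝ) : ℝ :=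
  2 * max t σ * (Bstar n T σ (min t T.s)).toReal + 7 * δ * gF + σ

/-! ### Confidence region for the quadratic form `θᵀ G θ` -/

open Classical in
/-- The bounded, odd, non-decreasing influence function `ψ`: `ψ(t) = log 2` for `t ≥ 1`,
`ψ(t) = -log(1 - t + t²/2)` for `0 ≤ t ≤ 1`, and `ψ(-t) = -ψ(t)`. -/
def psi (t : ℝ) : ℝ :=
  if 1 ≤ t then Real.log 2
  else if 0 ≤ t then -Real.log (1 - t + t ^ 2 / 2)
  else if -1 ≤ t then Real.log (1 + t + t ^ 2 / 2)
  else -Real.log 2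

/-- The empirical criterion `r_l(θ) = n⁻¹ ∑ᵢ ψ(⟨θ, xᵢ⟩² - l)`. -/
def crit {d n : ℕ} (x : Fin n → Vec d) (l : ℝ) (θ : Vec d) : ℝ :=
  (n : ℝ)⁻¹ * ∑ i, psi ((inner ℝ θ (x i)) ^ 2 - l)

/-- The estimator `l / α̂²` of `𝔼⟨θ,X⟩²`, where `α̂ ∈ (0, +∞]` is the supremum of the `α` with
`r_l(α θ) ≤ 0`. It is written as the infimum of `l / α²` over these `α`, which takes the right
value `0` when `α̂ = +∞`. -/
def Nhat {d n : ℕ} (x : Fin n → Vec d) (l : ℝ) (θ : Vec d) : ℝ :=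
  sInf ((fun α : ℝ => l / α ^ 2) '' {α : ℝ | 0 < α ∧ crit x l (α • θ) ≤ 0})

/-- The values `l_j` of the scale parameter on the grid, `0 ≤ j < K`. -/
def gridL (n : ℕ) (T : Tuning) (j : ℕ) : ℝ :=
  Real.sqrt (2 / (n * (T.κ - 1)) *
    ((2 + 3 * cst) / (4 * (2 + cst) * Real.sqrt T.κ * Real.exp (-(j * T.a))) +
      Real.log ((gridSize n T : ℝ) / T.ε)))

/-- The values `β_j` of the inverse variance of the Gaussian perturbation on the grid. -/
def gridBeta (n : ℕ) (T : Tuning) (j : ℕ) : ℝ :=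
  Real.sqrt (2 * (2 + cst) * Real.sqrt T.κ * T.s ^ 2 * n * Real.exp (-((j - 1 / 2) * T.a)))

/-- `ξ_j = κ l_j / 2`. -/
def xi (n : ℕ) (T : Tuning) (j : ℕ) : ℝ :=
  T.κ * gridL n T j / 2

/-- `μ_j = (κ - 1) l_j + (2 + c) κ^{1/2} s₄² / β_j`. -/
def mu (n : ℕ) (T : Tuning) (j : ℕ) : ℝ :=
  (T.κ - 1) * gridL n T j + (2 + cst) * Real.sqrt T.κ * T.s / gridBeta n T j

/-- `η_j(t)`, the relative error level of the `j`-th estimator at energy `t`. -/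
def eta (n : ℕ) (T : Tuning) (j : ℕ) (t : ℝ) : ℝ :=
  (T.κ - 1) * gridL n T j / 2 + (2 + cst) * Real.sqrt T.κ * T.s / gridBeta n T j +
    (2 + 3 * cst) * T.s ^ 2 / (2 * gridBeta n T j ^ 2 * gridL n T j) +
    Real.log ((gridSize n T : ℝ) / T.ε) / (n * gridL n T j) +
    gridBeta n T j / (2 * n * t)

/-- The range of energies at which the `j`-th estimator is informative. -/
def Informative (n : ℕ) (T : Tuning) (j : ℕ) (t : ℝ) : Prop :=
  xi n T j + mu n T j + 2 * eta n T j t < 1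

open Classical in
/-- The lower confidence bound as a function of the estimated energy: `t (1 - η_j(t))`, or the
trivial bound `0`. -/
def phiMinus (n : ℕ) (T : Tuning) (j : ℕ) (t : ℝ) : ℝ :=
  if Informative n T j t then t * (1 - eta n T j t) else 0

open Classical in
/-- The lower bound for the estimated energy as a function of the true energy `t`:
`t / (1 + η_j(t) / (1 - μ_j - 2 η_j(t)))`, or the trivial bound `0`. -/
def phiPlus (n : ℕ) (T : Tuning) (j : ℕ) (t : ℝ) : ℝ :=
  if Informative n T j t then
    t / (1 + eta n T j t / (1 - mu n T j - 2 * eta n T j t))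
  else 0

/-- The confidence region for `θᵀ G θ` (with `‖θ‖ = 1`) computed from the sample `x`: the
non-negative `q` with `Φ₋(N̂_j) ≤ q` and `Φ₊(q) ≤ N̂_j` for every point `j` of the grid. -/
def confRegion {d n : ℕ} (T : Tuning) (x : Fin n → Vec d) (θ : Vec d) : Set ℝ :=
  {q : ℝ | 0 ≤ q ∧ ∀ j < gridSize n T,
    phiMinus n T j (Nhat x (gridL n T j) θ) ≤ q ∧
    phiPlus n T j q ≤ Nhat x (gridL n T j) θ}

/-! ### The estimators -/

/-- `Θ` is a finite `δ`-net of the unit sphere. -/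
def IsSphereNet {d : ℕ} (δ : ℝ) (Θ : Finset (Vec d)) : Prop :=
  (∀ θ ∈ Θ, ‖θ‖ = 1) ∧ ∀ θ : Vec d, ‖θ‖ = 1 → ∃ θ' ∈ Θ, ‖θ - θ'‖ ≤ δ

/-- `Q` is symmetric and satisfies the confidence constraints in all directions of the net. -/
def Feasible {d n : ℕ} (T : Tuning) (Θ : Finset (Vec d)) (x : Fin n → Vec d)
    (Q : Matrix (Fin d) (Fin d) ℝ) : Prop :=
  Q.IsSymm ∧ ∀ θ ∈ Θ, quad Q θ ∈ confRegion T x θ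

/-- `Q` solves the convex program: it has the least Frobenius norm among feasible matrices. -/
def IsSolution {d n : ℕ} (T : Tuning) (Θ : Finset (Vec d)) (x : Fin n → Vec d)
    (Q : Matrix (Fin d) (Fin d) ℝ) : Prop :=
  Feasible T Θ x Q ∧ ∀ Q', Feasible T Θ x Q' → frob Q ≤ frob Q'

open Classical in
/-- The matrix `Q`: the solution of the convex program, and `0` for samples for which there is
none. -/
def Qhat {d n : ℕ} (T : Tuning) (Θ : Finset (Vec d)) (x : Fin n → Vec d) :
    Matrix (Fin d) (Fin d) ℝ :=
  if h : ∃ Q, IsSolution T Θ x Q then h.choose else 0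

/-- `Ĝ = Q₊`, the positive part of `Q`. For a real symmetric `M = U diag(mᵢ) Uᵀ`, `cfc f M` is
`U diag(f mᵢ) Uᵀ` for every function `f`. -/
def Ghat {d n : ℕ} (T : Tuning) (Θ : Finset (Vec d)) (x : Fin n → Vec d) :
    Matrix (Fin d) (Fin d) ℝ :=
  cfc (fun t : ℝ => max t 0) (Qhat T Θ x)

/-- `G̃ = ∑ᵢ λ̃ᵢ qᵢ qᵢᵀ` with `λ̃ᵢ = [λ̂ᵢ - B(λ̂ᵢ)]₊`, where `λ̂ᵢ`, `qᵢ` are the eigenvalues and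
eigenvectors of `Ĝ`. -/
def Gtilde {d n : ℕ} (T : Tuning) (Θ : Finset (Vec d)) (σ δ gF : ℝ) (x : Fin n → Vec d) :
    Matrix (Fin d) (Fin d) ℝ :=
  cfc (fun t : ℝ => max (t - Bfun n T σ δ gF t) 0) (Ghat T Θ x)

end RobustPCA

end

noncomputable section

namespace RobustPCA

/-! ### The influence function -/

/-! The proof has a probabilistic half, uniform in the direction θ, and a deterministic half. Write
N(θ) = θᵀGθ.

Probabilistic half: a PAC-Bayesian argument. For either sign, the influence function at θ is at most
the average, over Gaussian perturbations of θ, of the logarithm of a quartic polynomial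
(`psi_le_gaussian_integral_log`). Averages of this kind satisfy an exponential inequality on one
event that serves all θ at once: moving the Gaussian to θ only costs the relative entropy β‖θ‖²/2
(`exists_event_forall_sum_integral_log_le`). The kurtosis and Cauchy-Schwarz turn the moments into
N(θ), κ and s₄², which gives `CritBound`. There are two signs and K grid points, each at level ε/K,
hence probability 1 - 2ε.

On that event everything else is deterministic. Evaluating the criterion at α = √(l/t) turns
`CritBound` into a quadratic inequality in 1 - N(θ)/t. Its sign analysis places N(θ) in the
confidence region (`phiMinus_Nhat_le`, `phiPlus_le_Nhat`). Conversely, for each energy in [σ, s₄²]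
some grid point is nearly optimal (`exists_eta_le`), so the region is narrow (`abs_sub_le_width`).

Thus G is feasible, the convex program has a solution Q, and ‖Q‖_F ≤ ‖G‖_F. This norm bound controls
the passage from the net to the sphere, and the quadratic forms of G and Q₊ differ by at most
B(N(θ)) (`abs_quad_sub_quad_Ghat_le`). By a Courant-Fischer argument the shrunk eigenvalues lie
below those of G, while G - G̃ has operator norm at most (5/2) B(λ₁). Expanding the Frobenius norm
in the two eigenbases gives doubly stochastic weights. The first r rows and columns are bounded by
the operator norm, the remaining block by the tail of the spectrum (`frob_cfc_sub_cfc_sq_le`). -/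

theorem quadratic_pos (v : ℝ) : 1 / 2 ≤ 1 + v + v ^ 2 / 2 := by nlinarith [sq_nonneg (1 + v)]

theorem psi_neg (t : ℝ) : psi (-t) = -psi t := by
  have h0 : ∀ t, 0 < t → psi (-t) = -psi t := by
    intro t ht
    rcases lt_trichotomy t 1 with h | rfl | h
    · rw [psi, psi, if_neg (by linarith), if_neg (by linarith), if_pos (by linarith),
        if_neg (by linarith), if_pos ht.le, neg_neg]
      ring_nf
    · norm_num [psi]
      rw [one_div, Real.log_inv]
    · rw [psi, psi, if_neg (by linarith), if_neg (by linarith), if_neg (by linarith),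
        if_pos h.le]
  rcases lt_trichotomy t 0 with h | rfl | h
  · rw [← neg_neg (psi (-t)), ← h0 (-t) (by linarith), neg_neg]
  · norm_num [psi]
  · exact h0 t h

theorem psi_of_mem {t : ℝ} (h0 : 0 ≤ t) (h1 : t ≤ 1) : psi t = -Real.log (1 - t + t ^ 2 / 2) := by
  unfold psi
  split_ifs with h
  · have : t = 1 := le_antisymm h1 h
    rw [this, show (1 - 1 + 1 ^ 2 / 2 : ℝ) = 2⁻¹ by norm_num, Real.log_inv, neg_neg]
  · rfl

theorem psi_of_one_le {t : ℝ} (h : 1 ≤ t) : psi t = Real.log 2 := by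
  simp [psi, h]

theorem psi_of_le_zero {t : ℝ} (h0 : t ≤ 0) (h1 : -1 ≤ t) :
    psi t = Real.log (1 + t + t ^ 2 / 2) := by
  have h := psi_neg (-t)
  rw [neg_neg] at h
  rw [h, psi_of_mem (by linarith) (by linarith), neg_neg]
  ring_nf

theorem psi_of_le_neg_one {t : ℝ} (h : t ≤ -1) : psi t = -Real.log 2 := by
  have h' := psi_neg (-t)
  rw [neg_neg] at h'
  rw [h', psi_of_one_le (by linarith)]

theorem psi_monotone : Monotone psi := by
  have hpos : MonotoneOn psi (Set.Ici 0) := by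
    intro s hs t ht hst
    simp only [Set.mem_Ici] at hs ht
    have key : ∀ u ∈ Set.Icc (0 : ℝ) 1, psi u ≤ Real.log 2 := by
      intro u hu
      rw [psi_of_mem hu.1 hu.2, ← Real.log_inv]
      apply Real.log_le_log
      · have := quadratic_pos (-u); rw [inv_pos]; nlinarith
      · rw [inv_le_comm₀ (by have := quadratic_pos (-u); nlinarith) two_pos]
        have := quadratic_pos (-u); nlinarith
    rcases le_total t 1 with h | h
    · rw [psi_of_mem hs (hst.trans h), psi_of_mem ht h, neg_le_neg_iff]
      apply Real.log_le_log
      · have := quadratic_pos (-t); nlinarith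
      · nlinarith
    · rw [psi_of_one_le h]
      rcases le_total s 1 with h' | h'
      · exact key s ⟨hs, h'⟩
      · rw [psi_of_one_le h']
  have hodd : ∀ t, psi t = -psi (-t) := fun t => by rw [psi_neg, neg_neg]
  have h0 : psi 0 = 0 := by rw [psi_of_mem le_rfl zero_le_one]; norm_num
  intro s t hst
  rcases le_total 0 s with hs | hs
  · exact hpos hs (hs.trans hst) hst
  · rcases le_total 0 t with ht | ht
    · have h1 := hpos (Set.mem_Ici.2 le_rfl) (Set.mem_Ici.2 ht) ht
      have h2 := hpos (Set.mem_Ici.2 le_rfl) (Set.mem_Ici.2 (neg_nonneg.2 hs)) (neg_nonneg.2 hs)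
      rw [hodd s]; linarith
    · rw [hodd s, hodd t, neg_le_neg_iff]
      exact hpos (neg_nonneg.2 ht) (neg_nonneg.2 hs) (neg_le_neg hst)

theorem psi_le_log_two (t : ℝ) : psi t ≤ Real.log 2 := by
  calc psi t ≤ psi (max t 1) := psi_monotone (le_max_left _ _)
    _ = _ := psi_of_one_le (le_max_right _ _)

theorem psi_le_log (t : ℝ) : psi t ≤ Real.log (1 + t + t ^ 2 / 2) := by
  have hq := quadratic_pos t
  rcases le_total 1 t with h | h
  · rw [psi_of_one_le h]
    exact Real.log_le_log two_pos (by nlinarith)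
  rcases le_total 0 t with h0 | h0
  · rw [psi_of_mem h0 h, ← Real.log_inv]
    have hq' := quadratic_pos (-t)
    apply Real.log_le_log (by rw [inv_pos]; nlinarith)
    rw [inv_le_iff_one_le_mul₀ (by nlinarith)]
    nlinarith [sq_nonneg (t ^ 2)]
  rcases le_total (-1) t with h1 | h1
  · rw [psi_of_le_zero h0 h1]
  · rw [psi_of_le_neg_one h1, ← Real.log_inv]
    exact Real.log_le_log (by norm_num) (by linarith)

/-! ### Semiconvexity of `v ↦ log (1 + v + v² / 2)` -/

theorem le_of_deriv_mul_sub_nonneg {g g' : ℝ → ℝ} {u : ℝ} (hg : ∀ v, HasDerivAt g (g' v) v)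
    (h : ∀ v, 0 ≤ g' v * (v - u)) (v : ℝ) : g u ≤ g v := by
  have hd : Differentiable ℝ g := fun v => (hg v).differentiableAt
  have hder : ∀ v, deriv g v = g' v := fun v => (hg v).deriv
  rcases le_total u v with huv | huv
  · refine monotoneOn_of_deriv_nonneg (convex_Ici u) hd.continuous.continuousOn
      hd.differentiableOn ?_ (Set.mem_Ici.2 le_rfl) huv huv
    intro x hx
    rw [interior_Ici] at hx
    rw [hder]
    exact nonneg_of_mul_nonneg_left (h x) (sub_pos.2 hx)
  · refine antitoneOn_of_deriv_nonpos (convex_Iic u) hd.continuous.continuousOn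
      hd.differentiableOn ?_ huv (Set.mem_Iic.2 le_rfl) huv
    intro x hx
    rw [interior_Iic] at hx
    rw [hder]
    by_contra hc
    push Not at hc
    have : g' x * (x - u) < 0 := mul_neg_of_pos_of_neg hc (sub_neg.2 hx)
    linarith [h x]

/-- With q = 1 + v + v²/2 the second derivative of log q is (1 - q)/q², which is smallest at q = 2,
where it equals -1/4. The proof writes the derivative of the gap, times v - u, as a sum of squares
over a positive denominator. -/
theorem log_quadratic_semiconvex (u v : ℝ) :
    Real.log (1 + u + u ^ 2 / 2) + (1 + u) / (1 + u + u ^ 2 / 2) * (v - u) - (v - u) ^ 2 / 8 ≤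
      Real.log (1 + v + v ^ 2 / 2) := by
  have hq : ∀ v : ℝ, 0 < 1 + v + v ^ 2 / 2 := fun v => by linarith [quadratic_pos v]
  have hd : ∀ v, HasDerivAt (fun v => Real.log (1 + v + v ^ 2 / 2) -
      (1 + u) / (1 + u + u ^ 2 / 2) * (v - u) + (v - u) ^ 2 / 8)
      ((1 + v) / (1 + v + v ^ 2 / 2) - (1 + u) / (1 + u + u ^ 2 / 2) + (v - u) / 4) v := by
    intro v
    have h1 : HasDerivAt (fun v : ℝ => 1 + v + v ^ 2 / 2) (1 + v) v := by
      have := ((hasDerivAt_id v).const_add 1).add (((hasDerivAt_id v).pow 2).div_const 2)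
      convert! this using 1
      simp
    have h2 : HasDerivAt (fun v : ℝ => v - u) 1 v := (hasDerivAt_id v).sub_const u
    have := ((h1.log (hq v).ne').sub (h2.const_mul ((1 + u) / (1 + u + u ^ 2 / 2)))).add
      ((h2.pow 2).div_const 8)
    convert! this using 1
    simp
    ring
  have := le_of_deriv_mul_sub_nonneg (u := u) hd (fun v => ?_) v
  · simp only [sub_self, mul_zero, sub_zero] at this
    linarith
  · have hu := hq u
    have hv := hq v
    have : ((1 + v) / (1 + v + v ^ 2 / 2) - (1 + u) / (1 + u + u ^ 2 / 2) + (v - u) / 4) * (v - u)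
        = (v - u) ^ 2 * (((1 + u) * (1 + v) - 3) ^ 2 + (v - u) ^ 2) /
          (16 * (1 + v + v ^ 2 / 2) * (1 + u + u ^ 2 / 2)) := by
      generalize hA : 1 + u + u ^ 2 / 2 = A at hu ⊢
      generalize hB : 1 + v + v ^ 2 / 2 = B at hv ⊢
      have hu' := hu.ne'
      have hv' := hv.ne'
      field_simp
      rw [← hA, ← hB]
      ring
    rw [this]
    exact div_nonneg (by positivity)
      (mul_nonneg (mul_nonneg (by norm_num) hv.le) hu.le)

/-! ### Concave parabolas between `psi` and the truncated logarithm -/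

/-- An upper bound for the truncation level of the exponential of the influence function. -/
def truncLevel : ℝ := 13 / 8 * Real.exp (144 / 169)

theorem truncLevel_pos : 0 < truncLevel := by unfold truncLevel; positivity

theorem log_truncLevel : Real.log truncLevel = Real.log (13 / 8) + 144 / 169 := by
  rw [truncLevel, Real.log_mul (by norm_num) (by positivity), Real.log_exp]

theorem parabola_le (y d z : ℝ) : y + d * z - z ^ 2 / 4 ≤ y + d ^ 2 := by
  nlinarith [sq_nonneg (z - 2 * d)]

/-- The parabola has the value and slope of log(1 + v + v²/2) at v = 1/2. At 1/2 it lies above `psi`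
because (13/8)(5/8) = 65/64 ≥ 1, and the gap increases up to 1. -/
theorem psi_le_parabola {u : ℝ} (h0 : 1 / 2 ≤ u) (h1 : u ≤ 1) :
    psi u ≤ Real.log (13 / 8) + 12 / 13 * (u - 1 / 2) - (u - 1 / 2) ^ 2 / 4 := by
  have hq : ∀ v : ℝ, 0 < 1 - v + v ^ 2 / 2 := fun v => by
    have := quadratic_pos (-v); nlinarith
  have hd : ∀ v, HasDerivAt (fun v => 12 / 13 * (v - 1 / 2) - (v - 1 / 2) ^ 2 / 4 +
      Real.log (1 - v + v ^ 2 / 2))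
      (12 / 13 - (v - 1 / 2) / 2 - (1 - v) / (1 - v + v ^ 2 / 2)) v := by
    intro v
    have h1 : HasDerivAt (fun v : ℝ => 1 - v + v ^ 2 / 2) (-1 + v) v := by
      have := ((hasDerivAt_id v).const_sub 1).add (((hasDerivAt_id v).pow 2).div_const 2)
      convert! this using 1
      simp
    have h2 : HasDerivAt (fun v : ℝ => v - 1 / 2) 1 v := (hasDerivAt_id v).sub_const _
    have := ((h2.const_mul (12 / 13)).sub ((h2.pow 2).div_const 4)).add (h1.log (hq v).ne')
    convert! this using 1
    simp
    ring
  have hmono : MonotoneOn (fun v => 12 / 13 * (v - 1 / 2) - (v - 1 / 2) ^ 2 / 4 +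
      Real.log (1 - v + v ^ 2 / 2)) (Set.Icc (1 / 2 : ℝ) 1) := by
    refine monotoneOn_of_deriv_nonneg (convex_Icc _ _)
      (fun v _ => (hd v).continuousAt.continuousWithinAt)
      (fun v _ => (hd v).differentiableAt.differentiableWithinAt) ?_
    intro v hv
    rw [interior_Icc] at hv
    rw [(hd v).deriv, sub_nonneg, div_le_iff₀ (hq v)]
    obtain ⟨ha, hb⟩ := hv
    nlinarith [mul_pos (sub_pos.2 ha) (sub_pos.2 hb), mul_pos (mul_pos (sub_pos.2 ha) (sub_pos.2 hb)) (sub_pos.2 ha)]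
  have := hmono ⟨le_rfl, by norm_num⟩ ⟨h0, h1⟩ h0
  have h58 : Real.log (1 - 1 / 2 + (1 / 2) ^ 2 / 2) = Real.log (5 / 8) := by norm_num
  simp only [sub_self, mul_zero, h58] at this
  have h3 : 0 ≤ Real.log (13 / 8) + Real.log (5 / 8) := by
    rw [← Real.log_mul (by norm_num) (by norm_num)]
    exact Real.log_nonneg (by norm_num)
  rw [psi_of_mem (by linarith) h1]
  linarith

/-- The curvature is twice what semiconvexity requires: the spare part is what keeps the maximum of
each parabola, y + d², below log `truncLevel`. The extremal case is u = 1/2, where y = log(13/8) and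
d = 12/13, and this defines `truncLevel`. -/
theorem exists_parabola_le (u : ℝ) : ∃ d : ℝ, ∀ v : ℝ,
    psi u + d * (v - u) - (v - u) ^ 2 / 4 ≤ Real.log (1 + v + v ^ 2 / 2) ∧
    psi u + d * (v - u) - (v - u) ^ 2 / 4 ≤ Real.log truncLevel := by
  have hM : (0 : ℝ) ≤ Real.log truncLevel := by
    rw [log_truncLevel]
    have := Real.log_nonneg (show (1 : ℝ) ≤ 13 / 8 by norm_num)
    linarith
  have hpar : ∀ v : ℝ, Real.log (13 / 8) + 12 / 13 * (v - 1 / 2) - (v - 1 / 2) ^ 2 / 4 ≤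
      Real.log (1 + v + v ^ 2 / 2) := by
    intro v
    have := log_quadratic_semiconvex (1 / 2) v
    norm_num at this ⊢
    nlinarith [sq_nonneg (v - 1 / 2)]
  rcases le_total u (-1) with h | h
  · refine ⟨0, fun v => ?_⟩
    rw [psi_of_le_neg_one h]
    have h2 : -Real.log 2 ≤ Real.log (1 + v + v ^ 2 / 2) := by
      rw [← Real.log_inv]
      exact Real.log_le_log (by norm_num) (by linarith [quadratic_pos v])
    have h3 := Real.log_nonneg (one_le_two : (1 : ℝ) ≤ 2)
    constructor <;> nlinarith [sq_nonneg (v - u)]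
  rcases le_total u (1 / 2) with h' | h'
  · refine ⟨(1 + u) / (1 + u + u ^ 2 / 2), fun v => ⟨?_, ?_⟩⟩
    · have h1 := log_quadratic_semiconvex u v
      have h2 := psi_le_log u
      nlinarith [sq_nonneg (v - u)]
    · refine (parabola_le _ _ _).trans ?_
      set q := 1 + u + u ^ 2 / 2 with hq
      have hq0 : 1 / 2 ≤ q := quadratic_pos u
      have hq1 : q ≤ 13 / 8 := by nlinarith
      have hsq : (1 + u) ^ 2 = 2 * q - 1 := by rw [hq]; ring
      have h2 := psi_le_log u
      rw [← hq] at h2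
      have h3 : Real.log (q / (13 / 8)) ≤ q / (13 / 8) - 1 :=
        Real.log_le_sub_one_of_pos (by positivity)
      rw [Real.log_div (by positivity) (by norm_num)] at h3
      -- Here (2q - 1)/q² is the square of the slope. The affine bound on the right is an equality
      -- at q = 13/8 and offsets the tangent bound for log q.
      have h4 : (2 * q - 1) / q ^ 2 ≤ 313 / 169 - 8 / 13 * q := by
        rw [div_le_iff₀ (by positivity)]
        nlinarith [mul_nonneg (sub_nonneg.2 hq1)
          (by nlinarith [sq_nonneg (q - 9 / 13)] : 0 ≤ 13 * q ^ 2 - 18 * q + 13)]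
      rw [log_truncLevel, div_pow, hsq]
      linarith
  rcases le_total u (1 / 2 + 24 / 13) with h'' | h''
  -- This slope makes the parabola based at u a downward translate of the one based at 1/2, whose
  -- vertex is 1/2 + 24/13; up to that vertex it stays above `psi`.
  · refine ⟨12 / 13 - (u - 1 / 2) / 2, fun v => ?_⟩
    have hle : psi u ≤ Real.log (13 / 8) + 12 / 13 * (u - 1 / 2) - (u - 1 / 2) ^ 2 / 4 := by
      rcases le_total u 1 with h1 | h1
      · exact psi_le_parabola h' h1
      · refine (psi_le_log_two u).trans ?_
        have := psi_le_parabola (u := 1) (by norm_num) le_rfl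
        rw [psi_of_one_le le_rfl] at this
        nlinarith
    have : psi u + (12 / 13 - (u - 1 / 2) / 2) * (v - u) - (v - u) ^ 2 / 4 ≤
        Real.log (13 / 8) + 12 / 13 * (v - 1 / 2) - (v - 1 / 2) ^ 2 / 4 := by
      nlinarith
    refine ⟨this.trans (hpar v), this.trans ?_⟩
    rw [log_truncLevel]
    have := parabola_le (Real.log (13 / 8)) (12 / 13) (v - 1 / 2)
    linarith
  -- Beyond the vertex 1/2 + 24/13 a parabola with its top at u suffices: to the left of that vertex
  -- it is below the previous one, to the right the logarithm increases.
  · refine ⟨0, fun v => ?_⟩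
    have hpsi : psi u ≤ Real.log truncLevel := by
      refine (psi_le_log_two u).trans ?_
      have := psi_le_parabola (u := 1) (by norm_num) le_rfl
      rw [psi_of_one_le le_rfl] at this
      rw [log_truncLevel]
      norm_num at this ⊢
      linarith
    refine ⟨?_, by nlinarith [sq_nonneg (v - u)]⟩
    have hpv := hpar v
    rw [log_truncLevel] at hpsi
    rcases le_total v (1 / 2 + 24 / 13) with hv | hv
    · refine le_trans ?_ hpv
      nlinarith
    · have h1 := hpar (1 / 2 + 24 / 13)
      have h2 : Real.log (1 + (1 / 2 + 24 / 13) + (1 / 2 + 24 / 13) ^ 2 / 2) ≤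
          Real.log (1 + v + v ^ 2 / 2) :=
        Real.log_le_log (by positivity) (by nlinarith)
      refine le_trans ?_ h2
      refine le_trans ?_ h1
      nlinarith [sq_nonneg (v - u)]

/-! ### Moments of the Gaussian law -/

open scoped NNReal in
theorem gaussianReal_integrable_pow (v : ℝ≥0) (n : ℕ) :
    Integrable (fun y : ℝ => y ^ n) (gaussianReal 0 v) := by
  have h := (memLp_id_gaussianReal' (μ := 0) (v := v) n (by simp)).integrable_norm_pow'
  refine (integrable_norm_iff (by fun_prop)).1 ?_
  simpa using h

-- The moments are the successive derivatives at 0 of the moment generating function exp(v t²/2).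
open scoped NNReal in
theorem gaussianReal_moments (v : ℝ≥0) :
    ∫ y, y ∂gaussianReal 0 v = 0 ∧ ∫ y, y ^ 2 ∂gaussianReal 0 v = v ∧
      ∫ y, y ^ 3 ∂gaussianReal 0 v = 0 ∧ ∫ y, y ^ 4 ∂gaussianReal 0 v = 3 * v ^ 2 := by
  have hI : ∀ t : ℝ, t ∈ interior (integrableExpSet id (gaussianReal 0 v)) := fun t => by
    simp [integrableExpSet_id_gaussianReal]
  have hd : ∀ (n : ℕ) (t : ℝ), HasDerivAt (fun t => ∫ y, y ^ n * Real.exp (t * y) ∂gaussianReal 0 v)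
      (∫ y, y ^ (n + 1) * Real.exp (t * y) ∂gaussianReal 0 v) t := fun n t => by
    simpa using hasDerivAt_integral_pow_mul_exp_real (hI t) n
  have hexp : ∀ t : ℝ, HasDerivAt (fun t : ℝ => Real.exp (v * t ^ 2 / 2))
      (v * t * Real.exp (v * t ^ 2 / 2)) t := fun t => by
    have := ((((hasDerivAt_id t).pow 2).const_mul (v : ℝ)).div_const 2).exp
    convert! this using 1
    simp
    ring
  have h0 : (fun t => ∫ y, y ^ 0 * Real.exp (t * y) ∂gaussianReal 0 v) =
      fun t => Real.exp (v * t ^ 2 / 2) := by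
    have := mgf_id_gaussianReal (μ := 0) (v := v)
    ext t
    have := congrFun this t
    simpa [mgf] using this
  have h1 : (fun t => ∫ y, y ^ 1 * Real.exp (t * y) ∂gaussianReal 0 v) =
      fun t => v * t * Real.exp (v * t ^ 2 / 2) := by
    ext t
    have := hd 0 t
    rw [h0] at this
    exact this.unique (hexp t)
  have h2 : (fun t => ∫ y, y ^ 2 * Real.exp (t * y) ∂gaussianReal 0 v) =
      fun t => (v + (v * t) ^ 2) * Real.exp (v * t ^ 2 / 2) := by
    ext t
    have := hd 1 t
    rw [h1] at this
    refine this.unique ?_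
    convert! (((hasDerivAt_id t).const_mul (v : ℝ)).mul (hexp t)) using 1
    simp
    ring
  have h3 : (fun t => ∫ y, y ^ 3 * Real.exp (t * y) ∂gaussianReal 0 v) =
      fun t => (3 * v ^ 2 * t + (v * t) ^ 3) * Real.exp (v * t ^ 2 / 2) := by
    ext t
    have := hd 2 t
    rw [h2] at this
    refine this.unique ?_
    convert! (((((hasDerivAt_id t).const_mul (v : ℝ)).pow 2).const_add (v : ℝ)).mul (hexp t)) using 1
    simp
    ring
  have h4 : (fun t => ∫ y, y ^ 4 * Real.exp (t * y) ∂gaussianReal 0 v) =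
      fun t => (3 * v ^ 2 + 6 * v ^ 3 * t ^ 2 + (v * t) ^ 4) * Real.exp (v * t ^ 2 / 2) := by
    ext t
    have := hd 3 t
    rw [h3] at this
    refine this.unique ?_
    convert! ((((hasDerivAt_id t).const_mul (3 * (v : ℝ) ^ 2)).add
      (((hasDerivAt_id t).const_mul (v : ℝ)).pow 3)).mul (hexp t)) using 1
    simp
    ring
  refine ⟨?_, ?_, ?_, ?_⟩
  · simp
  · simpa using congrFun h2 0
  · simpa using congrFun h3 0
  · simpa using congrFun h4 0

open scoped NNReal in
/-- Integration of a quartic polynomial against a centred Gaussian law. -/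
theorem gaussianReal_quartic (v : ℝ≥0) (a b c d e : ℝ) :
    Integrable (fun y : ℝ => a + b * y + c * y ^ 2 + d * y ^ 3 + e * y ^ 4) (gaussianReal 0 v) ∧
    ∫ y, (a + b * y + c * y ^ 2 + d * y ^ 3 + e * y ^ 4) ∂gaussianReal 0 v =
      a + c * v + 3 * e * v ^ 2 := by
  obtain ⟨m1, m2, m3, m4⟩ := gaussianReal_moments v
  have i1 : Integrable (fun y : ℝ => y) (gaussianReal 0 v) := by
    simpa using gaussianReal_integrable_pow v 1
  have i2 := gaussianReal_integrable_pow v 2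
  have i3 := gaussianReal_integrable_pow v 3
  have i4 := gaussianReal_integrable_pow v 4
  have j0 : Integrable (fun _ : ℝ => a) (gaussianReal 0 v) := integrable_const a
  have j1 := i1.const_mul b
  have j2 := i2.const_mul c
  have j3 := i3.const_mul d
  have j4 := i4.const_mul e
  have k1 : Integrable (fun y : ℝ => a + b * y) (gaussianReal 0 v) := j0.add j1
  have k2 : Integrable (fun y : ℝ => a + b * y + c * y ^ 2) (gaussianReal 0 v) := k1.add j2
  have k3 : Integrable (fun y : ℝ => a + b * y + c * y ^ 2 + d * y ^ 3) (gaussianReal 0 v) :=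
    k2.add j3
  refine ⟨k3.add j4, ?_⟩
  rw [integral_add k3 j4, integral_add k2 j3, integral_add k1 j2, integral_add j0 j1]
  have e1 : ∫ y, b * y ∂gaussianReal 0 v = 0 := by
    rw [integral_const_mul b (fun y : ℝ => y), m1, mul_zero]
  simp only [integral_const_mul, e1, m2, m3, m4, integral_const, probReal_univ, smul_eq_mul]
  ring

/-! ### The influence function is dominated by a Gaussian average -/

/-- This is the only numerical property of `cst` that the smoothing argument uses besides its sign:
the added term must outweigh the truncation at level `truncLevel`. -/
theorem truncLevel_le : 15 * truncLevel ≤ cst * (2 * Real.log 2) := by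
  have hl : 0 < Real.log 2 := Real.log_pos one_lt_two
  have h2 : (1.4 : ℝ) ≤ Real.sqrt 2 := Real.le_sqrt_of_sq_le (by norm_num)
  have h2' : Real.sqrt 2 ≤ 1.415 := by rw [Real.sqrt_le_left (by norm_num)]; norm_num
  have e1 : cst * (2 * Real.log 2) =
      15 / (4 * (Real.sqrt 2 - 1)) * Real.exp ((1 + 2 * Real.sqrt 2) / 2) := by
    have : Real.sqrt 2 - 1 ≠ 0 := by linarith
    rw [cst]
    field_simp
    norm_num
  have e2 : (15 : ℝ) / (4 * (Real.sqrt 2 - 1)) ≥ 15 * 0.6 := by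
    rw [ge_iff_le, le_div_iff₀ (by linarith)]
    linarith
  have e3 : Real.exp ((1 + 2 * Real.sqrt 2) / 2) ≥ 2.7 * 1.04 * Real.exp (144 / 169) := by
    have h3 : (1 : ℝ) + 0.04 + 144 / 169 ≤ (1 + 2 * Real.sqrt 2) / 2 := by linarith
    have h4 := Real.exp_le_exp.2 h3
    rw [Real.exp_add, Real.exp_add] at h4
    have h5 := Real.exp_one_gt_d9
    have h6 := Real.add_one_le_exp (0.04 : ℝ)
    have h7 : (2.7 : ℝ) * 1.04 ≤ Real.exp 1 * Real.exp 0.04 :=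
      mul_le_mul (by linarith) (by linarith) (by norm_num) (by positivity)
    refine le_trans ?_ h4
    gcongr
  rw [e1, truncLevel]
  have := mul_le_mul e2 e3 (by positivity) (by linarith)
  have h8 := Real.exp_pos (144 / 169 : ℝ)
  nlinarith

theorem cst_pos : 0 < cst := by
  have h2 : (1 : ℝ) < Real.sqrt 2 := by rw [Real.lt_sqrt (by norm_num)]; norm_num
  have hl : 0 < Real.log 2 := Real.log_pos one_lt_two
  have : 0 < Real.sqrt 2 - 1 := by linarith
  unfold cst
  positivity

/-- The convex function exp(2A) lies below its chord on [0, 2 log 2], which goes from 1 to 16; this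
is the origin of the factor 15. -/
theorem le_half_log {A X : ℝ} (h0 : 0 ≤ A) (h1 : A ≤ 2 * Real.log 2)
    (hX : 15 * A / (2 * Real.log 2) ≤ X) : A ≤ 1 / 2 * Real.log (1 + X) := by
  have hl : 0 < Real.log 2 := Real.log_pos one_lt_two
  set t := A / (2 * Real.log 2) with ht
  have ht0 : 0 ≤ t := by positivity
  have ht1 : t ≤ 1 := by rw [ht, div_le_one (by positivity)]; exact h1
  have hA : 2 * A = (1 - t) * 0 + t * Real.log 16 := by
    rw [show (16 : ℝ) = 2 ^ 4 by norm_num, Real.log_pow, ht]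
    field_simp
    ring
  have hc := convexOn_exp.2 (Set.mem_univ (0 : ℝ)) (Set.mem_univ (Real.log 16))
    (sub_nonneg.2 ht1) ht0 (by ring)
  simp only [smul_eq_mul] at hc
  rw [← hA, Real.exp_log (by norm_num), Real.exp_zero] at hc
  have hX' : 15 * t ≤ X := by rw [ht, ← mul_div_assoc]; exact hX
  have : 2 * A ≤ Real.log (1 + X) := by
    rw [Real.le_log_iff_exp_le (by linarith [mul_nonneg (by norm_num : (0:ℝ) ≤ 15) ht0])]
    linarith
  linarith

theorem integrable_log_of_half_le {α : Type*} [MeasurableSpace α] {ν : Measure α}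
    [IsFiniteMeasure ν] {f : α → ℝ} (hf : Integrable f ν) (h : ∀ a, 1 / 2 ≤ f a) :
    Integrable (fun a => Real.log (f a)) ν := by
  refine Integrable.mono' ((integrable_const (Real.log 2)).add hf)
    (Real.measurable_log.comp_aemeasurable hf.aemeasurable).aestronglyMeasurable ?_
  refine Filter.Eventually.of_forall fun a => ?_
  have ha := h a
  have h2 := Real.log_pos one_lt_two
  rw [Real.norm_eq_abs, abs_le, Pi.add_apply]
  constructor
  · have : Real.log (1 / 2) ≤ Real.log (f a) := Real.log_le_log (by norm_num) ha
    rw [one_div, Real.log_inv] at this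
    linarith
  · have := Real.log_le_sub_one_of_pos (show 0 < f a by linarith)
    linarith

-- The Gaussian law is symmetric, and one of y and -y satisfies |m + y| ≥ |m|. Only half of the mass
-- is used, hence the factor 1/2.
open scoped NNReal in
theorem half_log_le_integral (v : ℝ≥0) {C : ℝ} (hC : 0 ≤ C) (m : ℝ) :
    Integrable (fun y => Real.log (1 + C * ((m + y) ^ 2 + v / 2))) (gaussianReal 0 v) ∧
    1 / 2 * Real.log (1 + C * (m ^ 2 + v / 2)) ≤
      ∫ y, Real.log (1 + C * ((m + y) ^ 2 + v / 2)) ∂gaussianReal 0 v := by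
  set f : ℝ → ℝ := fun y => Real.log (1 + C * ((m + y) ^ 2 + v / 2)) with hf
  have hv : (0 : ℝ) ≤ v := v.2
  have hi : Integrable f (gaussianReal 0 v) := by
    refine integrable_log_of_half_le ?_ (fun y => ?_)
    · have := (gaussianReal_quartic v (1 + C * (m ^ 2 + v / 2)) (2 * C * m) C 0 0).1
      refine this.congr (Filter.Eventually.of_forall fun y => ?_)
      simp only
      ring
    · have : 0 ≤ C * ((m + y) ^ 2 + v / 2) := by positivity
      linarith
  refine ⟨hi, ?_⟩
  have hneg : (gaussianReal 0 v).map (fun x => -x) = gaussianReal 0 v := by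
    rw [gaussianReal_map_neg, neg_zero]
  have hi' : Integrable (fun y => f (-y)) (gaussianReal 0 v) := by
    rw [← hneg] at hi
    exact (integrable_map_measure hi.1 (by fun_prop)).1 hi
  have hsym : ∫ y, f (-y) ∂gaussianReal 0 v = ∫ y, f y ∂gaussianReal 0 v := by
    conv_rhs => rw [← hneg]
    rw [integral_map (by fun_prop)]
    rw [hneg]
    exact hi.1
  have hle : ∀ y, Real.log (1 + C * (m ^ 2 + v / 2)) ≤ f y + f (-y) := by
    intro y
    have hpos : ∀ y, 0 ≤ f y := fun y => Real.log_nonneg (by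
      have : 0 ≤ C * ((m + y) ^ 2 + v / 2) := by positivity
      linarith)
    have hone : ∀ y, 0 ≤ m * y → Real.log (1 + C * (m ^ 2 + v / 2)) ≤ f y := by
      intro y hy
      refine Real.log_le_log (by positivity) ?_
      have : m ^ 2 ≤ (m + y) ^ 2 := by nlinarith [sq_nonneg y]
      gcongr
    rcases le_total 0 (m * y) with h | h
    · linarith [hone y h, hpos (-y)]
    · linarith [hone (-y) (by linarith), hpos y]
  have := integral_mono (integrable_const _) (hi.add hi') hle
  rw [integral_const, probReal_univ, one_smul, integral_add' hi hi', hsym] at this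
  linarith

open scoped NNReal in
/-- The smoothed logarithm dominates the influence function. Here `ς = ±1`. -/
theorem psi_le_gaussian_integral_log (v : ℝ≥0) {ς : ℝ} (hς : ς ^ 2 = 1) (m l : ℝ) :
    psi (ς * (m ^ 2 - l)) ≤ ∫ y, Real.log (1 + ς * ((m + y) ^ 2 - v - l) +
      ((m + y) ^ 2 - v - l) ^ 2 / 2 + cst * v * ((m + y) ^ 2 + v / 2)) ∂gaussianReal 0 v := by
  have hv : (0 : ℝ) ≤ v := v.2
  have hc := cst_pos
  have hM := truncLevel_pos
  have hl2 : 0 < Real.log 2 := Real.log_pos one_lt_two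
  set w : ℝ → ℝ := fun y => cst * v * ((m + y) ^ 2 + v / 2) with hw
  have hw0 : ∀ y, 0 ≤ w y := fun y => by positivity
  set V : ℝ → ℝ := fun y => ς * ((m + y) ^ 2 - v - l) with hV
  have hVsq : ∀ y, V y ^ 2 = ((m + y) ^ 2 - v - l) ^ 2 := fun y => by
    rw [hV]; simp only; rw [mul_pow, hς, one_mul]
  have hF : ∀ y, 1 + ς * ((m + y) ^ 2 - v - l) + ((m + y) ^ 2 - v - l) ^ 2 / 2 +
      cst * v * ((m + y) ^ 2 + v / 2) = 1 + V y + V y ^ 2 / 2 + w y := fun y => by rw [hVsq]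
  simp_rw [hF]
  have hFi : Integrable (fun y => 1 + V y + V y ^ 2 / 2 + w y) (gaussianReal 0 v) := by
    have := (gaussianReal_quartic v
      (1 + ς * (m ^ 2 - v - l) + (m ^ 2 - v - l) ^ 2 / 2 + cst * v * (m ^ 2 + v / 2))
      (2 * ς * m + 2 * m * (m ^ 2 - v - l) + cst * v * (2 * m))
      (ς + ((m ^ 2 - v - l) + 2 * m ^ 2) + cst * v) (2 * m) (1 / 2)).1
    refine this.congr (Filter.Eventually.of_forall fun y => ?_)
    simp only [hVsq]
    simp only [hV, hw]
    ring
  have hlogF : Integrable (fun y => Real.log (1 + V y + V y ^ 2 / 2 + w y)) (gaussianReal 0 v) :=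
    integrable_log_of_half_le hFi fun y => by linarith [quadratic_pos (V y), hw0 y]
  set A : ℝ := v * (m ^ 2 + v / 2) with hA
  have hA0 : 0 ≤ A := by positivity
  rcases le_total A (2 * Real.log 2) with hAle | hAge
  -- V - u = ς(2my + y² - v) is centred with variance 4A, so the parabola τ has mean `psi u` - A.
  -- The loss A is recovered below from the added term w.
  · obtain ⟨d, hd⟩ := exists_parabola_le (ς * (m ^ 2 - l))
    set u := ς * (m ^ 2 - l) with hu
    have hτ := gaussianReal_quartic v
      (psi u + d * (ς * (-v)) - v ^ 2 / 4)
      (d * (ς * (2 * m)) + v * m)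
      (d * ς - m ^ 2 + v / 2) (- m) (-1 / 4)
    have hτe : ∀ y : ℝ, psi u + d * (ς * (-v)) - v ^ 2 / 4 + (d * (ς * (2 * m)) + v * m) * y +
        (d * ς - m ^ 2 + v / 2) * y ^ 2 + (- m) * y ^ 3 + (-1 / 4) * y ^ 4 =
        psi u + d * (V y - u) - (V y - u) ^ 2 / 4 := by
      intro y
      have e1 : V y - u = ς * (2 * m * y + y ^ 2 - v) := by simp only [hV, hu]; ring
      rw [e1, mul_pow, hς]
      ring
    simp_rw [hτe] at hτ
    obtain ⟨hi2, hlog⟩ := half_log_le_integral v (show 0 ≤ cst * v / truncLevel by positivity) m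
    -- Since exp τ is below both 1 + V + V²/2 and `truncLevel`, the product exp τ · (1 +
    -- w/`truncLevel`) is at most 1 + V + V²/2 + w.
    have hpt : ∀ y, psi u + d * (V y - u) - (V y - u) ^ 2 / 4 +
        Real.log (1 + cst * v / truncLevel * ((m + y) ^ 2 + v / 2)) ≤
        Real.log (1 + V y + V y ^ 2 / 2 + w y) := by
      intro y
      obtain ⟨h1, h2⟩ := hd (V y)
      set τ := psi u + d * (V y - u) - (V y - u) ^ 2 / 4
      have hq := quadratic_pos (V y)
      have h1' : Real.exp τ ≤ 1 + V y + V y ^ 2 / 2 := (Real.le_log_iff_exp_le (by linarith)).1 h1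
      have h2' : Real.exp τ ≤ truncLevel := (Real.le_log_iff_exp_le hM).1 h2
      have e2 : cst * v / truncLevel * ((m + y) ^ 2 + v / 2) = w y / truncLevel := by
        simp only [hw]; ring
      rw [e2]
      have h3 : 0 < 1 + w y / truncLevel := by have := hw0 y; positivity
      rw [← Real.log_exp τ, ← Real.log_mul (Real.exp_pos _).ne' h3.ne']
      refine Real.log_le_log (mul_pos (Real.exp_pos _) h3) ?_
      have h4 : Real.exp τ * (w y / truncLevel) ≤ w y := by
        rw [← mul_div_assoc, div_le_iff₀ hM, mul_comm]
        exact mul_le_mul_of_nonneg_left h2' (hw0 y)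
      linarith
    have hint := integral_mono (hτ.1.add hi2) hlogF hpt
    simp only [Pi.add_apply] at hint
    rw [integral_add hτ.1 hi2, hτ.2] at hint
    have hX : 15 * A / (2 * Real.log 2) ≤ cst * v / truncLevel * (m ^ 2 + v / 2) := by
      have e3 : cst * v / truncLevel * (m ^ 2 + v / 2) = cst / truncLevel * A := by
        rw [hA]; ring
      have e4 : 15 * A / (2 * Real.log 2) = 15 / (2 * Real.log 2) * A := by ring
      rw [e3, e4]
      refine mul_le_mul_of_nonneg_right ?_ hA0
      rw [div_le_div_iff₀ (by positivity) hM]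
      exact truncLevel_le
    have hhalf := le_half_log hA0 hAle hX
    have hAe : A = v * m ^ 2 + v ^ 2 / 2 := by rw [hA]; ring
    linarith
  -- For large A the term w alone is enough: 1 + V + V²/2 ≥ 1/2, and the average is at least -log 2
  -- + (1/2) log 16 = log 2, the maximum of `psi`.
  · obtain ⟨hi2, hlog⟩ := half_log_le_integral v (show 0 ≤ 2 * (cst * v) by positivity) m
    have hpt : ∀ y, -Real.log 2 + Real.log (1 + 2 * (cst * v) * ((m + y) ^ 2 + v / 2)) ≤
        Real.log (1 + V y + V y ^ 2 / 2 + w y) := by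
      intro y
      have hq := quadratic_pos (V y)
      have e2 : 2 * (cst * v) * ((m + y) ^ 2 + v / 2) = 2 * w y := by simp only [hw]; ring
      have h3 : 0 < 1 + 2 * w y := by have := hw0 y; positivity
      rw [e2, ← Real.log_inv, ← Real.log_mul (by norm_num) h3.ne']
      exact Real.log_le_log (by positivity) (by linarith)
    have hint := integral_mono ((integrable_const _).add hi2) hlogF hpt
    simp only [Pi.add_apply] at hint
    rw [integral_add (integrable_const _) hi2, integral_const, probReal_univ, one_smul] at hint
    have h16 : (16 : ℝ) ≤ 1 + 2 * (cst * v) * (m ^ 2 + v / 2) := by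
      have e3 : 2 * (cst * v) * (m ^ 2 + v / 2) = 2 * cst * A := by rw [hA]; ring
      have h1 : (1 : ℝ) ≤ truncLevel := by
        have := Real.one_le_exp (show (0 : ℝ) ≤ 144 / 169 by norm_num)
        unfold truncLevel
        linarith
      have h2 : cst * (2 * Real.log 2) ≤ cst * A := mul_le_mul_of_nonneg_left hAge hc.le
      rw [e3]
      linarith [truncLevel_le]
    have h5 : Real.log 16 ≤ Real.log (1 + 2 * (cst * v) * (m ^ 2 + v / 2)) :=
      Real.log_le_log (by norm_num) h16
    rw [show (16 : ℝ) = 2 ^ 4 by norm_num, Real.log_pow] at h5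
    have := psi_le_log_two (ς * (m ^ 2 - l))
    norm_num at h5
    linarith

/-! ### Translations of the standard Gaussian law -/

theorem pi_withDensity {ι : Type*} [Fintype ι] {α : ι → Type*} [∀ i, MeasurableSpace (α i)]
    (ν : ∀ i, Measure (α i)) [∀ i, IsProbabilityMeasure (ν i)] (f : ∀ i, α i → ENNReal)
    (hf : ∀ i, Measurable (f i)) [∀ i, SigmaFinite ((ν i).withDensity (f i))] :
    Measure.pi (fun i => (ν i).withDensity (f i)) =
      (Measure.pi ν).withDensity (fun x => ∏ i, f i (x i)) := by
  refine Measure.pi_eq fun s hs => ?_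
  rw [withDensity_apply _ (MeasurableSet.univ_pi hs),
    ← lintegral_indicator (MeasurableSet.univ_pi hs)]
  have h1 : (Set.univ.pi s).indicator (fun x => ∏ i, f i (x i)) =
      fun x => ∏ i, (s i).indicator (f i) (x i) := by
    ext x
    by_cases hx : x ∈ Set.univ.pi s
    · rw [Set.indicator_of_mem hx]
      exact Finset.prod_congr rfl fun i _ =>
        (Set.indicator_of_mem (hx i (Set.mem_univ i)) _).symm
    · rw [Set.indicator_of_notMem hx]
      simp only [Set.mem_pi, Set.mem_univ, true_implies, not_forall] at hx
      obtain ⟨i, hi⟩ := hx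
      exact (Finset.prod_eq_zero (Finset.mem_univ i) (Set.indicator_of_notMem hi _)).symm
  have hm : ∀ i, Measurable ((s i).indicator (f i)) := fun i => (hf i).indicator (hs i)
  rw [h1, lintegral_prod_eq_prod_lintegral_of_indepFun Finset.univ
    (fun i (x : ∀ i, α i) => (s i).indicator (f i) (x i))
    (iIndepFun_pi fun i => (hm i).aemeasurable) (fun i => (hm i).comp (measurable_pi_apply i))]
  refine Finset.prod_congr rfl fun i _ => ?_
  rw [withDensity_apply _ (hs i), ← lintegral_indicator (hs i)]
  exact (measurePreserving_eval ν i).lintegral_comp (hm i)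

theorem gaussianReal_translate (h : ℝ) :
    (gaussianReal 0 1).map (fun x => x + h) =
      (gaussianReal 0 1).withDensity (fun x => ENNReal.ofReal (Real.exp (h * x - h ^ 2 / 2))) := by
  rw [gaussianReal_map_add_const, gaussianReal_of_var_ne_zero _ one_ne_zero,
    gaussianReal_of_var_ne_zero _ one_ne_zero, ← withDensity_mul _ (measurable_gaussianPDF _ _)
      (by fun_prop)]
  congr 1
  ext x
  simp only [gaussianPDF, gaussianPDFReal, Pi.mul_apply]
  rw [← ENNReal.ofReal_mul (by positivity), mul_assoc (Real.sqrt _)⁻¹, ← Real.exp_add]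
  congr 3
  simp
  ring

/-- The Cameron-Martin formula; the mean of its log-density under the translated law is the relative
entropy ‖h‖²/2. -/
theorem stdGaussian_lintegral_translate {d : ℕ} (h : Vec d) {F : Vec d → ENNReal}
    (hF : Measurable F) :
    ∫⁻ y, F (y + h) ∂stdGaussian (Vec d) =
      ∫⁻ y, F y * ENNReal.ofReal (Real.exp (inner ℝ h y - ‖h‖ ^ 2 / 2)) ∂stdGaussian (Vec d) := by
  have hsf : ∀ i, SigmaFinite ((gaussianReal 0 1).map (fun x => x + h i)) := fun i => by
    rw [gaussianReal_map_add_const]; infer_instance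
  have hsf' : ∀ i, SigmaFinite ((gaussianReal 0 1).withDensity
      (fun x => ENNReal.ofReal (Real.exp (h i * x - h i ^ 2 / 2)))) := fun i => by
    rw [← gaussianReal_translate]; exact hsf i
  have key : (Measure.pi fun _ : Fin d => gaussianReal 0 1).map (fun x i => x i + h i) =
      (Measure.pi fun _ : Fin d => gaussianReal 0 1).withDensity
        (fun x => ∏ i, ENNReal.ofReal (Real.exp (h i * x i - h i ^ 2 / 2))) := by
    rw [Measure.pi_map_pi (f := fun i x => x + h i) (fun i => by fun_prop)]
    simp_rw [gaussianReal_translate]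
    exact pi_withDensity (fun _ => gaussianReal 0 1)
      (fun i x => ENNReal.ofReal (Real.exp (h i * x - h i ^ 2 / 2))) (fun i => by fun_prop)
  have hF' : Measurable fun x : Fin d → ℝ => F (WithLp.toLp 2 x) :=
    hF.comp (by fun_prop)
  rw [← map_pi_eq_stdGaussian, lintegral_map (by fun_prop) (by fun_prop),
    lintegral_map (by fun_prop) (by fun_prop)]
  calc ∫⁻ x : Fin d → ℝ, F (WithLp.toLp 2 x + h) ∂(Measure.pi fun _ => gaussianReal 0 1)
      = ∫⁻ x, F (WithLp.toLp 2 x)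
          ∂((Measure.pi fun _ : Fin d => gaussianReal 0 1).map (fun x i => x i + h i)) := by
        rw [lintegral_map hF' (by fun_prop)]
        rfl
    _ = _ := by
        rw [key, lintegral_withDensity_eq_lintegral_mul _ (by fun_prop) hF']
        refine lintegral_congr fun x => ?_
        rw [Pi.mul_apply, mul_comm, ← ENNReal.ofReal_prod_of_nonneg (fun i _ => by positivity),
          ← Real.exp_sum, Finset.sum_sub_distrib, EuclideanSpace.real_norm_sq_eq,
          ← Finset.sum_div]
        congr 4
        simp [PiLp.inner_apply, mul_comm]

theorem stdGaussian_map_inner {d : ℕ} (x : Vec d) :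
    (stdGaussian (Vec d)).map (fun y => inner ℝ x y) = gaussianReal 0 (‖x‖₊ ^ 2) := by
  have h := IsGaussian.map_eq_gaussianReal (μ := stdGaussian (Vec d)) (innerSL ℝ x)
  rw [integral_strongDual_stdGaussian, variance_dual_stdGaussian, innerSL_apply_norm] at h
  have e : (‖x‖ ^ 2).toNNReal = ‖x‖₊ ^ 2 := by
    ext
    simp
  rw [← e]
  exact h

theorem stdGaussian_integrable_inner {d : ℕ} (x : Vec d) :
    Integrable (fun y => inner ℝ x y) (stdGaussian (Vec d)) ∧
      ∫ y, inner ℝ x y ∂stdGaussian (Vec d) = 0 :=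
  ⟨(innerSL ℝ x).integrable_comp IsGaussian.integrable_id,
    integral_strongDual_stdGaussian (innerSL ℝ x)⟩

/-! ### A uniform exponential inequality -/

/-- A PAC-Bayesian inequality. The event controls the single variable Z, an exponential moment
averaged over the unshifted Gaussian, by Markov's inequality; h enters only afterwards, through a
change of measure. This is why one event serves every h. -/
theorem exists_event_forall_sum_integral_log_le {d n : ℕ}
    (P : Measure (Vec d)) [IsProbabilityMeasure P]
    {Ω : Type*} [MeasurableSpace Ω] (μ : Measure Ω) [IsProbabilityMeasure μ]
    (X : Fin n → Ω → Vec d) (hXm : ∀ i, Measurable (X i)) (hXlaw : ∀ i, μ.map (X i) = P)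
    (hXind : iIndepFun X μ) (U : Vec d → Vec d → ℝ) (hU : Measurable (Function.uncurry U))
    (hU1 : ∀ y x, 1 / 2 ≤ U y x) (hP : ∀ y, Integrable (U y) P)
    (hprod : ∀ h, Integrable (fun p : Vec d × Vec d => U (p.1 + h) p.2)
      ((stdGaussian (Vec d)).prod P))
    (hx : ∀ h x, Integrable (fun y => U (y + h) x) (stdGaussian (Vec d)))
    {ε : ℝ} (hε : 0 < ε) :
    ∃ E : Set Ω, MeasurableSet E ∧ μ Eᶜ ≤ ENNReal.ofReal ε ∧ ∀ ω ∈ E, ∀ h : Vec d,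
      ∑ i, ∫ y, Real.log (U (y + h) (X i ω)) ∂stdGaussian (Vec d) ≤
        n * ((∫ p, U (p.1 + h) p.2 ∂((stdGaussian (Vec d)).prod P)) - 1) + ‖h‖ ^ 2 / 2 +
          Real.log (1 / ε) := by
  set γ := stdGaussian (Vec d) with hγ
  have hU0 : ∀ y x, 0 < U y x := fun y x => by linarith [hU1 y x]
  set m : Vec d → ℝ := fun y => ∫ x, U y x ∂P with hm
  have hmm : Measurable m := (hU.stronglyMeasurable.integral_prod_right).measurable
  have hUX : ∀ i, Measurable (fun q : Ω × Vec d => U q.2 (X i q.1)) := fun i =>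
    hU.comp (measurable_snd.prodMk ((hXm i).comp measurable_fst))
  set H : Ω → Vec d → ℝ := fun ω y => ∑ i, Real.log (U y (X i ω)) - n * (m y - 1) with hH
  have hHm : Measurable (Function.uncurry H) := by
    have h1 : Measurable (fun q : Ω × Vec d => ∑ i, Real.log (U q.2 (X i q.1))) :=
      Finset.measurable_sum _ fun i _ => Real.measurable_log.comp (hUX i)
    exact h1.sub (((hmm.comp measurable_snd).sub_const 1).const_mul _)
  have hHω : ∀ ω, Measurable (H ω) := fun ω => hHm.comp measurable_prodMk_left
  set Z : Ω → ENNReal := fun ω => ∫⁻ y, ENNReal.ofReal (Real.exp (H ω y)) ∂γ with hZ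
  have hem : Measurable (fun q : Ω × Vec d => ENNReal.ofReal (Real.exp (H q.1 q.2))) :=
    (Real.measurable_exp.comp hHm).ennreal_ofReal
  have hZm : Measurable Z := hem.lintegral_prod_right'
  -- Independence makes the expectation of the product equal to m(y)ⁿ, and mⁿ ≤ exp(n(m - 1)).
  have hinner : ∀ y, ∫⁻ ω, ENNReal.ofReal (Real.exp (H ω y)) ∂μ ≤ 1 := by
    intro y
    have hUy : Measurable (U y) := hU.comp measurable_prodMk_left
    have h1 : ∀ ω, ENNReal.ofReal (Real.exp (H ω y)) =
        (∏ i, ENNReal.ofReal (U y (X i ω))) * ENNReal.ofReal (Real.exp (-(n * (m y - 1)))) := by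
      intro ω
      rw [← ENNReal.ofReal_prod_of_nonneg (fun i _ => (hU0 _ _).le),
        ← ENNReal.ofReal_mul (Finset.prod_nonneg fun i _ => (hU0 _ _).le), hH]
      simp only
      rw [sub_eq_add_neg, Real.exp_add, Real.exp_sum]
      simp_rw [Real.exp_log (hU0 _ _)]
    simp_rw [h1]
    have hmeas : ∀ i, Measurable fun ω => ENNReal.ofReal (U y (X i ω)) := fun i =>
      (hUy.comp (hXm i)).ennreal_ofReal
    rw [lintegral_mul_const _ (Finset.measurable_prod _ fun i _ => hmeas i),
      lintegral_prod_eq_prod_lintegral_of_indepFun Finset.univ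
        (fun i ω => ENNReal.ofReal (U y (X i ω)))
        (hXind.comp (fun _ x => ENNReal.ofReal (U y x)) fun _ => hUy.ennreal_ofReal) hmeas]
    have h2 : ∀ i, ∫⁻ ω, ENNReal.ofReal (U y (X i ω)) ∂μ = ENNReal.ofReal (m y) := by
      intro i
      rw [← lintegral_map (f := fun x => ENNReal.ofReal (U y x)) hUy.ennreal_ofReal (hXm i),
        hXlaw i, ← ofReal_integral_eq_lintegral_ofReal (hP y)
          (Filter.Eventually.of_forall fun x => (hU0 y x).le)]
    have hm0 : 0 ≤ m y := integral_nonneg fun x => (hU0 y x).le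
    simp_rw [h2]
    rw [Finset.prod_const, Finset.card_univ, Fintype.card_fin, ← ENNReal.ofReal_pow hm0,
      ← ENNReal.ofReal_mul (by positivity), ← ENNReal.ofReal_one]
    refine ENNReal.ofReal_le_ofReal ?_
    have h3 : m y ^ n ≤ Real.exp (n * (m y - 1)) := by
      rw [Real.exp_nat_mul]
      exact pow_le_pow_left₀ hm0 (by linarith [Real.add_one_le_exp (m y - 1)]) n
    calc m y ^ n * Real.exp (-(n * (m y - 1)))
        ≤ Real.exp (n * (m y - 1)) * Real.exp (-(n * (m y - 1))) := by gcongr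
      _ = 1 := by rw [← Real.exp_add, add_neg_cancel, Real.exp_zero]
  have hZ1 : ∫⁻ ω, Z ω ∂μ ≤ 1 := by
    rw [hZ, lintegral_lintegral_swap hem.aemeasurable]
    calc ∫⁻ y, ∫⁻ ω, ENNReal.ofReal (Real.exp (H ω y)) ∂μ ∂γ ≤ ∫⁻ _, 1 ∂γ := lintegral_mono hinner
      _ = 1 := by simp
  refine ⟨{ω | Z ω ≤ ENNReal.ofReal (1 / ε)}, measurableSet_le hZm measurable_const, ?_, ?_⟩
  · have h1 := mul_meas_ge_le_lintegral hZm (μ := μ) (ENNReal.ofReal (1 / ε))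
    have h2 : {ω | Z ω ≤ ENNReal.ofReal (1 / ε)}ᶜ ⊆ {ω | ENNReal.ofReal (1 / ε) ≤ Z ω} :=
      fun ω hω => by
      have h : ¬ Z ω ≤ ENNReal.ofReal (1 / ε) := hω
      exact (not_le.1 h).le
    refine (measure_mono h2).trans ?_
    have h3 := h1.trans hZ1
    have h4 : ENNReal.ofReal ε * ENNReal.ofReal (1 / ε) = 1 := by
      rw [← ENNReal.ofReal_mul hε.le, mul_one_div_cancel hε.ne', ENNReal.ofReal_one]
    calc μ {ω | ENNReal.ofReal (1 / ε) ≤ Z ω}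
        = ENNReal.ofReal ε * (ENNReal.ofReal (1 / ε) * μ {ω | ENNReal.ofReal (1 / ε) ≤ Z ω}) := by
          rw [← mul_assoc, h4, one_mul]
      _ ≤ ENNReal.ofReal ε * 1 := by gcongr
      _ = _ := mul_one _
  · intro ω hω h
    have hmi : Integrable (fun y => m (y + h)) γ := (hprod h).integral_prod_left
    have hme : ∫ y, m (y + h) ∂γ = ∫ p, U (p.1 + h) p.2 ∂(γ.prod P) :=
      (integral_prod _ (hprod h)).symm
    have hli : ∀ i, Integrable (fun y => Real.log (U (y + h) (X i ω))) γ := fun i =>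
      integrable_log_of_half_le (hx h _) fun y => hU1 _ _
    have hsi : Integrable (fun y => ∑ i, Real.log (U (y + h) (X i ω))) γ :=
      integrable_finsetSum _ fun i _ => hli i
    obtain ⟨hin, hin0⟩ := stdGaussian_integrable_inner h
    have hmi2 : Integrable (fun y => n * (m (y + h) - 1)) γ :=
      (hmi.sub (integrable_const 1)).const_mul _
    have hHi : Integrable (fun y => H ω (y + h)) γ := hsi.sub hmi2
    have hHi2 : Integrable (fun y => H ω (y + h) - inner ℝ h y) γ := hHi.sub hin
    set g : Vec d → ℝ := fun y => H ω (y + h) - inner ℝ h y - ‖h‖ ^ 2 / 2 with hg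
    have hgi : Integrable g γ := hHi2.sub (integrable_const _)
    have hge : ∫ y, g y ∂γ = ∑ i, ∫ y, Real.log (U (y + h) (X i ω)) ∂γ -
        n * ((∫ p, U (p.1 + h) p.2 ∂(γ.prod P)) - 1) - ‖h‖ ^ 2 / 2 := by
      have e1 : ∫ y, (m (y + h) - 1) ∂γ = (∫ p, U (p.1 + h) p.2 ∂(γ.prod P)) - 1 := by
        rw [integral_sub hmi (integrable_const _), hme, integral_const, probReal_univ, one_smul]
      rw [hg, integral_sub hHi2 (integrable_const _), integral_sub hHi hin, hin0, integral_const,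
        probReal_univ, one_smul, sub_zero, hH]
      simp only
      rw [integral_sub hsi hmi2, integral_const_mul, e1, integral_finsetSum _ fun i _ => hli i]
    -- The correction ⟨h, y⟩ + ‖h‖²/2 in g is chosen so that Cameron-Martin turns this integral into
    -- Z(ω).
    have hexp : ∫⁻ y, ENNReal.ofReal (Real.exp (g y)) ∂γ ≤ ENNReal.ofReal (1 / ε) := by
      have e2 := stdGaussian_lintegral_translate h (F := fun y =>
        ENNReal.ofReal (Real.exp (H ω y - inner ℝ h y + ‖h‖ ^ 2 / 2)))
        (by have := hHω ω; fun_prop)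
      have e3 : ∀ y, g y = H ω (y + h) - inner ℝ h (y + h) + ‖h‖ ^ 2 / 2 := fun y => by
        rw [hg, inner_add_right, real_inner_self_eq_norm_sq]
        ring
      simp_rw [e3]
      rw [e2]
      refine le_trans (le_of_eq (lintegral_congr fun y => ?_)) hω
      rw [← ENNReal.ofReal_mul (by positivity), ← Real.exp_add]
      congr 2
      ring
    have hgm : AEStronglyMeasurable (fun y => Real.exp (g y)) γ :=
      (Real.measurable_exp.comp_aemeasurable hgi.aemeasurable).aestronglyMeasurable
    have hei : Integrable (fun y => Real.exp (g y)) γ := by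
      refine (lintegral_ofReal_ne_top_iff_integrable hgm
        (Filter.Eventually.of_forall fun y => (Real.exp_pos _).le)).1 ?_
      exact (hexp.trans_lt ENNReal.ofReal_lt_top).ne
    have hee : ∫ y, Real.exp (g y) ∂γ ≤ 1 / ε := by
      rw [integral_eq_lintegral_of_nonneg_ae
        (Filter.Eventually.of_forall fun y => (Real.exp_pos _).le) hgm]
      exact ENNReal.toReal_le_of_le_ofReal (by positivity) hexp
    -- Jensen's inequality for exp in tangent form, with the tangent taken at log(1/ε).
    have hpt : ∀ y, g y + (1 - Real.log (1 / ε)) ≤ ε * Real.exp (g y) := by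
      intro y
      have := Real.add_one_le_exp (g y - Real.log (1 / ε))
      rw [Real.exp_sub, Real.exp_log (by positivity), div_div_eq_mul_div, div_one] at this
      linarith
    have hfin := integral_mono (hgi.add (integrable_const _)) (hei.const_mul ε) hpt
    simp only [Pi.add_apply] at hfin
    rw [integral_add hgi (integrable_const _), integral_const, probReal_univ, one_smul,
      integral_const_mul] at hfin
    have : ε * ∫ y, Real.exp (g y) ∂γ ≤ 1 := by
      calc ε * ∫ y, Real.exp (g y) ∂γ ≤ ε * (1 / ε) := by gcongr
        _ = 1 := mul_one_div_cancel hε.ne'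
    linarith

/-! ### The smoothed criterion -/

/-- The polynomial whose logarithm, averaged over a standard Gaussian `y`, dominates the influence
function. -/
def smoothPoly {d : ℕ} (ς l : ℝ) (y x : Vec d) : ℝ :=
  1 + ς * ((inner ℝ x y) ^ 2 - ‖x‖ ^ 2 - l) + ((inner ℝ x y) ^ 2 - ‖x‖ ^ 2 - l) ^ 2 / 2 +
    cst * ‖x‖ ^ 2 * ((inner ℝ x y) ^ 2 + ‖x‖ ^ 2 / 2)

theorem half_le_smoothPoly {d : ℕ} {ς : ℝ} (hς : ς ^ 2 = 1) (l : ℝ) (y x : Vec d) :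
    1 / 2 ≤ smoothPoly ς l y x := by
  have hc := cst_pos
  have h := quadratic_pos (ς * ((inner ℝ x y) ^ 2 - ‖x‖ ^ 2 - l))
  rw [mul_pow, hς, one_mul] at h
  have h2 : 0 ≤ cst * ‖x‖ ^ 2 * ((inner ℝ x y) ^ 2 + ‖x‖ ^ 2 / 2) := by positivity
  unfold smoothPoly
  linarith

/-- Subtracting ‖x‖² in `smoothPoly` removes the bias of the squared perturbed inner product. The
fluctuations of the square contribute 2 and 1 to the coefficients 2 + c and (2 + 3c)/2, and the
added term gives the rest. -/
theorem smoothPoly_integral {d : ℕ} (ς l : ℝ) (h x : Vec d) :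
    Integrable (fun y => smoothPoly ς l (y + h) x) (stdGaussian (Vec d)) ∧
    ∫ y, smoothPoly ς l (y + h) x ∂stdGaussian (Vec d) =
      1 + ς * ((inner ℝ x h) ^ 2 - l) + ((inner ℝ x h) ^ 2 - l) ^ 2 / 2 +
        (2 + cst) * (inner ℝ x h) ^ 2 * ‖x‖ ^ 2 + (2 + 3 * cst) / 2 * ‖x‖ ^ 4 := by
  set m : ℝ := inner ℝ x h
  set w : ℝ := ‖x‖ ^ 2 with hw
  have key := gaussianReal_quartic (‖x‖₊ ^ 2)
    (1 + ς * (m ^ 2 - w - l) + (m ^ 2 - w - l) ^ 2 / 2 + cst * w * (m ^ 2 + w / 2))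
    (2 * ς * m + 2 * m * (m ^ 2 - w - l) + cst * w * (2 * m))
    (ς + ((m ^ 2 - w - l) + 2 * m ^ 2) + cst * w) (2 * m) (1 / 2)
  rw [← stdGaussian_map_inner x] at key
  have hfun : ∀ y : Vec d, smoothPoly ς l (y + h) x =
      (fun t : ℝ => (1 + ς * (m ^ 2 - w - l) + (m ^ 2 - w - l) ^ 2 / 2 + cst * w * (m ^ 2 + w / 2)) +
        (2 * ς * m + 2 * m * (m ^ 2 - w - l) + cst * w * (2 * m)) * t +
        (ς + ((m ^ 2 - w - l) + 2 * m ^ 2) + cst * w) * t ^ 2 + (2 * m) * t ^ 3 + (1 / 2) * t ^ 4)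
        (inner ℝ x y) := by
    intro y
    simp only [smoothPoly, inner_add_right]
    ring
  simp_rw [hfun]
  refine ⟨(integrable_map_measure (by fun_prop) (by fun_prop)).1 key.1, ?_⟩
  have h2 := key.2
  rw [integral_map (by fun_prop) (by fun_prop)] at h2
  rw [h2]
  have hw' : ((‖x‖₊ ^ 2 : NNReal) : ℝ) = w := by simp [hw]
  have hw4 : ‖x‖ ^ 4 = w ^ 2 := by rw [hw]; ring
  rw [hw', hw4]
  ring

theorem psi_le_integral_log_smoothPoly {d : ℕ} {ς : ℝ} (hς : ς ^ 2 = 1) (l : ℝ) (h x : Vec d) :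
    psi (ς * ((inner ℝ x h) ^ 2 - l)) ≤
      ∫ y, Real.log (smoothPoly ς l (y + h) x) ∂stdGaussian (Vec d) := by
  have key := psi_le_gaussian_integral_log (‖x‖₊ ^ 2) hς (inner ℝ x h) l
  rw [← stdGaussian_map_inner x, integral_map (by fun_prop)
    (Measurable.aestronglyMeasurable (by fun_prop))] at key
  refine key.trans (le_of_eq ?_)
  congr 1
  ext y
  simp only [smoothPoly, inner_add_right, NNReal.coe_pow, coe_nnnorm]
  congr 1
  ring

/-! ### Integrability of quartic quantities -/

theorem integrable_of_le_quartic {d : ℕ} {P : Measure (Vec d)} [IsProbabilityMeasure P]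
    (hP : Integrable (fun x => ‖x‖ ^ 4) P) {f : Vec d → ℝ} (hf : Measurable f) (C : ℝ)
    (h : ∀ x, |f x| ≤ C * (1 + ‖x‖ ^ 4)) : Integrable f P :=
  Integrable.mono' (((integrable_const 1).add hP).const_mul C) hf.aestronglyMeasurable
    (Filter.Eventually.of_forall fun x => by simpa using h x)

theorem integrable_inner_sq {d : ℕ} {P : Measure (Vec d)} [IsProbabilityMeasure P]
    (hP : Integrable (fun x => ‖x‖ ^ 4) P) (θ : Vec d) :
    Integrable (fun x => (inner ℝ θ x) ^ 2) P := by
  refine integrable_of_le_quartic hP (by fun_prop) (‖θ‖ ^ 2) fun x => ?_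
  have h := abs_real_inner_le_norm θ x
  rw [abs_pow]
  have h2 := pow_le_pow_left₀ (abs_nonneg _) h 2
  rw [mul_pow] at h2
  refine h2.trans ?_
  gcongr
  nlinarith [sq_nonneg (‖x‖ ^ 2 - 1), sq_nonneg ‖x‖]

theorem integrable_inner_pow_four {d : ℕ} {P : Measure (Vec d)} [IsProbabilityMeasure P]
    (hP : Integrable (fun x => ‖x‖ ^ 4) P) (θ : Vec d) :
    Integrable (fun x => (inner ℝ θ x) ^ 4) P := by
  refine integrable_of_le_quartic hP (by fun_prop) (‖θ‖ ^ 4) fun x => ?_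
  have h := abs_real_inner_le_norm θ x
  rw [abs_pow]
  have h2 := pow_le_pow_left₀ (abs_nonneg _) h 4
  rw [mul_pow] at h2
  refine h2.trans ?_
  gcongr
  linarith

theorem integrable_inner_sq_mul_norm_sq {d : ℕ} {P : Measure (Vec d)} [IsProbabilityMeasure P]
    (hP : Integrable (fun x => ‖x‖ ^ 4) P) (θ : Vec d) :
    Integrable (fun x => (inner ℝ θ x) ^ 2 * ‖x‖ ^ 2) P := by
  refine integrable_of_le_quartic hP (by fun_prop) (‖θ‖ ^ 2) fun x => ?_
  have h := abs_real_inner_le_norm θ x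
  rw [abs_of_nonneg (by positivity), ← sq_abs]
  have h2 := pow_le_pow_left₀ (abs_nonneg _) h 2
  rw [mul_pow] at h2
  calc |inner ℝ θ x| ^ 2 * ‖x‖ ^ 2 ≤ ‖θ‖ ^ 2 * ‖x‖ ^ 2 * ‖x‖ ^ 2 := by gcongr
    _ ≤ _ := by nlinarith [sq_nonneg ‖θ‖]

theorem integrable_norm_sq {d : ℕ} {P : Measure (Vec d)} [IsProbabilityMeasure P]
    (hP : Integrable (fun x => ‖x‖ ^ 4) P) : Integrable (fun x => ‖x‖ ^ 2) P := by
  refine integrable_of_le_quartic hP (by fun_prop) 1 fun x => ?_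
  rw [abs_of_nonneg (by positivity)]
  nlinarith [sq_nonneg (‖x‖ ^ 2 - 1), sq_nonneg ‖x‖]

/-- A polynomial in `⟪θ, x⟫` and `‖x‖` with the monomials of the Gaussian integral of `smoothPoly` is
integrable, and its integral is the same combination of moments. -/
theorem smooth_moment {d : ℕ} {P : Measure (Vec d)} [IsProbabilityMeasure P]
    (hP : Integrable (fun x => ‖x‖ ^ 4) P) (A B C D E : ℝ) (θ : Vec d) :
    Integrable (fun x => A + B * (inner ℝ θ x) ^ 2 + C * (inner ℝ θ x) ^ 4 +
      D * ((inner ℝ θ x) ^ 2 * ‖x‖ ^ 2) + E * ‖x‖ ^ 4) P ∧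
    ∫ x, (A + B * (inner ℝ θ x) ^ 2 + C * (inner ℝ θ x) ^ 4 +
      D * ((inner ℝ θ x) ^ 2 * ‖x‖ ^ 2) + E * ‖x‖ ^ 4) ∂P =
      A + B * ∫ x, (inner ℝ θ x) ^ 2 ∂P + C * ∫ x, (inner ℝ θ x) ^ 4 ∂P +
        D * ∫ x, (inner ℝ θ x) ^ 2 * ‖x‖ ^ 2 ∂P + E * ∫ x, ‖x‖ ^ 4 ∂P := by
  have j0 : Integrable (fun _ : Vec d => A) P := integrable_const A
  have j1 := (integrable_inner_sq hP θ).const_mul B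
  have j2 := (integrable_inner_pow_four hP θ).const_mul C
  have j3 := (integrable_inner_sq_mul_norm_sq hP θ).const_mul D
  have j4 := hP.const_mul E
  have k1 : Integrable (fun x => A + B * (inner ℝ θ x) ^ 2) P := j0.add j1
  have k2 : Integrable (fun x => A + B * (inner ℝ θ x) ^ 2 + C * (inner ℝ θ x) ^ 4) P := k1.add j2
  have k3 : Integrable (fun x => A + B * (inner ℝ θ x) ^ 2 + C * (inner ℝ θ x) ^ 4 +
      D * ((inner ℝ θ x) ^ 2 * ‖x‖ ^ 2)) P := k2.add j3
  refine ⟨k3.add j4, ?_⟩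
  rw [integral_add k3 j4, integral_add k2 j3, integral_add k1 j2, integral_add j0 j1]
  simp only [integral_const_mul, integral_const, probReal_univ, one_smul]

theorem smoothPoly_integrable_right {d : ℕ} {P : Measure (Vec d)} [IsProbabilityMeasure P]
    (hP : Integrable (fun x => ‖x‖ ^ 4) P) (ς l b : ℝ) (y : Vec d) :
    Integrable (fun x => smoothPoly ς l y (b⁻¹ • x)) P := by
  have h1 := (smooth_moment hP (1 - ς * l + l ^ 2 / 2) (b⁻¹ ^ 2 * (ς - l)) (b⁻¹ ^ 4 / 2)
    (b⁻¹ ^ 4 * (cst - 1)) (b⁻¹ ^ 4 * (1 / 2 + cst / 2)) y).1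
  have h2 := (integrable_norm_sq hP).const_mul (b⁻¹ ^ 2 * (l - ς))
  refine (h1.add h2).congr (Filter.Eventually.of_forall fun x => ?_)
  have e : inner ℝ (b⁻¹ • x) y = b⁻¹ * inner ℝ y x := by
    rw [real_inner_smul_left, real_inner_comm]
  simp only [Pi.add_apply, smoothPoly, e, norm_smul, mul_pow, Real.norm_eq_abs, sq_abs]
  ring

/-! ### Uniform deviation of the empirical criterion -/

/-- The exponential inequality is applied to x/√β and the shift √β θ: the inner product with θ is
kept, the perturbation has covariance I/β, and the entropy is β‖θ‖²/2. -/
theorem exists_event_sum_psi_le {d n : ℕ}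
    (P : Measure (Vec d)) [IsProbabilityMeasure P] (hP : Integrable (fun x => ‖x‖ ^ 4) P)
    {Ω : Type*} [MeasurableSpace Ω] (μ : Measure Ω) [IsProbabilityMeasure μ]
    (X : Fin n → Ω → Vec d) (hXm : ∀ i, Measurable (X i)) (hXlaw : ∀ i, μ.map (X i) = P)
    (hXind : iIndepFun X μ) {ς : ℝ} (hς : ς ^ 2 = 1) (l : ℝ) {β ε : ℝ} (hβ : 0 < β) (hε : 0 < ε) :
    ∃ E : Set Ω, MeasurableSet E ∧ μ Eᶜ ≤ ENNReal.ofReal ε ∧ ∀ ω ∈ E, ∀ θ : Vec d,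
      ∑ i, psi (ς * ((inner ℝ θ (X i ω)) ^ 2 - l)) ≤
        n * (ς * ((∫ x, (inner ℝ θ x) ^ 2 ∂P) - l) +
          ((∫ x, (inner ℝ θ x) ^ 4 ∂P) - 2 * l * (∫ x, (inner ℝ θ x) ^ 2 ∂P) + l ^ 2) / 2 +
          (2 + cst) / β * (∫ x, (inner ℝ θ x) ^ 2 * ‖x‖ ^ 2 ∂P) +
          (2 + 3 * cst) / (2 * β ^ 2) * ∫ x, ‖x‖ ^ 4 ∂P) + β * ‖θ‖ ^ 2 / 2 +
          Real.log (1 / ε) := by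
  set b := Real.sqrt β with hb
  have hb0 : 0 < b := Real.sqrt_pos.2 hβ
  have hbsq : b ^ 2 = β := Real.sq_sqrt hβ.le
  have hnonneg : ∀ y x : Vec d, 0 ≤ smoothPoly ς l y x := fun y x => by
    linarith [half_le_smoothPoly hς l y x]
  have hmeas : Measurable (Function.uncurry fun y x : Vec d => smoothPoly ς l y (b⁻¹ • x)) := by
    unfold smoothPoly Function.uncurry
    fun_prop
  have hmeas' : ∀ h : Vec d,
      Measurable (fun p : Vec d × Vec d => smoothPoly ς l (p.1 + h) (b⁻¹ • p.2)) := fun h => by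
    unfold smoothPoly
    fun_prop
  have hpoly : ∀ θ x : Vec d, ∫ y, smoothPoly ς l (y + b • θ) (b⁻¹ • x) ∂stdGaussian (Vec d) =
      (1 - ς * l + l ^ 2 / 2) + (ς - l) * (inner ℝ θ x) ^ 2 + 1 / 2 * (inner ℝ θ x) ^ 4 +
        (2 + cst) / β * ((inner ℝ θ x) ^ 2 * ‖x‖ ^ 2) + (2 + 3 * cst) / (2 * β ^ 2) * ‖x‖ ^ 4 := by
    intro θ x
    rw [(smoothPoly_integral ς l _ _).2, real_inner_smul_left, real_inner_smul_right, ← mul_assoc,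
      inv_mul_cancel₀ hb0.ne', one_mul, norm_smul, norm_inv, Real.norm_of_nonneg hb0.le,
      real_inner_comm, ← hbsq, mul_pow, mul_pow]
    field_simp
    ring
  have hpolyi : ∀ θ : Vec d, Integrable (fun x =>
      ∫ y, smoothPoly ς l (y + b • θ) (b⁻¹ • x) ∂stdGaussian (Vec d)) P := fun θ => by
    simp_rw [hpoly]
    exact (smooth_moment hP _ _ _ _ _ θ).1
  have hprod : ∀ h : Vec d, Integrable (fun p : Vec d × Vec d =>
      smoothPoly ς l (p.1 + h) (b⁻¹ • p.2)) ((stdGaussian (Vec d)).prod P) := by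
    intro h
    have hh : b • (b⁻¹ • h) = h := by rw [smul_smul, mul_inv_cancel₀ hb0.ne', one_smul]
    have hi := hpolyi (b⁻¹ • h)
    rw [hh] at hi
    refine (integrable_prod_iff' (hmeas' h).aestronglyMeasurable).2
      ⟨Filter.Eventually.of_forall fun x => (smoothPoly_integral ς l h (b⁻¹ • x)).1, ?_⟩
    refine hi.congr (Filter.Eventually.of_forall fun x => ?_)
    exact integral_congr_ae (Filter.Eventually.of_forall fun y =>
      (Real.norm_of_nonneg (hnonneg (y + h) (b⁻¹ • x))).symm)
  obtain ⟨E, hE, hμE, h⟩ := exists_event_forall_sum_integral_log_le P μ X hXm hXlaw hXind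
    (fun y x => smoothPoly ς l y (b⁻¹ • x)) hmeas (fun y x => half_le_smoothPoly hς l _ _)
    (fun y => smoothPoly_integrable_right hP ς l b y) hprod
    (fun h x => (smoothPoly_integral ς l h _).1) hε
  refine ⟨E, hE, hμE, fun ω hω θ => ?_⟩
  have key := h ω hω (b • θ)
  have h1 : ∑ i, psi (ς * ((inner ℝ θ (X i ω)) ^ 2 - l)) ≤
      ∑ i, ∫ y, Real.log (smoothPoly ς l (y + b • θ) (b⁻¹ • X i ω)) ∂stdGaussian (Vec d) := by
    refine Finset.sum_le_sum fun i _ => ?_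
    have := psi_le_integral_log_smoothPoly hς l (b • θ) (b⁻¹ • X i ω)
    rwa [real_inner_smul_left, real_inner_smul_right, ← mul_assoc,
      inv_mul_cancel₀ hb0.ne', one_mul, real_inner_comm] at this
  refine h1.trans (key.trans (le_of_eq ?_))
  have h2 : ‖b • θ‖ ^ 2 = β * ‖θ‖ ^ 2 := by
    rw [norm_smul, Real.norm_of_nonneg hb0.le, mul_pow, hbsq]
  rw [integral_prod_symm _ (hprod _)]
  simp_rw [hpoly]
  rw [(smooth_moment hP _ _ _ _ _ θ).2, h2]
  ring

/-! ### Kurtosis -/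

theorem integral_inner_pow_four_le {d : ℕ} {P : Measure (Vec d)} [IsProbabilityMeasure P]
    (hP : Integrable (fun x => ‖x‖ ^ 4) P) (hκ : 0 < kurt P) (θ : Vec d) :
    ∫ x, (inner ℝ θ x) ^ 4 ∂P ≤ kurt P * (∫ x, (inner ℝ θ x) ^ 2 ∂P) ^ 2 := by
  have h0 : 0 ≤ ∫ x, (inner ℝ θ x) ^ 2 ∂P := integral_nonneg fun x => sq_nonneg _
  rcases h0.eq_or_lt with h | h
  · have hz := (integral_eq_zero_iff_of_nonneg (fun x => sq_nonneg _)
      (integrable_inner_sq hP θ)).1 h.symm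
    have : ∫ x, (inner ℝ θ x) ^ 4 ∂P = 0 := by
      refine integral_eq_zero_of_ae ?_
      filter_upwards [hz] with x hx
      have hx' : inner ℝ θ x = 0 := by simpa using hx
      simp [hx']
    rw [this, ← h]
    simp
  -- An unbounded set of ratios would have `sSup` equal to 0, which positivity of `kurt P` excludes.
  · have hb : BddAbove ((fun θ : Vec d => (∫ x, (inner ℝ θ x) ^ 4 ∂P) /
        (∫ x, (inner ℝ θ x) ^ 2 ∂P) ^ 2) '' {θ : Vec d | 0 < ∫ x, (inner ℝ θ x) ^ 2 ∂P}) := by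
      by_contra hc
      have := Real.sSup_of_not_bddAbove hc
      rw [kurt, this] at hκ
      exact lt_irrefl _ hκ
    have := le_csSup hb (Set.mem_image_of_mem _ h)
    rwa [div_le_iff₀ (by positivity)] at this

theorem s4sq_sq {d : ℕ} (P : Measure (Vec d)) : s4sq P ^ 2 = ∫ x, ‖x‖ ^ 4 ∂P :=
  Real.sq_sqrt (integral_nonneg fun x => by positivity)

theorem integral_inner_sq_mul_norm_sq_le {d : ℕ} {P : Measure (Vec d)} [IsProbabilityMeasure P]
    (hP : Integrable (fun x => ‖x‖ ^ 4) P) (hκ : 0 < kurt P) (hs : 0 < s4sq P) (θ : Vec d) :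
    ∫ x, (inner ℝ θ x) ^ 2 * ‖x‖ ^ 2 ∂P ≤
      Real.sqrt (kurt P) * s4sq P * ∫ x, (inner ℝ θ x) ^ 2 ∂P := by
  have h0 : 0 ≤ ∫ x, (inner ℝ θ x) ^ 2 ∂P := integral_nonneg fun x => sq_nonneg _
  have h4 := integral_inner_pow_four_le hP hκ θ
  rcases h0.eq_or_lt with h | h
  · have hz := (integral_eq_zero_iff_of_nonneg (fun x => sq_nonneg _)
      (integrable_inner_sq hP θ)).1 h.symm
    have : ∫ x, (inner ℝ θ x) ^ 2 * ‖x‖ ^ 2 ∂P = 0 := by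
      refine integral_eq_zero_of_ae ?_
      filter_upwards [hz] with x hx
      have hx' : inner ℝ θ x = 0 := by simpa using hx
      simp [hx']
    rw [this, ← h]
    simp
  · set N := ∫ x, (inner ℝ θ x) ^ 2 ∂P
    set k := Real.sqrt (kurt P) with hk
    have hk0 : 0 < k := Real.sqrt_pos.2 hκ
    have hksq : k ^ 2 = kurt P := Real.sq_sqrt hκ.le
    set s := s4sq P
    -- The optimal weight in the arithmetic-geometric inequality, so that the result is the
    -- Cauchy-Schwarz bound.
    set t := s / (k * N) with ht
    have ht0 : 0 < t := by positivity
    have hle : ∀ x : Vec d, (inner ℝ θ x) ^ 2 * ‖x‖ ^ 2 ≤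
        t / 2 * (inner ℝ θ x) ^ 4 + t⁻¹ / 2 * ‖x‖ ^ 4 := by
      intro x
      have h1 : t / 2 * (inner ℝ θ x) ^ 4 + t⁻¹ / 2 * ‖x‖ ^ 4 - (inner ℝ θ x) ^ 2 * ‖x‖ ^ 2 =
          t⁻¹ / 2 * (t * (inner ℝ θ x) ^ 2 - ‖x‖ ^ 2) ^ 2 := by
        field_simp
        ring
      have h2 : 0 ≤ t⁻¹ / 2 * (t * (inner ℝ θ x) ^ 2 - ‖x‖ ^ 2) ^ 2 := by positivity
      linarith
    have i4 := (integrable_inner_pow_four hP θ).const_mul (t / 2)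
    have i5 := hP.const_mul (t⁻¹ / 2)
    have := integral_mono (integrable_inner_sq_mul_norm_sq hP θ) (i4.add i5) hle
    rw [integral_add' i4 i5, integral_const_mul, integral_const_mul, ← s4sq_sq P] at this
    refine this.trans ?_
    calc t / 2 * ∫ x, (inner ℝ θ x) ^ 4 ∂P + t⁻¹ / 2 * s ^ 2
        ≤ t / 2 * (k ^ 2 * N ^ 2) + t⁻¹ / 2 * s ^ 2 := by rw [hksq]; gcongr
      _ = k * s * N := by
        rw [ht]
        field_simp
        ring

theorem exists_event_crit_le {d n : ℕ} (hn : 0 < n)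
    (P : Measure (Vec d)) [IsProbabilityMeasure P] (hP : Integrable (fun x => ‖x‖ ^ 4) P)
    (hκ : 0 < kurt P) (hs : 0 < s4sq P)
    {Ω : Type*} [MeasurableSpace Ω] (μ : Measure Ω) [IsProbabilityMeasure μ]
    (X : Fin n → Ω → Vec d) (hXm : ∀ i, Measurable (X i)) (hXlaw : ∀ i, μ.map (X i) = P)
    (hXind : iIndepFun X μ) {ς : ℝ} (hς : ς = 1 ∨ ς = -1) (l : ℝ) {β ε : ℝ} (hβ : 0 < β)
    (hε : 0 < ε) :
    ∃ E : Set Ω, MeasurableSet E ∧ μ Eᶜ ≤ ENNReal.ofReal ε ∧ ∀ ω ∈ E, ∀ θ : Vec d,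
      ς * crit (fun i => X i ω) l θ ≤
        ς * ((∫ x, (inner ℝ θ x) ^ 2 ∂P) - l) +
          (kurt P * (∫ x, (inner ℝ θ x) ^ 2 ∂P) ^ 2 - 2 * l * (∫ x, (inner ℝ θ x) ^ 2 ∂P) +
            l ^ 2) / 2 +
          (2 + cst) * Real.sqrt (kurt P) * s4sq P / β * (∫ x, (inner ℝ θ x) ^ 2 ∂P) +
          (2 + 3 * cst) * s4sq P ^ 2 / (2 * β ^ 2) + β * ‖θ‖ ^ 2 / (2 * n) +
          Real.log (1 / ε) / n := by
  have hς2 : ς ^ 2 = 1 := by rcases hς with rfl | rfl <;> norm_num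
  have hodd : ∀ t, psi (ς * t) = ς * psi t := fun t => by
    rcases hς with rfl | rfl
    · simp
    · rw [neg_one_mul, psi_neg, neg_one_mul]
  obtain ⟨E, hE, hμE, h⟩ := exists_event_sum_psi_le P hP μ X hXm hXlaw hXind hς2 l hβ hε
  refine ⟨E, hE, hμE, fun ω hω θ => ?_⟩
  have key := h ω hω θ
  have hn' : (0 : ℝ) < n := Nat.cast_pos.2 hn
  have hc := cst_pos
  have e1 : ς * crit (fun i => X i ω) l θ =
      (∑ i, psi (ς * ((inner ℝ θ (X i ω)) ^ 2 - l))) / n := by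
    simp_rw [hodd]
    rw [← Finset.mul_sum, crit]
    field_simp
  rw [e1, div_le_iff₀ hn']
  refine key.trans ?_
  have h4 := integral_inner_pow_four_le hP hκ θ
  have h22 := mul_le_mul_of_nonneg_left (integral_inner_sq_mul_norm_sq_le hP hκ hs θ)
    (show 0 ≤ (2 + cst) / β by positivity)
  rw [← s4sq_sq P]
  set N := ∫ x, (inner ℝ θ x) ^ 2 ∂P
  have e2 : (2 + cst) * Real.sqrt (kurt P) * s4sq P / β * N =
      (2 + cst) / β * (Real.sqrt (kurt P) * s4sq P * N) := by ring
  have e3 : (2 + 3 * cst) * s4sq P ^ 2 / (2 * β ^ 2) =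
      (2 + 3 * cst) / (2 * β ^ 2) * s4sq P ^ 2 := by ring
  rw [e2, e3, add_mul _ (Real.log (1 / ε) / n), add_mul _ (β * ‖θ‖ ^ 2 / (2 * n))]
  have e4 : Real.log (1 / ε) / n * n = Real.log (1 / ε) := by field_simp
  have e5 : β * ‖θ‖ ^ 2 / (2 * n) * n = β * ‖θ‖ ^ 2 / 2 := by field_simp
  rw [e4, e5, mul_comm _ (n : ℝ)]
  gcongr

/-! ### Confidence bounds for the energy in one direction -/

theorem crit_smul_mono {d n : ℕ} (x : Fin n → Vec d) (l : ℝ) (θ : Vec d) {a b : ℝ} (ha : 0 ≤ a)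
    (hab : a ≤ b) : crit x l (a • θ) ≤ crit x l (b • θ) := by
  unfold crit
  gcongr with i
  apply psi_monotone
  rw [real_inner_smul_left, real_inner_smul_left, mul_pow, mul_pow]
  gcongr

/-- A small enough α makes every argument of `psi` nonpositive. The infimum defining `Nhat` is
therefore over a nonempty set; the summand 1 in S avoids a division by zero. -/
theorem exists_crit_nonpos {d n : ℕ} (x : Fin n → Vec d) {l : ℝ} (hl : 0 < l) (θ : Vec d) :
    ∃ α : ℝ, 0 < α ∧ crit x l (α • θ) ≤ 0 := by
  set S := 1 + ∑ i, (inner ℝ θ (x i)) ^ 2 with hS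
  have hS0 : 0 < S := by
    have : 0 ≤ ∑ i, (inner ℝ θ (x i)) ^ 2 := Finset.sum_nonneg fun i _ => sq_nonneg _
    linarith
  refine ⟨Real.sqrt (l / S), Real.sqrt_pos.2 (by positivity), ?_⟩
  unfold crit
  refine mul_nonpos_of_nonneg_of_nonpos (by positivity) (Finset.sum_nonpos fun i _ => ?_)
  have h0 : psi 0 = 0 := by rw [psi_of_mem le_rfl zero_le_one]; norm_num
  rw [← h0]
  apply psi_monotone
  rw [real_inner_smul_left, mul_pow, Real.sq_sqrt (by positivity), sub_nonpos,
    div_mul_eq_mul_div, div_le_iff₀ hS0]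
  have : (inner ℝ θ (x i)) ^ 2 ≤ ∑ i, (inner ℝ θ (x i)) ^ 2 :=
    Finset.single_le_sum (f := fun i => (inner ℝ θ (x i)) ^ 2) (fun i _ => sq_nonneg _)
      (Finset.mem_univ i)
  gcongr
  linarith

theorem Nhat_nonneg {d n : ℕ} (x : Fin n → Vec d) {l : ℝ} (hl : 0 < l) (θ : Vec d) :
    0 ≤ Nhat x l θ := by
  refine Real.sInf_nonneg ?_
  rintro _ ⟨α, _, rfl⟩
  positivity

theorem crit_pos_of_lt_Nhat {d n : ℕ} (x : Fin n → Vec d) {l : ℝ} (hl : 0 < l) (θ : Vec d)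
    {t : ℝ} (ht : 0 < t) (h : t < Nhat x l θ) : 0 < crit x l (Real.sqrt (l / t) • θ) := by
  by_contra hc
  push Not at hc
  have hb : BddBelow ((fun α : ℝ => l / α ^ 2) '' {α : ℝ | 0 < α ∧ crit x l (α • θ) ≤ 0}) :=
    ⟨0, by rintro _ ⟨α, _, rfl⟩; positivity⟩
  have := csInf_le hb ⟨Real.sqrt (l / t), ⟨Real.sqrt_pos.2 (by positivity), hc⟩, rfl⟩
  simp only [Real.sq_sqrt (show 0 ≤ l / t by positivity)] at this
  rw [div_div_cancel₀ hl.ne'] at this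
  exact absurd h (not_lt.2 this)

/-- The parameters are in the range where the estimator is studied. -/
structure Tuning.Admissible (n : ℕ) (T : Tuning) : Prop where
  n_pos : 0 < n
  κ_ge : 3 / 2 ≤ T.κ
  s_pos : 0 < T.s
  a_pos : 0 < T.a
  log_pos : 0 < Real.log ((gridSize n T : ℝ) / T.ε)

namespace Tuning.Admissible

variable {n : ℕ} {T : Tuning}

theorem n_pos' (hT : T.Admissible n) : (0 : ℝ) < n := Nat.cast_pos.2 hT.n_pos

theorem sqrt_pos (hT : T.Admissible n) : 0 < Real.sqrt T.κ :=
  Real.sqrt_pos.2 (by linarith [hT.κ_ge])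

theorem gridL_pos (hT : T.Admissible n) (j : ℕ) : 0 < gridL n T j := by
  have h1 := hT.n_pos'
  have h2 := hT.sqrt_pos
  have h3 : 0 < T.κ - 1 := by linarith [hT.κ_ge]
  have h4 := hT.log_pos
  have hc := cst_pos
  unfold gridL
  positivity

theorem gridBeta_pos (hT : T.Admissible n) (j : ℕ) : 0 < gridBeta n T j := by
  have h1 := hT.n_pos'
  have h2 := hT.sqrt_pos
  have h4 := hT.s_pos
  have hc := cst_pos
  unfold gridBeta
  positivity

theorem xi_pos (hT : T.Admissible n) (j : ℕ) : 0 < xi n T j := by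
  have := hT.gridL_pos j
  have := hT.κ_ge
  unfold xi
  positivity

theorem mu_pos (hT : T.Admissible n) (j : ℕ) : 0 < mu n T j := by
  have h1 := hT.gridL_pos j
  have h2 := hT.gridBeta_pos j
  have h3 := hT.sqrt_pos
  have h4 := hT.s_pos
  have h5 : 0 < T.κ - 1 := by linarith [hT.κ_ge]
  have hc := cst_pos
  unfold mu
  positivity

end Tuning.Admissible

/-- The part of the error level that does not depend on the energy. -/
def etaConst (n : ℕ) (T : Tuning) (j : ℕ) : ℝ :=
  (T.κ - 1) * gridL n T j / 2 + (2 + cst) * Real.sqrt T.κ * T.s / gridBeta n T j +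
    (2 + 3 * cst) * T.s ^ 2 / (2 * gridBeta n T j ^ 2 * gridL n T j) +
    Real.log ((gridSize n T : ℝ) / T.ε) / (n * gridL n T j)

theorem eta_eq (n : ℕ) (T : Tuning) (j : ℕ) (t : ℝ) :
    eta n T j t = etaConst n T j + gridBeta n T j / (2 * n) / t := by
  rw [eta, etaConst, div_div]

namespace Tuning.Admissible

variable {n : ℕ} {T : Tuning}

theorem etaConst_pos (hT : T.Admissible n) (j : ℕ) : 0 < etaConst n T j := by
  have h1 := hT.gridL_pos j
  have h2 := hT.gridBeta_pos j
  have h3 := hT.sqrt_pos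
  have h4 := hT.s_pos
  have h5 : 0 < T.κ - 1 := by linarith [hT.κ_ge]
  have h6 := hT.n_pos'
  have h7 := hT.log_pos
  have hc := cst_pos
  unfold etaConst
  positivity

theorem slope_pos (hT : T.Admissible n) (j : ℕ) : 0 < gridBeta n T j / (2 * n) := by
  have h2 := hT.gridBeta_pos j
  have h6 := hT.n_pos'
  positivity

theorem eta_pos (hT : T.Admissible n) (j : ℕ) {t : ℝ} (ht : 0 ≤ t) : 0 < eta n T j t := by
  rw [eta_eq]
  have h1 := hT.etaConst_pos j
  have h2 := hT.slope_pos j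
  positivity

theorem eta_anti (hT : T.Admissible n) (j : ℕ) {t t' : ℝ} (ht : 0 < t) (h : t ≤ t') :
    eta n T j t' ≤ eta n T j t := by
  rw [eta_eq, eta_eq]
  have h2 := hT.slope_pos j
  gcongr

end Tuning.Admissible

/-- A convex quadratic lies below its chord on [η, 1]: at η its value is -η(μ - ξη) ≤ 0, at 1 it is
η + ξ - 1 - μ < 0. -/
theorem quadratic_neg_of_lt {ξ μ η x : ℝ} (hξ : 0 < ξ) (hμ : 0 < μ) (hη : 0 < η)
    (h : ξ + μ + 2 * η < 1) (hμξ : ξ * η ≤ μ) (hx : η < x) (hx1 : x ≤ 1) :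
    η - (1 + μ) * x + ξ * x ^ 2 < 0 := by
  have h1 : (1 - η) * (η - (1 + μ) * x + ξ * x ^ 2) =
      -((1 - x) * (η * (μ - ξ * η))) - (x - η) * (1 + μ - η - ξ) -
        ξ * (1 - η) * (x - η) * (1 - x) := by ring
  have h2 : 0 ≤ (1 - x) * (η * (μ - ξ * η)) :=
    mul_nonneg (by linarith) (mul_nonneg hη.le (by linarith))
  have h3 : 0 < (x - η) * (1 + μ - η - ξ) := mul_pos (by linarith) (by linarith)
  have h4 : 0 ≤ ξ * (1 - η) * (x - η) * (1 - x) :=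
    mul_nonneg (mul_nonneg (mul_nonneg hξ.le (by linarith)) (by linarith)) (by linarith)
  have h5 : (1 - η) * (η - (1 + μ) * x + ξ * x ^ 2) < 0 := by linarith
  by_contra hc
  push Not at hc
  have := mul_nonneg (show 0 ≤ 1 - η by linarith) hc
  linarith

/-! ### Inversion of the deviation bound into bounds on the energy. -/

/-- The conclusion of the deviation inequality at a given point of the grid, for both signs. -/
def CritBound {d n : ℕ} (T : Tuning) (j : ℕ) (N : Vec d → ℝ) (x : Fin n → Vec d) : Prop :=
  ∀ ς : ℝ, ς = 1 ∨ ς = -1 → ∀ θ : Vec d,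
    ς * crit x (gridL n T j) θ ≤ ς * (N θ - gridL n T j) +
      (T.κ * N θ ^ 2 - 2 * gridL n T j * N θ + gridL n T j ^ 2) / 2 +
      (2 + cst) * Real.sqrt T.κ * T.s / gridBeta n T j * N θ +
      (2 + 3 * cst) * T.s ^ 2 / (2 * gridBeta n T j ^ 2) +
      gridBeta n T j * ‖θ‖ ^ 2 / (2 * n) + Real.log ((gridSize n T : ℝ) / T.ε) / n

/-- The scaling α = √(l/t) tests the value t for the energy: the perturbation terms combine into
`eta` at t, and only the relative error 1 - N(θ)/t remains. -/
theorem CritBound.apply_sqrt {d n : ℕ} {T : Tuning} {j : ℕ} {N : Vec d → ℝ} {x : Fin n → Vec d}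
    (h : CritBound T j N x) (hT : T.Admissible n) (hN : ∀ (α : ℝ) θ, N (α • θ) = α ^ 2 * N θ)
    {θ : Vec d} (hθ : ‖θ‖ = 1) {t : ℝ} (ht : 0 < t) {ς : ℝ} (hς : ς = 1 ∨ ς = -1) :
    ς * crit x (gridL n T j) (Real.sqrt (gridL n T j / t) • θ) ≤
      gridL n T j * (eta n T j t - (ς + mu n T j) * (1 - N θ / t) +
        xi n T j * (1 - N θ / t) ^ 2) := by
  have hl := hT.gridL_pos j
  have hβ := hT.gridBeta_pos j
  have hn := hT.n_pos'
  refine (h ς hς _).trans (le_of_eq ?_)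
  rw [hN, norm_smul, hθ, Real.norm_eq_abs, mul_one, sq_abs, Real.sq_sqrt (by positivity), eta, mu,
    xi]
  field_simp
  ring

/-- If it failed at D = `Nhat`, then x = 1 - N(θ)/D would exceed η(D), where the quadratic bound is
negative. But the criterion is positive at every t < D, so the bound is nonnegative in the limit t →
D. -/
theorem phiMinus_Nhat_le {d n : ℕ} {T : Tuning} {j : ℕ} {N : Vec d → ℝ} {x : Fin n → Vec d}
    (h : CritBound T j N x) (hT : T.Admissible n) (hN : ∀ (α : ℝ) θ, N (α • θ) = α ^ 2 * N θ)
    (hN0 : ∀ θ, 0 ≤ N θ) {θ : Vec d} (hθ : ‖θ‖ = 1) :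
    phiMinus n T j (Nhat x (gridL n T j) θ) ≤ N θ := by
  have hl := hT.gridL_pos j
  have hξ := hT.xi_pos j
  have hμ := hT.mu_pos j
  set D := Nhat x (gridL n T j) θ with hD
  unfold phiMinus
  split_ifs with hI
  swap
  · exact hN0 θ
  rcases (Nhat_nonneg x hl θ).eq_or_lt with hD0 | hD0
  · rw [← hD] at hD0
    rw [← hD0, zero_mul]
    exact hN0 θ
  rw [← hD] at hD0
  by_contra hc
  push Not at hc
  have hη := hT.eta_pos j hD0.le
  unfold Informative at hI
  have hx : eta n T j D < 1 - N θ / D := by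
    rw [lt_sub_comm, div_lt_iff₀ hD0, mul_comm]
    exact hc
  have hx1 : 1 - N θ / D ≤ 1 := by
    have : 0 ≤ N θ / D := div_nonneg (hN0 θ) hD0.le
    linarith
  -- Since η ≤ 1/2, it suffices that κ/4 ≤ κ - 1, which the lower bound on κ provides.
  have hμξ : xi n T j * eta n T j D ≤ mu n T j := by
    have h1 : eta n T j D ≤ 1 / 2 := by linarith
    have h2 : (T.κ - 1) * gridL n T j ≤ mu n T j := by
      have h3 := hT.gridBeta_pos j
      have h4 := hT.sqrt_pos
      have h5 := hT.s_pos
      have hc := cst_pos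
      have : 0 ≤ (2 + cst) * Real.sqrt T.κ * T.s / gridBeta n T j := by positivity
      rw [mu]
      linarith
    have h3 := mul_le_mul_of_nonneg_left h1 hξ.le
    have h4 : xi n T j * (1 / 2) ≤ (T.κ - 1) * gridL n T j := by
      rw [xi]
      nlinarith [hT.κ_ge]
    linarith
  have hneg := quadratic_neg_of_lt hξ hμ hη hI hμξ hx hx1
  have hcont : ContinuousAt (fun t => gridL n T j * (eta n T j t -
      (1 + mu n T j) * (1 - N θ / t) + xi n T j * (1 - N θ / t) ^ 2)) D := by
    simp_rw [eta_eq]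
    have := hD0.ne'
    fun_prop (disch := assumption)
  have hlim := (hcont.tendsto.mono_left (nhdsWithin_le_nhds (s := Set.Iio D)))
  have hge : 0 ≤ gridL n T j * (eta n T j D -
      (1 + mu n T j) * (1 - N θ / D) + xi n T j * (1 - N θ / D) ^ 2) := by
    refine ge_of_tendsto hlim ?_
    filter_upwards [Ioo_mem_nhdsLT hD0] with t ht
    have h1 := crit_pos_of_lt_Nhat x hl θ ht.1 ht.2
    have h2 := h.apply_sqrt hT hN hθ ht.1 (Or.inl rfl)
    rw [one_mul] at h2
    exact h1.le.trans h2
  have := mul_neg_of_pos_of_neg hl hneg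
  linarith

/-- At t = N(θ)/(1 + y) the bound with sign -1 makes the criterion positive. By monotonicity in α,
no α with l/α² < t can belong to the set defining `Nhat`. -/
theorem phiPlus_le_Nhat {d n : ℕ} {T : Tuning} {j : ℕ} {N : Vec d → ℝ} {x : Fin n → Vec d}
    (h : CritBound T j N x) (hT : T.Admissible n) (hN : ∀ (α : ℝ) θ, N (α • θ) = α ^ 2 * N θ)
    (hN0 : ∀ θ, 0 ≤ N θ) {θ : Vec d} (hθ : ‖θ‖ = 1) :
    phiPlus n T j (N θ) ≤ Nhat x (gridL n T j) θ := by
  have hl := hT.gridL_pos j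
  have hξ := hT.xi_pos j
  have hμ := hT.mu_pos j
  have hB := hT.slope_pos j
  have he := hT.etaConst_pos j
  unfold phiPlus
  split_ifs with hI
  swap
  · exact Nhat_nonneg x hl θ
  unfold Informative at hI
  rcases (hN0 θ).eq_or_lt with h0 | h0
  · rw [← h0, zero_div]
    exact Nhat_nonneg x hl θ
  have hη := hT.eta_pos j h0.le
  set η := eta n T j (N θ) with hηdef
  have hden : 0 < 1 - mu n T j - 2 * η := by linarith
  set y := η / (1 - mu n T j - 2 * η) with hy
  have hy0 : 0 < y := by positivity
  set t := N θ / (1 + y) with ht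
  have ht0 : 0 < t := by positivity
  obtain ⟨α₀, hα₀, hα₀'⟩ := exists_crit_nonpos x hl θ
  refine le_csInf ⟨_, ⟨α₀, ⟨hα₀, hα₀'⟩, rfl⟩⟩ ?_
  rintro _ ⟨α, ⟨hα, hα'⟩, rfl⟩
  by_contra hc
  push Not at hc
  have hle : Real.sqrt (gridL n T j / t) ≤ α := by
    rw [Real.sqrt_le_left hα.le, div_le_iff₀ ht0]
    rw [div_lt_iff₀ (by positivity)] at hc
    linarith
  have hcr := (crit_smul_mono x (gridL n T j) θ (Real.sqrt_nonneg _) hle).trans hα'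
  have h2 := h.apply_sqrt hT hN hθ ht0 (Or.inr rfl)
  have hNt : N θ / t = 1 + y := by
    rw [ht, div_div_cancel₀ h0.ne']
  rw [hNt] at h2
  have hηt : eta n T j t ≤ η + η * y := by
    have e1 : eta n T j t = η + gridBeta n T j / (2 * n) / N θ * y := by
      rw [hηdef, eta_eq, eta_eq, ht]
      field_simp
      ring
    have e2 : gridBeta n T j / (2 * n) / N θ ≤ η := by
      rw [hηdef, eta_eq]
      linarith
    rw [e1]
    gcongr
  have hyd : y * (1 - mu n T j - 2 * η) = η := div_mul_cancel₀ _ hden.ne'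
  -- By the choice of y, η = y(1 - μ - 2η), so the expression is at most y(ξy - η), and
  -- informativeness gives ξy < η.
  have hneg : eta n T j t - (-1 + mu n T j) * (1 - (1 + y)) + xi n T j * (1 - (1 + y)) ^ 2 < 0 := by
    have e3 : xi n T j * y < η := by
      rw [← hyd]
      nlinarith
    nlinarith
  have := mul_neg_of_pos_of_neg hl hneg
  linarith

/-! ### Precision of the confidence region -/

theorem add_inv_le_two_cosh {ρ b : ℝ} (h0 : Real.exp (-b) ≤ ρ) (h1 : ρ ≤ Real.exp b) :
    ρ + ρ⁻¹ ≤ 2 * Real.cosh b := by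
  have hρ : 0 < ρ := (Real.exp_pos _).trans_le h0
  have e : Real.exp b * Real.exp (-b) = 1 := by rw [← Real.exp_add, add_neg_cancel, Real.exp_zero]
  have h := mul_nonneg (sub_nonneg.2 h0) (sub_nonneg.2 h1)
  rw [Real.cosh_eq]
  have : (ρ + ρ⁻¹) * ρ ≤ (2 * ((Real.exp b + Real.exp (-b)) / 2)) * ρ := by
    rw [add_mul, inv_mul_cancel₀ hρ.ne']
    nlinarith
  exact le_of_mul_le_mul_right this hρ

namespace Tuning.Admissible

variable {n : ℕ} {T : Tuning}

theorem zeta_anti (hT : T.Admissible n) {t t' : ℝ} (ht : 0 < t) (h : t ≤ t') :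
    zeta n T t' ≤ zeta n T t := by
  have h2 := hT.sqrt_pos
  have h3 : 0 < T.κ - 1 := by linarith [hT.κ_ge]
  have h4 := hT.s_pos
  have hc := cst_pos
  have := Real.cosh_pos (T.a / 4)
  have := Real.cosh_pos (T.a / 2)
  unfold zeta
  gcongr

theorem zeta_pos (hT : T.Admissible n) {t : ℝ} (ht : 0 < t) : 0 < zeta n T t := by
  have h2 := hT.sqrt_pos
  have h3 : 0 < T.κ - 1 := by linarith [hT.κ_ge]
  have h4 := hT.s_pos
  have hc := cst_pos
  have := Real.cosh_pos (T.a / 4)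
  have := Real.cosh_pos (T.a / 2)
  unfold zeta
  positivity

/-- Moving √t inside the roots leaves t only as a positive multiple of the logarithm. -/
theorem sqrt_mul_zeta_mono (hT : T.Admissible n) {t t' : ℝ} (ht : 0 < t) (h : t ≤ t') :
    Real.sqrt t * zeta n T t ≤ Real.sqrt t' * zeta n T t' := by
  have h2 := hT.sqrt_pos
  have h3 : 0 < T.κ - 1 := by linarith [hT.κ_ge]
  have h4 := hT.s_pos
  have h5 := hT.log_pos
  have hc := cst_pos
  have hc4 := Real.cosh_pos (T.a / 4)
  have hc2 := Real.cosh_pos (T.a / 2)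
  have key : ∀ t, 0 < t → Real.sqrt t * zeta n T t =
      Real.sqrt (2 * (T.κ - 1) * ((2 + 3 * cst) * T.s / (4 * (2 + cst) * Real.sqrt T.κ) +
        t * Real.log ((gridSize n T : ℝ) / T.ε))) * Real.cosh (T.a / 4) +
      Real.sqrt (2 * (2 + cst) * Real.sqrt T.κ * T.s) * Real.cosh (T.a / 2) := by
    intro t ht
    rw [zeta, mul_add, ← mul_assoc, ← mul_assoc, ← Real.sqrt_mul ht.le, ← Real.sqrt_mul ht.le]
    congr 3
    · field_simp
    · field_simp
  rw [key t ht, key t' (ht.trans_le h)]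
  gcongr

/-- For every energy between `σ` and `s₄²` some point of the grid is adapted to it. -/
theorem exists_eta_le (hT : T.Admissible n) {σ t : ℝ} (hσ : 0 < σ)
    (hζ : 8 * zeta n T σ ≤ Real.sqrt n) (hσt : σ ≤ t) (hts : t ≤ T.s) :
    ∃ j < gridSize n T, eta n T j t ≤ (Real.sqrt n)⁻¹ * zeta n T t := by
  have hn := hT.n_pos'
  have hk := hT.sqrt_pos
  have hκ : 0 < T.κ - 1 := by linarith [hT.κ_ge]
  have hs := hT.s_pos
  have ha := hT.a_pos
  have hΛ := hT.log_pos
  have hc := cst_pos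
  have ht : 0 < t := hσ.trans_le hσt
  set k := Real.sqrt T.κ with hkdef
  set Λ := Real.log ((gridSize n T : ℝ) / T.ε) with hΛdef
  set u := T.a⁻¹ * Real.log (T.s / t) with hu
  have hu0 : 0 ≤ u := mul_nonneg (inv_nonneg.2 ha.le)
    (Real.log_nonneg (by rwa [one_le_div ht]))
  -- The ideal real index is u = a⁻¹ log(s/t), and j is the nearest integer, so the offset v = (u -
  -- j)a is at most a/2 in absolute value.
  have hj1 : (⌊u + 1 / 2⌋₊ : ℝ) ≤ u + 1 / 2 := Nat.floor_le (by linarith)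
  have hj2 : u + 1 / 2 < (⌊u + 1 / 2⌋₊ : ℝ) + 1 := Nat.lt_floor_add_one _
  set j := ⌊u + 1 / 2⌋₊
  refine ⟨j, ?_, ?_⟩
  · have hle : T.s / t ≤ n / (72 * (2 + cst) * k) := by
      have h1 : Real.sqrt (2 * (2 + cst) * k * T.s / σ) ≤ zeta n T σ := by
        rw [zeta]
        have e1 := Real.one_le_cosh (T.a / 2)
        have e2 := Real.cosh_pos (T.a / 4)
        have e3 : 0 ≤ Real.sqrt (2 * (T.κ - 1) * ((2 + 3 * cst) * T.s /
          (4 * (2 + cst) * Real.sqrt T.κ * σ) + Real.log ((gridSize n T : ℝ) / T.ε))) *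
            Real.cosh (T.a / 4) := by positivity
        have e4 := le_mul_of_one_le_right
          (Real.sqrt_nonneg (2 * (2 + cst) * Real.sqrt T.κ * T.s / σ)) e1
        linarith
      have h2 : 8 * Real.sqrt (2 * (2 + cst) * k * T.s / σ) ≤ Real.sqrt n := by linarith
      have h3 := pow_le_pow_left₀ (by positivity) h2 2
      rw [mul_pow, Real.sq_sqrt (by positivity), Real.sq_sqrt hn.le] at h3
      have h4 : T.s / t ≤ T.s / σ := by gcongr
      rw [le_div_iff₀ (by positivity)]
      have h5 : 8 ^ 2 * (2 * (2 + cst) * k * T.s / σ) = T.s / σ * (128 * (2 + cst) * k) := by ring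
      rw [h5] at h3
      calc T.s / t * (72 * (2 + cst) * k) ≤ T.s / σ * (128 * (2 + cst) * k) := by
            gcongr
            norm_num
        _ ≤ n := h3
    have hu1 : u ≤ ⌈T.a⁻¹ * Real.log ((n : ℝ) / (72 * (2 + cst) * k))⌉₊ := by
      refine le_trans ?_ (Nat.le_ceil _)
      rw [hu]
      gcongr
    have : (j : ℝ) < (gridSize n T : ℝ) := by
      rw [gridSize]
      push_cast
      linarith
    exact_mod_cast this
  · -- the deviation of the grid point from the ideal parameter
    set v := u * T.a - j * T.a with hv
    have hv1 : -(T.a / 2) ≤ v := by rw [hv]; nlinarith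
    have hv2 : v ≤ T.a / 2 := by rw [hv]; nlinarith
    have hua : u * T.a = Real.log (T.s / t) := by rw [hu]; field_simp
    have hexp : Real.exp (-(j * T.a)) = t / T.s * Real.exp v := by
      have : -(j * T.a) = -Real.log (T.s / t) + v := by rw [hv, hua]; ring
      rw [this, Real.exp_add, Real.exp_neg, Real.exp_log (by positivity), inv_div]
    have hexp2 : Real.exp (-((j - 1 / 2) * T.a)) = t / T.s * Real.exp (v + T.a / 2) := by
      rw [Real.exp_add, ← mul_assoc, ← hexp, ← Real.exp_add]
      congr 1
      ring
    set D := (2 + 3 * cst) * T.s / (4 * (2 + cst) * k) with hD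
    have hD0 : 0 < D := by positivity
    set W := D / t + Λ with hW
    have hW0 : 0 < W := by positivity
    have hl := hT.gridL_pos j
    have hβ := hT.gridBeta_pos j
    have hlsq : gridL n T j ^ 2 = 2 / (n * (T.κ - 1)) * (D / (t * Real.exp v) + Λ) := by
      rw [gridL, hexp, ← hkdef, Real.sq_sqrt (by positivity)]
      congr 2
      rw [hD]
      field_simp
    have hβsq : gridBeta n T j ^ 2 = 2 * (2 + cst) * k * T.s * n * t * Real.exp (v + T.a / 2) := by
      rw [gridBeta, hexp2, ← hkdef, Real.sq_sqrt (by positivity)]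
      field_simp
    -- l' and β' are the parameters suited to the exact energy t. The grid values differ from them
    -- by factors ρ and r, whose distance to 1 costs cosh(a/4) and cosh(a/2).
    set l' := Real.sqrt (2 / (n * (T.κ - 1)) * W) with hl'
    have hl'0 : 0 < l' := Real.sqrt_pos.2 (by positivity)
    have hl'sq : l' ^ 2 = 2 / (n * (T.κ - 1)) * W := Real.sq_sqrt (by positivity)
    set β' := Real.sqrt (2 * (2 + cst) * k * T.s * n * t) with hβ'
    have hβ'0 : 0 < β' := Real.sqrt_pos.2 (by positivity)
    have hβ'sq : β' ^ 2 = 2 * (2 + cst) * k * T.s * n * t := Real.sq_sqrt (by positivity)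
    set ρ := gridL n T j / l' with hρ
    set r := gridBeta n T j / β' with hr
    have hρ0 : 0 < ρ := by positivity
    have hr0 : 0 < r := by positivity
    have hlρ : gridL n T j = l' * ρ := by rw [hρ]; field_simp
    have hβr : gridBeta n T j = β' * r := by rw [hr]; field_simp
    have hρsq : ρ ^ 2 * W = D / (t * Real.exp v) + Λ := by
      have h1 : (l' * ρ) ^ 2 = 2 / (n * (T.κ - 1)) * (D / (t * Real.exp v) + Λ) := by
        rw [← hlρ, hlsq]
      rw [mul_pow, hl'sq, mul_assoc] at h1
      have h2 := mul_left_cancel₀ (show 2 / ((n : ℝ) * (T.κ - 1)) ≠ 0 by positivity) h1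
      linarith
    have hrsq : r ^ 2 = Real.exp (v + T.a / 2) := by
      have h1 : (β' * r) ^ 2 = 2 * (2 + cst) * k * T.s * n * t * Real.exp (v + T.a / 2) := by
        rw [← hβr, hβsq]
      rw [mul_pow, hβ'sq] at h1
      exact mul_left_cancel₀ (by positivity) h1
    have hsqexp : ∀ b : ℝ, Real.exp b ^ 2 = Real.exp (2 * b) := fun b => by
      rw [← Real.exp_nat_mul]; norm_num
    have hcosh1 : ρ + ρ⁻¹ ≤ 2 * Real.cosh (T.a / 4) := by
      refine add_inv_le_two_cosh ?_ ?_
      · refine le_of_sq_le_sq ?_ hρ0.le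
        rw [hsqexp]
        have h1 : Real.exp (2 * -(T.a / 4)) * W ≤ ρ ^ 2 * W := by
          rw [hρsq, hW, mul_add]
          have h2 : Real.exp (2 * -(T.a / 4)) * Λ ≤ Λ :=
            mul_le_of_le_one_left hΛ.le (Real.exp_le_one_iff.2 (by linarith))
          have h3 : Real.exp (2 * -(T.a / 4)) * (D / t) ≤ D / (t * Real.exp v) := by
            have h4 : Real.exp (2 * -(T.a / 4)) ≤ (Real.exp v)⁻¹ := by
              rw [← Real.exp_neg]; exact Real.exp_le_exp.2 (by linarith)
            calc Real.exp (2 * -(T.a / 4)) * (D / t) ≤ (Real.exp v)⁻¹ * (D / t) := by gcongr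
              _ = _ := by field_simp
          linarith
        exact le_of_mul_le_mul_right h1 hW0
      · refine le_of_sq_le_sq ?_ (Real.exp_pos _).le
        rw [hsqexp]
        have h1 : ρ ^ 2 * W ≤ Real.exp (2 * (T.a / 4)) * W := by
          rw [hρsq, hW, mul_add]
          have h2 : Λ ≤ Real.exp (2 * (T.a / 4)) * Λ :=
            le_mul_of_one_le_left hΛ.le (Real.one_le_exp (by linarith))
          have h3 : D / (t * Real.exp v) ≤ Real.exp (2 * (T.a / 4)) * (D / t) := by
            have h4 : (Real.exp v)⁻¹ ≤ Real.exp (2 * (T.a / 4)) := by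
              rw [← Real.exp_neg]; exact Real.exp_le_exp.2 (by linarith)
            calc D / (t * Real.exp v) = (Real.exp v)⁻¹ * (D / t) := by field_simp
              _ ≤ _ := by gcongr
          linarith
        exact le_of_mul_le_mul_right h1 hW0
    have hcosh2 : r + r⁻¹ ≤ 2 * Real.cosh (T.a / 2) := by
      refine add_inv_le_two_cosh ?_ ?_
      · refine le_of_sq_le_sq ?_ hr0.le
        rw [hsqexp, hrsq]
        exact Real.exp_le_exp.2 (by linarith)
      · refine le_of_sq_le_sq ?_ (Real.exp_pos _).le
        rw [hsqexp, hrsq]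
        exact Real.exp_le_exp.2 (by linarith)
    have hfirst : (T.κ - 1) * gridL n T j / 2 +
        ((2 + 3 * cst) * T.s ^ 2 / (2 * gridBeta n T j ^ 2 * gridL n T j) + Λ / (n * gridL n T j)) ≤
        (Real.sqrt n)⁻¹ * (Real.sqrt (2 * (T.κ - 1) * W) * Real.cosh (T.a / 4)) := by
      have h1 : (2 + 3 * cst) * T.s ^ 2 / (2 * gridBeta n T j ^ 2 * gridL n T j) =
          D / (n * t * gridL n T j) * (Real.exp (v + T.a / 2))⁻¹ := by
        rw [hβsq, hD]
        field_simp
        norm_num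
      -- The half-step shift in `gridBeta` ensures that the grid value is at least β', so the term
      -- with β² in its denominator does not exceed its ideal value.
      have h2 : (Real.exp (v + T.a / 2))⁻¹ ≤ 1 :=
        inv_le_one_of_one_le₀ (Real.one_le_exp (by linarith))
      have h3 : D / (n * t * gridL n T j) * (Real.exp (v + T.a / 2))⁻¹ ≤ D / (n * t * gridL n T j) :=
        mul_le_of_le_one_right (by positivity) h2
      have h4 : D / (n * t * gridL n T j) + Λ / (n * gridL n T j) = W / (n * l') * ρ⁻¹ := by
        rw [hW, hlρ]
        field_simp
      have h5 : W / (n * l') = (T.κ - 1) * l' / 2 := by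
        have : W = l' ^ 2 * (n * (T.κ - 1)) / 2 := by rw [hl'sq]; field_simp
        rw [this]
        field_simp
      have h6 : (T.κ - 1) * l' = (Real.sqrt n)⁻¹ * Real.sqrt (2 * (T.κ - 1) * W) := by
        refine (pow_left_inj₀ (by positivity) (by positivity) two_ne_zero).1 ?_
        rw [mul_pow, mul_pow, hl'sq, inv_pow, Real.sq_sqrt hn.le, Real.sq_sqrt (by positivity)]
        field_simp
      rw [← mul_assoc, ← h6, h1]
      calc _ ≤ (T.κ - 1) * gridL n T j / 2 + W / (n * l') * ρ⁻¹ := by rw [← h4]; linarith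
        _ = (T.κ - 1) * l' / 2 * (ρ + ρ⁻¹) := by rw [h5, hlρ]; ring
        _ ≤ (T.κ - 1) * l' / 2 * (2 * Real.cosh (T.a / 4)) := by gcongr
        _ = _ := by ring
    have hsecond : (2 + cst) * k * T.s / gridBeta n T j + gridBeta n T j / (2 * n * t) ≤
        (Real.sqrt n)⁻¹ * (Real.sqrt (2 * (2 + cst) * k * T.s / t) * Real.cosh (T.a / 2)) := by
      have h1 : (2 + cst) * k * T.s / gridBeta n T j = β' / (2 * n * t) * r⁻¹ := by
        have : (2 + cst) * k * T.s = β' ^ 2 / (2 * n * t) := by rw [hβ'sq]; field_simp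
        rw [this, hβr]
        field_simp
      have h6 : β' / (n * t) = (Real.sqrt n)⁻¹ * Real.sqrt (2 * (2 + cst) * k * T.s / t) := by
        refine (pow_left_inj₀ (by positivity) (by positivity) two_ne_zero).1 ?_
        rw [div_pow, mul_pow (Real.sqrt n)⁻¹, hβ'sq, inv_pow, Real.sq_sqrt hn.le, Real.sq_sqrt (by positivity)]
        field_simp
      rw [← mul_assoc, ← h6, h1, hβr]
      calc β' / (2 * n * t) * r⁻¹ + β' * r / (2 * n * t) = β' / (2 * n * t) * (r + r⁻¹) := by ring
        _ ≤ β' / (2 * n * t) * (2 * Real.cosh (T.a / 2)) := by gcongr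
        _ = _ := by field_simp
    have hWe : (2 + 3 * cst) * T.s / (4 * (2 + cst) * k * t) + Λ = W := by
      rw [hW, hD, div_div]
    rw [eta, zeta, hWe, mul_add]
    linarith

/-- The error level dominates the auxiliary quantities `ξ_j` and `μ_j`. -/
theorem xi_add_mu_lt (hT : T.Admissible n) (j : ℕ) {t : ℝ} (ht : 0 < t) :
    xi n T j + mu n T j < 5 * eta n T j t ∧ mu n T j < 2 * eta n T j t := by
  have hn := hT.n_pos'
  have hk := hT.sqrt_pos
  have hκ : 0 < T.κ - 1 := by linarith [hT.κ_ge]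
  have hs := hT.s_pos
  have hΛ := hT.log_pos
  have hc := cst_pos
  have hl := hT.gridL_pos j
  have hβ := hT.gridBeta_pos j
  have h1 : 0 < (2 + cst) * Real.sqrt T.κ * T.s / gridBeta n T j := by positivity
  have h2 : 0 < (2 + 3 * cst) * T.s ^ 2 / (2 * gridBeta n T j ^ 2 * gridL n T j) := by positivity
  have h3 : 0 < Real.log ((gridSize n T : ℝ) / T.ε) / (n * gridL n T j) := by positivity
  have h4 : 0 < gridBeta n T j / (2 * n * t) := by positivity
  -- This amounts to κ ≤ 3(κ - 1), whence ξ + (κ - 1)l is at most five times the first term of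
  -- `eta`.
  have h5 : 3 / 2 * gridL n T j ≤ T.κ * gridL n T j := by gcongr; exact hT.κ_ge
  rw [xi, mu, eta]
  constructor <;> linarith

end Tuning.Admissible

/-- Two energies compatible with the same estimate are close: lower bound. -/
theorem sub_le_of_phi {n : ℕ} {T : Tuning} (hT : T.Admissible n) {j : ℕ} {t D q e : ℝ}
    (ht : 0 < t) (he : eta n T j t = e) (he8 : e ≤ 1 / 8)
    (h1 : phiPlus n T j t ≤ D) (h2 : phiMinus n T j D ≤ q) :
    t - 2 * t * (e / (1 - 4 * e)) ≤ q ∧ t / (1 + e / (1 - 4 * e)) ≤ D := by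
  have hξ := hT.xi_pos j
  have hμ := hT.mu_pos j
  obtain ⟨h5, h6⟩ := hT.xi_add_mu_lt j ht
  have he0 := hT.eta_pos j ht.le
  rw [he] at h5 h6 he0
  set B := e / (1 - 4 * e) with hB
  have hd : 0 < 1 - 4 * e := by linarith
  have hB0 : 0 < B := by positivity
  have hB1 : B ≤ 1 / 4 := by rw [hB, div_le_iff₀ hd]; linarith
  have heB : e ≤ B := by rw [hB, le_div_iff₀ hd]; nlinarith
  have hI : Informative n T j t := by
    unfold Informative
    rw [he]
    linarith
  rw [phiPlus, if_pos hI, he] at h1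
  have hy : e / (1 - mu n T j - 2 * e) ≤ B := by
    rw [hB]
    exact div_le_div_of_nonneg_left he0.le hd (by linarith)
  have hy0 : 0 < e / (1 - mu n T j - 2 * e) := div_pos he0 (by linarith)
  set S := t / (1 + B) with hS
  have hS0 : 0 < S := by positivity
  have hSD : S ≤ D := le_trans (by rw [hS]; gcongr) h1
  refine ⟨?_, hSD⟩
  have hD0 : 0 < D := hS0.trans_le hSD
  have hηS : eta n T j S ≤ e * (1 + B) := by
    have e1 := hT.etaConst_pos j
    rw [eta_eq] at he ⊢
    have e2 : gridBeta n T j / (2 * n) / S = gridBeta n T j / (2 * n) / t * (1 + B) := by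
      rw [hS]
      field_simp
    rw [e2, ← he]
    nlinarith
  have hηD : eta n T j D ≤ eta n T j S := hT.eta_anti j hS0 hSD
  -- The estimate D can be smaller than t, but only by the factor 1 + B ≤ 5/4; thus ξ + μ + 2η(D) <
  -- 5e + 5e/2 < 1.
  have hID : Informative n T j D := by
    unfold Informative
    nlinarith
  rw [phiMinus, if_pos hID] at h2
  -- Multiplied by the energy, 1 - η becomes affine with positive slope.
  have hmono : S * (1 - eta n T j S) ≤ D * (1 - eta n T j D) := by
    rw [eta_eq, eta_eq]
    have hE : etaConst n T j < 1 := by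
      have : 0 < gridBeta n T j / (2 * n) / t := div_pos (hT.slope_pos j) ht
      rw [eta_eq] at he
      linarith
    have e1 : S * (1 - (etaConst n T j + gridBeta n T j / (2 * n) / S)) =
        S * (1 - etaConst n T j) - gridBeta n T j / (2 * n) := by field_simp; ring
    have e2 : D * (1 - (etaConst n T j + gridBeta n T j / (2 * n) / D)) =
        D * (1 - etaConst n T j) - gridBeta n T j / (2 * n) := by field_simp; ring
    rw [e1, e2]
    have := mul_le_mul_of_nonneg_right hSD (sub_nonneg.2 hE.le)
    linarith
  have hfin : S * (1 - e * (1 + B)) ≤ S * (1 - eta n T j S) := by gcongr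
  have hSt : S * (1 + B) = t := by rw [hS]; field_simp
  have hSl : t * (1 - B) ≤ S := by
    rw [hS, le_div_iff₀ (by positivity)]
    nlinarith [mul_pos ht (mul_pos hB0 hB0)]
  have h7 : S * (1 - e * (1 + B)) = S - t * e := by rw [← hSt]; ring
  nlinarith

/-- Two energies compatible with the same estimate are close: upper bound. -/
theorem le_add_of_phi {n : ℕ} {T : Tuning} (hT : T.Admissible n) {j : ℕ} {t D p q e : ℝ}
    (ht : 0 < t) (he : eta n T j t = e) (he8 : e ≤ 1 / 8) (hp : p ≤ t)
    (h1 : phiPlus n T j q ≤ D) (h2 : phiMinus n T j D ≤ p) :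
    q ≤ t + 2 * t * (e / (1 - 4 * e)) := by
  have hξ := hT.xi_pos j
  have hμ := hT.mu_pos j
  obtain ⟨h5, h6⟩ := hT.xi_add_mu_lt j ht
  have he0 := hT.eta_pos j ht.le
  rw [he] at h5 h6 he0
  set B := e / (1 - 4 * e) with hB
  have hd : 0 < 1 - 4 * e := by linarith
  have hB0 : 0 < B := by positivity
  have hB1 : B ≤ 1 / 4 := by rw [hB, div_le_iff₀ hd]; linarith
  rcases le_or_gt q t with hqt | hqt
  · have : 0 < t * B := by positivity
    linarith
  have hq0 : 0 < q := ht.trans hqt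
  have hηq : eta n T j q ≤ e := he ▸ hT.eta_anti j ht hqt.le
  have hηq0 := hT.eta_pos j hq0.le
  have hI : Informative n T j q := by
    unfold Informative
    linarith
  rw [phiPlus, if_pos hI] at h1
  have hy : eta n T j q / (1 - mu n T j - 2 * eta n T j q) ≤ B := by
    rw [hB]
    exact div_le_div₀ he0.le hηq hd (by linarith)
  have hy0 : 0 < eta n T j q / (1 - mu n T j - 2 * eta n T j q) := div_pos hηq0 (by linarith)
  have hqD : q ≤ D * (1 + B) := by
    rw [← div_le_iff₀ (by positivity)]
    exact le_trans (by gcongr) h1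
  rcases le_or_gt D t with hDt | hDt
  · nlinarith [mul_pos ht hB0]
  have hD0 : 0 < D := ht.trans hDt
  have hηD : eta n T j D ≤ e := he ▸ hT.eta_anti j ht hDt.le
  have hID : Informative n T j D := by
    unfold Informative
    linarith
  rw [phiMinus, if_pos hID] at h2
  have h7 : D * (1 - e) ≤ t := by
    have : D * (1 - e) ≤ D * (1 - eta n T j D) := by gcongr
    linarith
  -- From B - e = 4Be, the difference of the two sides is 2Be.
  have h8 : 1 + B ≤ (1 + 2 * B) * (1 - e) := by
    have : B * (1 - 4 * e) = e := div_mul_cancel₀ _ hd.ne'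
    nlinarith
  calc q ≤ D * (1 + B) := hqD
    _ ≤ D * ((1 + 2 * B) * (1 - e)) := by gcongr
    _ = (1 + 2 * B) * (D * (1 - e)) := by ring
    _ ≤ (1 + 2 * B) * t := by gcongr
    _ = _ := by ring

/-! ### The width of the confidence region -/

/-- The value of `B_*` at an energy `u ≥ σ`. -/
def relWidth (n : ℕ) (T : Tuning) (u : ℝ) : ℝ :=
  (Real.sqrt n)⁻¹ * zeta n T u / (1 - 4 * (Real.sqrt n)⁻¹ * zeta n T u)

/-- The part of `Bfun` that depends on the energy. -/
def width (n : ℕ) (T : Tuning) (σ t : ℝ) : ℝ :=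
  2 * max t σ * (Bstar n T σ (min t T.s)).toReal

theorem Bfun_eq (n : ℕ) (T : Tuning) (σ δ gF t : ℝ) :
    Bfun n T σ δ gF t = width n T σ t + 7 * δ * gF + σ := rfl

theorem div_one_sub_mono {z z' : ℝ} (h : z ≤ z') (h' : z' ≤ 1 / 8) (h0 : 0 ≤ z) :
    z / (1 - 4 * z) ≤ z' / (1 - 4 * z') :=
  div_le_div₀ (h0.trans h) h (by linarith) (by linarith)

/-- The sample is large enough for the confidence region to be informative above `σ`. -/
structure Tuning.Precise (n : ℕ) (T : Tuning) (σ : ℝ) : Prop extends T.Admissible n where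
  σ_pos : 0 < σ
  σ_le : σ ≤ T.s
  zeta_le : 8 * zeta n T σ ≤ Real.sqrt n

namespace Tuning.Precise

variable {n : ℕ} {T : Tuning} {σ : ℝ}

theorem scaled_zeta_le (h : T.Precise n σ) {u : ℝ} (hu : σ ≤ u) :
    (Real.sqrt n)⁻¹ * zeta n T u ≤ 1 / 8 := by
  have h1 := h.zeta_anti h.σ_pos hu
  have h2 := Real.sqrt_pos.2 h.n_pos'
  rw [inv_mul_le_iff₀ h2]
  linarith [h.zeta_le]

theorem scaled_zeta_pos (h : T.Precise n σ) {u : ℝ} (hu : σ ≤ u) :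
    0 < (Real.sqrt n)⁻¹ * zeta n T u :=
  mul_pos (inv_pos.2 (Real.sqrt_pos.2 h.n_pos')) (h.zeta_pos (h.σ_pos.trans_le hu))

theorem relWidth_eq (u : ℝ) : relWidth n T u =
    ((Real.sqrt n)⁻¹ * zeta n T u) / (1 - 4 * ((Real.sqrt n)⁻¹ * zeta n T u)) := by
  rw [relWidth, mul_assoc 4]

theorem relWidth_nonneg (h : T.Precise n σ) {u : ℝ} (hu : σ ≤ u) : 0 ≤ relWidth n T u := by
  rw [relWidth_eq]
  have h1 := h.scaled_zeta_le hu
  have h2 := h.scaled_zeta_pos hu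
  exact div_nonneg h2.le (by linarith)

theorem relWidth_le (h : T.Precise n σ) {u : ℝ} (hu : σ ≤ u) : relWidth n T u ≤ 1 / 4 := by
  rw [relWidth_eq]
  have h1 := h.scaled_zeta_le hu
  rw [div_le_iff₀ (by linarith)]
  linarith

theorem relWidth_anti (h : T.Precise n σ) {u u' : ℝ} (hu : σ ≤ u) (huu : u ≤ u') :
    relWidth n T u' ≤ relWidth n T u := by
  rw [relWidth_eq, relWidth_eq]
  refine div_one_sub_mono ?_ (h.scaled_zeta_le hu) (h.scaled_zeta_pos (hu.trans huu)).le
  have := h.zeta_anti (h.σ_pos.trans_le hu) huu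
  gcongr

/-- The factor `relWidth` decreases, so this rests on √u ζ(u) being nondecreasing: with w = √(u/u')
it gives wz ≤ z', and w²z/(1 - 4z) ≤ wz/(1 - 4wz) holds because z ≤ 1/8. -/
theorem mul_relWidth_mono (h : T.Precise n σ) {u u' : ℝ} (hu : σ ≤ u) (huu : u ≤ u') :
    u * relWidth n T u ≤ u' * relWidth n T u' := by
  have hu0 : 0 < u := h.σ_pos.trans_le hu
  have hu'0 : 0 < u' := hu0.trans_le huu
  have hz8 := h.scaled_zeta_le hu
  have hz0 := h.scaled_zeta_pos hu
  have hz8' := h.scaled_zeta_le (hu.trans huu)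
  have hzz := h.sqrt_mul_zeta_mono hu0 huu
  rw [relWidth_eq, relWidth_eq]
  set z := (Real.sqrt n)⁻¹ * zeta n T u with hz
  set z' := (Real.sqrt n)⁻¹ * zeta n T u' with hz'
  set w := Real.sqrt u / Real.sqrt u' with hw
  have hs' : 0 < Real.sqrt u' := Real.sqrt_pos.2 hu'0
  have hw0 : 0 < w := div_pos (Real.sqrt_pos.2 hu0) hs'
  have hw1 : w ≤ 1 := by
    rw [hw, div_le_one hs']
    exact Real.sqrt_le_sqrt huu
  have hwsq : u = u' * w ^ 2 := by
    rw [hw, div_pow, Real.sq_sqrt hu0.le, Real.sq_sqrt hu'0.le]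
    field_simp
  have hwz : w * z ≤ z' := by
    rw [hw, hz, hz', div_mul_eq_mul_div, div_le_iff₀ hs']
    have := mul_le_mul_of_nonneg_left hzz (inv_nonneg.2 (Real.sqrt_nonneg (n : ℝ)))
    linarith
  have hwz1 : w * z ≤ 1 / 8 := hwz.trans hz8'
  have h1 : (w * z) / (1 - 4 * (w * z)) ≤ z' / (1 - 4 * z') :=
    div_one_sub_mono hwz hz8' (by positivity)
  have h2 : w ^ 2 * (z / (1 - 4 * z)) ≤ (w * z) / (1 - 4 * (w * z)) := by
    rw [← mul_div_assoc, div_le_div_iff₀ (by linarith) (by linarith)]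
    have h3 : w * (1 - 4 * (w * z)) ≤ 1 - 4 * z := by nlinarith
    calc w ^ 2 * z * (1 - 4 * (w * z)) = (w * z) * (w * (1 - 4 * (w * z))) := by ring
      _ ≤ (w * z) * (1 - 4 * z) := by gcongr
  calc u * (z / (1 - 4 * z)) = u' * (w ^ 2 * (z / (1 - 4 * z))) := by
        conv_lhs => rw [hwsq]
        ring
    _ ≤ u' * (z' / (1 - 4 * z')) := by
        gcongr
        exact h2.trans h1

theorem width_eq (h : T.Precise n σ) (t : ℝ) :
    width n T σ t = 2 * max t σ * relWidth n T (max (min t T.s) σ) := by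
  have h1 : (6 + (T.κ - 1)⁻¹) * zeta n T (max (min t T.s) σ) ≤ Real.sqrt n := by
    have h2 := h.zeta_anti h.σ_pos (le_max_right (min t T.s) σ)
    have h3 := h.zeta_pos (h.σ_pos.trans_le (le_max_right (min t T.s) σ))
    have h4 : (T.κ - 1)⁻¹ ≤ 2 := by
      rw [inv_le_comm₀ (by linarith [h.κ_ge]) two_pos]
      linarith [h.κ_ge]
    calc (6 + (T.κ - 1)⁻¹) * zeta n T (max (min t T.s) σ)
        ≤ (6 + 2) * zeta n T (max (min t T.s) σ) := by gcongr
      _ ≤ Real.sqrt n := by linarith [h.zeta_le]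
  rw [width, Bstar, if_pos h1, EReal.toReal_coe, relWidth]

theorem width_nonneg (h : T.Precise n σ) (t : ℝ) : 0 ≤ width n T σ t := by
  rw [h.width_eq]
  have := h.relWidth_nonneg (le_max_right (min t T.s) σ)
  have := h.σ_pos.trans_le (le_max_right t σ)
  positivity

theorem width_mono (h : T.Precise n σ) : Monotone (width n T σ) := by
  -- Two monotone pieces: the width at the energy clamped to [σ, s₄²], and a linear growth beyond
  -- s₄².
  have key : ∀ t, width n T σ t = 2 * (max (min t T.s) σ * relWidth n T (max (min t T.s) σ)) +
      2 * (max (t - T.s) 0 * relWidth n T T.s) := by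
    intro t
    rw [h.width_eq]
    rcases le_total t T.s with ht | ht
    · rw [min_eq_left ht, max_eq_right (by linarith : t - T.s ≤ 0)]
      ring
    · rw [min_eq_right ht, max_eq_left h.σ_le, max_eq_left (h.σ_le.trans ht),
        max_eq_left (by linarith : 0 ≤ t - T.s)]
      ring
  intro t t' htt
  rw [key, key]
  have h1 := h.mul_relWidth_mono (le_max_right (min t T.s) σ)
    (max_le_max (min_le_min htt le_rfl) le_rfl : max (min t T.s) σ ≤ max (min t' T.s) σ)
  have h2 := h.relWidth_nonneg h.σ_le
  gcongr

/-- The one-sided Lipschitz constant 1/2 is twice the bound 1/4 on `relWidth`. It allows the net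
error and the error on the eigenvalues to be moved out of B. -/
theorem width_add_le (h : T.Precise n σ) (t : ℝ) {r : ℝ} (hr : 0 ≤ r) :
    width n T σ (t + r) ≤ width n T σ t + r / 2 := by
  rw [h.width_eq, h.width_eq]
  have h1 : max (t + r) σ ≤ max t σ + r :=
    max_le (by linarith [le_max_left t σ]) (by linarith [le_max_right t σ])
  have h2 := h.relWidth_anti (le_max_right (min t T.s) σ)
    (max_le_max (min_le_min (by linarith) le_rfl) le_rfl :
      max (min t T.s) σ ≤ max (min (t + r) T.s) σ)
  have h3 := h.relWidth_nonneg (le_max_right (min t T.s) σ)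
  have h4 := h.relWidth_le (le_max_right (min t T.s) σ)
  have h5 := h.σ_pos.trans_le (le_max_right (t + r) σ)
  calc 2 * max (t + r) σ * relWidth n T (max (min (t + r) T.s) σ)
      ≤ 2 * max (t + r) σ * relWidth n T (max (min t T.s) σ) := by gcongr
    _ ≤ 2 * (max t σ + r) * relWidth n T (max (min t T.s) σ) := by gcongr
    _ = 2 * max t σ * relWidth n T (max (min t T.s) σ) +
        2 * r * relWidth n T (max (min t T.s) σ) := by ring
    _ ≤ 2 * max t σ * relWidth n T (max (min t T.s) σ) + 2 * r * (1 / 4) := by gcongr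
    _ = _ := by ring

/-- Two points of the confidence region are close. -/
theorem abs_sub_le_width {d : ℕ} (h : T.Precise n σ) {x : Fin n → Vec d} {θ : Vec d} {p q : ℝ}
    (hp : p ∈ confRegion T x θ) (hq : q ∈ confRegion T x θ) (hps : p ≤ T.s) :
    |max p σ - max q σ| ≤ width n T σ p := by
  have hσ := h.σ_pos
  set t := max p σ with ht
  have ht0 : 0 < t := hσ.trans_le (le_max_right _ _)
  have hts : t ≤ T.s := max_le hps h.σ_le
  have hσt : σ ≤ t := le_max_right _ _
  obtain ⟨j, hj, hη⟩ := h.exists_eta_le hσ h.zeta_le hσt hts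
  obtain ⟨hq1, hq2⟩ := hq.2 j hj
  obtain ⟨hp1, hp2⟩ := hp.2 j hj
  have hz := h.scaled_zeta_le hσt
  have he0 := h.eta_pos j ht0.le
  have hB : eta n T j t / (1 - 4 * eta n T j t) ≤ relWidth n T t := by
    rw [relWidth_eq]
    exact div_one_sub_mono hη hz he0.le
  have hw : width n T σ p = 2 * t * relWidth n T t := by
    rw [h.width_eq, min_eq_left hps]
  have hBt : 2 * t * (eta n T j t / (1 - 4 * eta n T j t)) ≤ 2 * t * relWidth n T t := by gcongr
  have hupper := le_add_of_phi h.toAdmissible ht0 rfl (hη.trans hz) (le_max_left p σ) hq2 hp1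
  have hwn := h.width_nonneg p
  rw [hw] at hwn ⊢
  rw [abs_le]
  constructor
  · have : max q σ ≤ t + 2 * t * relWidth n T t := max_le (by linarith) (by linarith)
    linarith
  -- The constraint on `phiPlus` is available at p, not at max p σ; when p ≤ σ the truncation makes
  -- the lower bound trivial.
  · rcases le_total p σ with hpσ | hpσ
    · have : t = σ := max_eq_right hpσ
      have := le_max_right q σ
      linarith
    · have htp : t = p := max_eq_left hpσ
      have := (sub_le_of_phi h.toAdmissible ht0 rfl (hη.trans hz) (by rw [htp]; exact hp2) hq1).1
      have := le_max_left q σ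
      linarith

end Tuning.Precise

/-! ### Solvability of the convex program -/

/-- Although `phiPlus` jumps, it is lower semicontinuous on [0, ∞): `Informative` is an open
condition at positive energies, `phiPlus` is continuous there, and its fallback value 0 never
violates the constraint. -/
theorem isClosed_confRegion {d n : ℕ} {T : Tuning} (hT : T.Admissible n) (x : Fin n → Vec d)
    (θ : Vec d) : IsClosed (confRegion T x θ) := by
  have hset : confRegion T x θ = {q : ℝ | 0 ≤ q} ∩ ⋂ j, ⋂ _ : j < gridSize n T,
      ({q : ℝ | phiMinus n T j (Nhat x (gridL n T j) θ) ≤ q} ∩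
        {q : ℝ | 0 ≤ q ∧ phiPlus n T j q ≤ Nhat x (gridL n T j) θ} ) := by
    ext q
    simp only [confRegion, Set.mem_ofPred_eq, Set.mem_inter_iff, Set.mem_iInter]
    constructor
    · rintro ⟨h0, h⟩
      exact ⟨h0, fun j hj => ⟨(h j hj).1, h0, (h j hj).2⟩⟩
    · rintro ⟨h0, h⟩
      exact ⟨h0, fun j hj => ⟨(h j hj).1, (h j hj).2.2⟩⟩
  rw [hset]
  refine (isClosed_le continuous_const continuous_id).inter
    (isClosed_iInter fun j => isClosed_iInter fun _ =>
      (isClosed_le continuous_const continuous_id).inter ?_)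
  rw [← isOpen_compl_iff, isOpen_iff_mem_nhds]
  intro q hq
  have hq' : ¬ (0 ≤ q ∧ phiPlus n T j q ≤ Nhat x (gridL n T j) θ) := hq
  have hD := Nhat_nonneg x (hT.gridL_pos j) θ
  rcases lt_or_ge q 0 with hq0 | hq0
  · filter_upwards [Iio_mem_nhds hq0] with r hr hr'
    exact absurd hr'.1 (not_le.2 hr)
  have hgt : Nhat x (gridL n T j) θ < phiPlus n T j q := by
    by_contra hc
    exact hq' ⟨hq0, not_lt.1 hc⟩
  by_cases hI : Informative n T j q
  swap
  · rw [phiPlus, if_neg hI] at hgt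
    exact absurd hgt (not_lt.2 hD)
  have hqpos : 0 < q := by
    rcases hq0.eq_or_lt with h | h
    · rw [phiPlus, if_pos hI, ← h, zero_div] at hgt
      exact absurd hgt (not_lt.2 hD)
    · exact h
  have hqne := hqpos.ne'
  have hηc : ContinuousAt (eta n T j) q := by
    have : eta n T j = fun t => etaConst n T j + gridBeta n T j / (2 * n) / t :=
      funext fun t => eta_eq n T j t
    rw [this]
    fun_prop (disch := assumption)
  have hden : 0 < 1 - mu n T j - 2 * eta n T j q := by
    have := hT.xi_pos j
    unfold Informative at hI
    linarith
  have hden' := hden.ne'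
  have hη := hT.eta_pos j hqpos.le
  have hone : 1 + eta n T j q / (1 - mu n T j - 2 * eta n T j q) ≠ 0 := by positivity
  have hfc : ContinuousAt (fun t => t / (1 + eta n T j t / (1 - mu n T j - 2 * eta n T j t))) q := by
    fun_prop (disch := assumption)
  have hev1 : ∀ᶠ r in nhds q, Informative n T j r := by
    have hc : ContinuousAt (fun t => xi n T j + mu n T j + 2 * eta n T j t) q := by fun_prop
    exact hc.eventually (Iio_mem_nhds hI)
  rw [phiPlus, if_pos hI] at hgt
  filter_upwards [hev1, hfc.eventually (Ioi_mem_nhds hgt)] with r hr1 hr2 hr3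
  have h3 := hr3.2
  rw [phiPlus, if_pos hr1] at h3
  exact absurd h3 (not_le.2 hr2)

theorem frob_sq {d : ℕ} (M : Matrix (Fin d) (Fin d) ℝ) : frob M ^ 2 = ∑ i, ∑ j, M i j ^ 2 := by
  have : (Mᵀ * M).trace = ∑ i, ∑ j, M i j ^ 2 := by
    rw [Matrix.trace, Finset.sum_comm]
    simp [Matrix.mul_apply, sq]
  rw [frob, this]
  exact Real.sq_sqrt (Finset.sum_nonneg fun i _ => Finset.sum_nonneg fun j _ => sq_nonneg _)

theorem frob_nonneg {d : ℕ} (M : Matrix (Fin d) (Fin d) ℝ) : 0 ≤ frob M := Real.sqrt_nonneg _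

theorem abs_apply_le_frob {d : ℕ} (M : Matrix (Fin d) (Fin d) ℝ) (i j : Fin d) :
    |M i j| ≤ frob M := by
  refine abs_le_of_sq_le_sq ?_ (frob_nonneg M)
  rw [frob_sq]
  calc M i j ^ 2 ≤ ∑ j, M i j ^ 2 :=
        Finset.single_le_sum (f := fun j => M i j ^ 2) (fun _ _ => sq_nonneg _) (Finset.mem_univ j)
    _ ≤ _ := Finset.single_le_sum (f := fun i => ∑ j, M i j ^ 2)
        (fun _ _ => Finset.sum_nonneg fun _ _ => sq_nonneg _) (Finset.mem_univ i)

theorem continuous_frob {d : ℕ} : Continuous (frob : Matrix (Fin d) (Fin d) ℝ → ℝ) := by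
  unfold frob
  fun_prop

theorem continuous_quad {d : ℕ} (θ : Vec d) :
    Continuous fun M : Matrix (Fin d) (Fin d) ℝ => quad M θ := by
  unfold quad
  fun_prop

/-- Feasible matrices no larger than G form a compact set, on which the Frobenius norm attains its
minimum. -/
theorem exists_isSolution {d n : ℕ} {T : Tuning} (hT : T.Admissible n) (Θ : Finset (Vec d))
    (x : Fin n → Vec d) {G : Matrix (Fin d) (Fin d) ℝ} (hG : Feasible T Θ x G) :
    ∃ Q, IsSolution T Θ x Q := by
  set S : Set (Matrix (Fin d) (Fin d) ℝ) := {Q | Feasible T Θ x Q} ∩ {Q | frob Q ≤ frob G} with hS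
  have hclosed : IsClosed S := by
    have h1 : {Q : Matrix (Fin d) (Fin d) ℝ | Feasible T Θ x Q} =
        {Q | Qᵀ = Q} ∩ ⋂ θ ∈ Θ, (fun Q => quad Q θ) ⁻¹' confRegion T x θ := by
      ext Q
      simp [Feasible, Matrix.IsSymm]
    rw [hS, h1]
    refine ((isClosed_eq (by fun_prop) continuous_id).inter
      (isClosed_biInter fun θ _ => ?_)).inter (isClosed_le continuous_frob continuous_const)
    exact (isClosed_confRegion hT x θ).preimage (continuous_quad θ)
  have hcompact : IsCompact S := by
    have hbox : IsCompact (Set.univ.pi fun _ : Fin d => Set.univ.pi fun _ : Fin d =>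
        Set.Icc (-frob G) (frob G)) :=
      isCompact_univ_pi fun _ => isCompact_univ_pi fun _ => isCompact_Icc
    refine hbox.of_isClosed_subset hclosed fun Q hQ => ?_
    intro i _ j _
    exact abs_le.1 ((abs_apply_le_frob Q i j).trans hQ.2)
  obtain ⟨Q, hQ, hmin⟩ := hcompact.exists_isMinOn ⟨G, hG, le_refl (frob G)⟩
    continuous_frob.continuousOn
  refine ⟨Q, hQ.1, fun Q' hQ' => ?_⟩
  rcases le_total (frob Q') (frob G) with h | h
  · exact hmin ⟨hQ', h⟩
  · exact le_trans hQ.2 h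

/-! ### Symmetric matrices as operators -/

theorem quad_eq_inner {d : ℕ} (M : Matrix (Fin d) (Fin d) ℝ) (θ : Vec d) :
    quad M θ = inner ℝ θ (M.toEuclideanLin θ) := by
  simp [quad, PiLp.inner_apply, dotProduct, mul_comm]

theorem norm_sq_eq_sum_inner {d : ℕ} (e : OrthonormalBasis (Fin d) ℝ (Vec d)) (v : Vec d) :
    ‖v‖ ^ 2 = ∑ i, (inner ℝ (e i) v) ^ 2 := by
  rw [← e.sum_sq_norm_inner_right v]
  simp

theorem frob_sq_eq_sum_norm {d : ℕ} {M : Matrix (Fin d) (Fin d) ℝ} (hM : M.IsHermitian)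
    (e : OrthonormalBasis (Fin d) ℝ (Vec d)) :
    frob M ^ 2 = ∑ i, ‖M.toEuclideanLin (e i)‖ ^ 2 := by
  have hS := Matrix.isSymmetric_toEuclideanLin_iff.2 hM
  set b := EuclideanSpace.basisFun (Fin d) ℝ
  have h1 : frob M ^ 2 = ∑ j, ‖M.toEuclideanLin (b j)‖ ^ 2 := by
    rw [frob_sq, Finset.sum_comm]
    refine Finset.sum_congr rfl fun j _ => ?_
    rw [EuclideanSpace.real_norm_sq_eq]
    refine Finset.sum_congr rfl fun i _ => ?_
    simp [b]
  rw [h1]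
  simp_rw [norm_sq_eq_sum_inner b (M.toEuclideanLin (e _)), norm_sq_eq_sum_inner e]
  rw [Finset.sum_comm]
  refine Finset.sum_congr rfl fun i _ => Finset.sum_congr rfl fun j _ => ?_
  rw [← hS, real_inner_comm]

theorem norm_toEuclideanLin_le_frob {d : ℕ} (M : Matrix (Fin d) (Fin d) ℝ) (v : Vec d) :
    ‖M.toEuclideanLin v‖ ≤ frob M * ‖v‖ := by
  refine le_of_sq_le_sq ?_ (mul_nonneg (frob_nonneg M) (norm_nonneg v))
  rw [mul_pow, frob_sq, EuclideanSpace.real_norm_sq_eq, EuclideanSpace.real_norm_sq_eq v,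
    Finset.sum_mul]
  refine Finset.sum_le_sum fun i _ => ?_
  have := Finset.sum_mul_sq_le_sq_mul_sq Finset.univ (fun j => M i j) v.ofLp
  simpa [Matrix.mulVec, dotProduct] using this

theorem abs_quad_sub_le {d : ℕ} {M : Matrix (Fin d) (Fin d) ℝ} (hM : M.IsHermitian) {θ θ' : Vec d}
    (hθ : ‖θ‖ = 1) (hθ' : ‖θ'‖ = 1) :
    |quad M θ - quad M θ'| ≤ 2 * ‖θ - θ'‖ * frob M := by
  have hS := Matrix.isSymmetric_toEuclideanLin_iff.2 hM
  have h1 : quad M θ - quad M θ' = inner ℝ (θ + θ') (M.toEuclideanLin (θ - θ')) := by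
    rw [quad_eq_inner, quad_eq_inner, map_sub, inner_sub_right, inner_add_left, inner_add_left,
      ← hS θ' θ, real_inner_comm θ]
    ring
  rw [h1]
  have h2 := abs_real_inner_le_norm (θ + θ') (M.toEuclideanLin (θ - θ'))
  have h3 := norm_toEuclideanLin_le_frob M (θ - θ')
  have h4 : ‖θ + θ'‖ ≤ 2 := (norm_add_le _ _).trans (by rw [hθ, hθ']; norm_num)
  calc |inner ℝ (θ + θ') (M.toEuclideanLin (θ - θ'))|
      ≤ ‖θ + θ'‖ * ‖M.toEuclideanLin (θ - θ')‖ := h2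
    _ ≤ 2 * (frob M * ‖θ - θ'‖) := by gcongr
    _ = _ := by ring

/-- The orthonormal basis `e` diagonalizes `M`, with eigenvalues `a`. -/
def Diagonalizes {d : ℕ} (M : Matrix (Fin d) (Fin d) ℝ) (e : OrthonormalBasis (Fin d) ℝ (Vec d))
    (a : Fin d → ℝ) : Prop :=
  ∀ i, M.toEuclideanLin (e i) = a i • e i

theorem exists_diagonalizes {d : ℕ} {M : Matrix (Fin d) (Fin d) ℝ} (hM : M.IsHermitian) :
    ∃ e : OrthonormalBasis (Fin d) ℝ (Vec d),
      Diagonalizes M e fun i => hM.eigenvalues₀ (Fin.cast (Fintype.card_fin d).symm i) := by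
  set σ : Fin (Fintype.card (Fin d)) ≃ Fin d := Fintype.equivOfCardEq (Fintype.card_fin _)
  refine ⟨hM.eigenvectorBasis.reindex (σ.symm.trans (finCongr (Fintype.card_fin d))), fun i => ?_⟩
  have h := hM.mulVec_eigenvectorBasis (σ (Fin.cast (Fintype.card_fin d).symm i))
  have h2 : hM.eigenvalues (σ (Fin.cast (Fintype.card_fin d).symm i)) =
      hM.eigenvalues₀ (Fin.cast (Fintype.card_fin d).symm i) := by
    simp [Matrix.IsHermitian.eigenvalues, σ]
  rw [h2] at h
  ext k
  have hk := congrFun h k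
  simpa using hk

theorem eigenvalues₀_cast_antitone {d : ℕ} {M : Matrix (Fin d) (Fin d) ℝ} (hM : M.IsHermitian) :
    Antitone fun i => hM.eigenvalues₀ (Fin.cast (Fintype.card_fin d).symm i) :=
  fun _ _ h => hM.eigenvalues₀_antitone (by simpa using h)

theorem Diagonalizes.inner_apply {d : ℕ} {M : Matrix (Fin d) (Fin d) ℝ}
    {e : OrthonormalBasis (Fin d) ℝ (Vec d)} {a : Fin d → ℝ} (h : Diagonalizes M e a)
    (hM : M.IsHermitian) (i : Fin d) (v : Vec d) :
    inner ℝ (e i) (M.toEuclideanLin v) = a i * inner ℝ (e i) v := by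
  have hS := Matrix.isSymmetric_toEuclideanLin_iff.2 hM
  rw [← hS, h i, real_inner_smul_left]

theorem Diagonalizes.quad_eq {d : ℕ} {M : Matrix (Fin d) (Fin d) ℝ}
    {e : OrthonormalBasis (Fin d) ℝ (Vec d)} {a : Fin d → ℝ} (h : Diagonalizes M e a)
    (hM : M.IsHermitian) (θ : Vec d) : quad M θ = ∑ i, a i * (inner ℝ (e i) θ) ^ 2 := by
  rw [quad_eq_inner, ← e.sum_inner_mul_inner]
  refine Finset.sum_congr rfl fun i _ => ?_
  rw [h.inner_apply hM, real_inner_comm]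
  ring

theorem Diagonalizes.quad_basis {d : ℕ} {M : Matrix (Fin d) (Fin d) ℝ}
    {e : OrthonormalBasis (Fin d) ℝ (Vec d)} {a : Fin d → ℝ} (h : Diagonalizes M e a) (i : Fin d) :
    quad M (e i) = a i := by
  rw [quad_eq_inner, h i, real_inner_smul_right, real_inner_self_eq_norm_sq, e.norm_eq_one]
  ring

theorem isHermitian_cfc {d : ℕ} (f : ℝ → ℝ) (M : Matrix (Fin d) (Fin d) ℝ) :
    (cfc f M).IsHermitian :=
  cfc_predicate f M

theorem cfc_mulVec_eigenvectorBasis {d : ℕ} {M : Matrix (Fin d) (Fin d) ℝ} (hM : M.IsHermitian)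
    (f : ℝ → ℝ) (i : Fin d) : (cfc f M).toEuclideanLin (hM.eigenvectorBasis i) =
      f (hM.eigenvalues i) • hM.eigenvectorBasis i := by
  have h1 : cfc f M * (hM.eigenvectorUnitary : Matrix (Fin d) (Fin d) ℝ) =
      hM.eigenvectorUnitary * Matrix.diagonal (f ∘ hM.eigenvalues) := by
    rw [hM.cfc_eq, Matrix.IsHermitian.cfc, Unitary.conjStarAlgAut_apply, mul_assoc,
      Unitary.coe_star_mul_self, mul_one]
    rfl
  ext k
  have h2 := congrFun (congrFun h1 k) i
  rw [Matrix.mul_diagonal, Matrix.mul_apply] at h2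
  simp only [Matrix.IsHermitian.eigenvectorUnitary_apply, Function.comp_apply] at h2
  simp only [Matrix.toLpLin_apply, Matrix.mulVec, dotProduct, PiLp.smul_apply, smul_eq_mul]
  rw [h2, mul_comm]

/-- The functional calculus does not depend on the eigenbasis: an eigenvector for a i has nonzero
components only along basis vectors with the same eigenvalue. No continuity of f is needed. -/
theorem Diagonalizes.cfc {d : ℕ} {M : Matrix (Fin d) (Fin d) ℝ}
    {e : OrthonormalBasis (Fin d) ℝ (Vec d)} {a : Fin d → ℝ} (h : Diagonalizes M e a)
    (hM : M.IsHermitian) (f : ℝ → ℝ) : Diagonalizes (cfc f M) e fun i => f (a i) := by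
  intro i
  set u := hM.eigenvectorBasis
  have hu : Diagonalizes M u hM.eigenvalues := fun k => by
    ext j
    have := congrFun (hM.mulVec_eigenvectorBasis k) j
    simpa using this
  have hu' : Diagonalizes (_root_.cfc f M) u fun k => f (hM.eigenvalues k) :=
    cfc_mulVec_eigenvectorBasis hM f
  refine InnerProductSpace.ext_inner_left_basis u.toBasis fun k => ?_
  rw [OrthonormalBasis.coe_toBasis, hu'.inner_apply (isHermitian_cfc f M), real_inner_smul_right]
  have h1 := hu.inner_apply hM k (e i)
  rw [h i, real_inner_smul_right] at h1
  by_cases h0 : inner ℝ (u k) (e i) = 0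
  · rw [h0, mul_zero, mul_zero]
  · simp only [mul_right_cancel₀ h0 h1]

/-! ### Comparison of eigenvalues and Lipschitz functional calculus -/

/-- A unit vector orthogonal to the first `i` vectors of a basis and to the last `d - 1 - i` vectors
of another one. -/
theorem exists_unit_vector_orthogonal {d : ℕ} (p e : OrthonormalBasis (Fin d) ℝ (Vec d))
    (i : Fin d) : ∃ θ : Vec d, ‖θ‖ = 1 ∧ (∀ k < i, inner ℝ (p k) θ = 0) ∧
      ∀ k, i < k → inner ℝ (e k) θ = 0 := by
  -- Only the index i is left free, so there are d - 1 linear constraints in dimension d.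
  set F : Vec d →ₗ[ℝ] ({k : Fin d // k ≠ i} → ℝ) := LinearMap.pi fun k =>
    (innerSL ℝ (if k.1 < i then p k.1 else e k.1)).toLinearMap with hF
  have hlt : Module.finrank ℝ ({k : Fin d // k ≠ i} → ℝ) < Module.finrank ℝ (Vec d) := by
    rw [Module.finrank_fintype_fun_eq_card, finrank_euclideanSpace, Fintype.card_subtype_compl]
    have : 0 < Fintype.card (Fin d) := Fintype.card_pos_iff.2 ⟨i⟩
    simp
    simpa using this
  obtain ⟨v, hv, hv0⟩ := Submodule.exists_mem_ne_zero_of_ne_bot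
    (LinearMap.ker_ne_bot_of_finrank_lt (f := F) hlt)
  have hFv : ∀ k : {k : Fin d // k ≠ i}, inner ℝ (if k.1 < i then p k.1 else e k.1) v = 0 := by
    intro k
    exact congrFun (LinearMap.mem_ker.1 hv) k
  have hn : ‖v‖ ≠ 0 := norm_ne_zero_iff.2 hv0
  refine ⟨‖v‖⁻¹ • v, ?_, fun k hk => ?_, fun k hk => ?_⟩
  · rw [norm_smul, norm_inv, norm_norm, inv_mul_cancel₀ hn]
  · have := hFv ⟨k, hk.ne⟩
    rw [if_pos hk] at this
    rw [real_inner_smul_right, this, mul_zero]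
  · have := hFv ⟨k, hk.ne'⟩
    rw [if_neg (not_lt.2 hk.le)] at this
    rw [real_inner_smul_right, this, mul_zero]

theorem Diagonalizes.quad_le {d : ℕ} {M : Matrix (Fin d) (Fin d) ℝ}
    {e : OrthonormalBasis (Fin d) ℝ (Vec d)} {a : Fin d → ℝ} (h : Diagonalizes M e a)
    (hM : M.IsHermitian) {θ : Vec d} (hθ : ‖θ‖ = 1) {c : ℝ}
    (hc : ∀ k, inner ℝ (e k) θ ≠ 0 → a k ≤ c) : quad M θ ≤ c := by
  have h1 := norm_sq_eq_sum_inner e θ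
  rw [hθ, one_pow] at h1
  rw [h.quad_eq hM, ← mul_one c, h1, Finset.mul_sum]
  refine Finset.sum_le_sum fun k _ => ?_
  by_cases h0 : inner ℝ (e k) θ = 0
  · simp [h0]
  · exact mul_le_mul_of_nonneg_right (hc k h0) (sq_nonneg _)

theorem Diagonalizes.le_quad {d : ℕ} {M : Matrix (Fin d) (Fin d) ℝ}
    {e : OrthonormalBasis (Fin d) ℝ (Vec d)} {a : Fin d → ℝ} (h : Diagonalizes M e a)
    (hM : M.IsHermitian) {θ : Vec d} (hθ : ‖θ‖ = 1) {c : ℝ}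
    (hc : ∀ k, inner ℝ (e k) θ ≠ 0 → c ≤ a k) : c ≤ quad M θ := by
  have h1 := norm_sq_eq_sum_inner e θ
  rw [hθ, one_pow] at h1
  rw [h.quad_eq hM, ← mul_one c, h1, Finset.mul_sum]
  refine Finset.sum_le_sum fun k _ => ?_
  by_cases h0 : inner ℝ (e k) θ = 0
  · simp [h0]
  · exact mul_le_mul_of_nonneg_right (hc k h0) (sq_nonneg _)

theorem quad_sub {d : ℕ} (A B : Matrix (Fin d) (Fin d) ℝ) (θ : Vec d) :
    quad (A - B) θ = quad A θ - quad B θ := by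
  simp [quad, Matrix.sub_mulVec, dotProduct_sub]

theorem norm_toEuclideanLin_le_of_quad {d : ℕ} {M : Matrix (Fin d) (Fin d) ℝ}
    (hM : M.IsHermitian) {X : ℝ} (hX : ∀ θ : Vec d, ‖θ‖ = 1 → |quad M θ| ≤ X) {v : Vec d}
    (hv : ‖v‖ = 1) : ‖M.toEuclideanLin v‖ ^ 2 ≤ X ^ 2 := by
  obtain ⟨e, he⟩ := exists_diagonalizes hM
  have hX2 : X ^ 2 = ∑ i, X ^ 2 * (inner ℝ (e i) v) ^ 2 := by
    rw [← Finset.mul_sum, ← norm_sq_eq_sum_inner, hv, one_pow, mul_one]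
  rw [norm_sq_eq_sum_inner e, hX2]
  refine Finset.sum_le_sum fun i _ => ?_
  rw [he.inner_apply hM, mul_pow]
  have := hX (e i) (e.norm_eq_one i)
  rw [he.quad_basis] at this
  have h2 := pow_le_pow_left₀ (abs_nonneg _) this 2
  rw [sq_abs] at h2
  gcongr

/-- Frobenius distance between functions of two matrices with close spectra. -/
theorem frob_cfc_sub_cfc_sq_le {d : ℕ} {A B : Matrix (Fin d) (Fin d) ℝ} (hA : A.IsHermitian)
    (hB : B.IsHermitian) {p e : OrthonormalBasis (Fin d) ℝ (Vec d)} {a b : Fin d → ℝ}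
    (ha : Diagonalizes A p a) (hb : Diagonalizes B e b) (hb0 : ∀ i, 0 ≤ b i) (hba : ∀ i, b i ≤ a i)
    {X : ℝ} (hX : ∀ θ : Vec d, ‖θ‖ = 1 → |quad (A - B) θ| ≤ X) {f : ℝ → ℝ} {L : ℝ} (hL : 0 < L)
    (hf : ∀ s t : ℝ, |f s - f t| ≤ 1 / L * |s - t|) {r : ℕ} (hr : r ≤ d) :
    frob (cfc f A - cfc f B) ^ 2 ≤
      L⁻¹ ^ 2 * (2 * r * X ^ 2 + 2 * ∑ i : Fin d with r ≤ i.val, a i ^ 2) := by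
  have hAB : (A - B).IsHermitian := hA.sub hB
  have hfAB : (cfc f A - cfc f B).IsHermitian := (isHermitian_cfc f A).sub (isHermitian_cfc f B)
  -- These weights are doubly stochastic, and ‖f(A) - f(B)‖_F² is the weighted sum of (f(a k) - f(b
  -- i))², so the Lipschitz bound applies term by term.
  set w : Fin d → Fin d → ℝ := fun k i => (inner ℝ (p k) (e i)) ^ 2 with hw
  have hw0 : ∀ k i, 0 ≤ w k i := fun k i => sq_nonneg _
  have hw1 : ∀ i, ∑ k, w k i = 1 := fun i => by
    rw [hw, ← norm_sq_eq_sum_inner p, e.norm_eq_one, one_pow]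
  have hw2 : ∀ k, ∑ i, w k i = 1 := fun k => by
    have := norm_sq_eq_sum_inner e (p k)
    rw [p.norm_eq_one, one_pow] at this
    rw [this]
    exact Finset.sum_congr rfl fun i _ => by rw [hw, real_inner_comm]
  have hnorm : ∀ (A B : Matrix (Fin d) (Fin d) ℝ), A.IsHermitian → ∀ (a b : Fin d → ℝ),
      Diagonalizes A p a → Diagonalizes B e b → ∀ i,
      ‖(A - B).toEuclideanLin (e i)‖ ^ 2 = ∑ k, (a k - b i) ^ 2 * w k i := by
    intro A B hA a b ha hb i
    rw [norm_sq_eq_sum_inner p]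
    refine Finset.sum_congr rfl fun k _ => ?_
    rw [map_sub, LinearMap.sub_apply, inner_sub_right, ha.inner_apply hA, hb i,
      real_inner_smul_right, hw]
    ring
  have hcol : ∀ i, ∑ k, (a k - b i) ^ 2 * w k i ≤ X ^ 2 := fun i => by
    rw [← hnorm A B hA a b ha hb i]
    exact norm_toEuclideanLin_le_of_quad hAB hX (e.norm_eq_one i)
  have hrow : ∀ k, ∑ i, (a k - b i) ^ 2 * w k i ≤ X ^ 2 := fun k => by
    have h1 : ∑ i, (a k - b i) ^ 2 * w k i = ‖(A - B).toEuclideanLin (p k)‖ ^ 2 := by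
      rw [norm_sq_eq_sum_inner e]
      refine Finset.sum_congr rfl fun i _ => ?_
      rw [map_sub, LinearMap.sub_apply, inner_sub_right, hb.inner_apply hB, ha k,
        real_inner_smul_right, real_inner_comm (p k) (e i)]
      simp only [hw]
      ring
    rw [h1]
    exact norm_toEuclideanLin_le_of_quad hAB hX (p.norm_eq_one k)
  rw [frob_sq_eq_sum_norm hfAB e]
  simp_rw [hnorm _ _ (isHermitian_cfc f A) _ _ (ha.cfc hA f) (hb.cfc hB f)]
  have hlip : ∀ k i, (f (a k) - f (b i)) ^ 2 * w k i ≤ L⁻¹ ^ 2 * ((a k - b i) ^ 2 * w k i) := by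
    intro k i
    have h1 := pow_le_pow_left₀ (abs_nonneg _) (hf (a k) (b i)) 2
    rw [sq_abs, mul_pow, sq_abs, one_div] at h1
    rw [← mul_assoc]
    exact mul_le_mul_of_nonneg_right h1 (hw0 k i)
  -- Columns i < r and rows k < r each contribute at most r X². In the remaining block 0 ≤ b i ≤ a i
  -- gives (a k - b i)² ≤ a k² + a i².
  have hsplit : ∀ k i, (a k - b i) ^ 2 * w k i ≤
      (if i.val < r then (a k - b i) ^ 2 * w k i else 0) +
      (if k.val < r then (a k - b i) ^ 2 * w k i else 0) +
      ((if r ≤ k.val then a k ^ 2 else 0) * w k i + (if r ≤ i.val then a i ^ 2 else 0) * w k i) := by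
    intro k i
    have h0 : 0 ≤ (a k - b i) ^ 2 * w k i := mul_nonneg (sq_nonneg _) (hw0 k i)
    have h1 : ∀ m : Fin d, 0 ≤ (if r ≤ m.val then a m ^ 2 else 0) * w k i := fun m => by
      have := hw0 k i
      split_ifs <;> positivity
    by_cases hi : i.val < r
    · rw [if_pos hi]
      have h2 := h1 k
      have h3 := h1 i
      have h4 : 0 ≤ if k.val < r then (a k - b i) ^ 2 * w k i else 0 := by
        split_ifs
        · exact h0
        · exact le_rfl
      linarith
    by_cases hk : k.val < r
    · rw [if_neg hi, if_pos hk]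
      have h2 := h1 k
      have h3 := h1 i
      linarith
    · rw [if_neg hi, if_neg hk, if_pos (not_lt.1 hk), if_pos (not_lt.1 hi)]
      have h2 : (a k - b i) ^ 2 ≤ a k ^ 2 + a i ^ 2 := by
        have ha0 : 0 ≤ a k := (hb0 k).trans (hba k)
        have := mul_nonneg ha0 (hb0 i)
        have := pow_le_pow_left₀ (hb0 i) (hba i) 2
        nlinarith
      have := mul_le_mul_of_nonneg_right h2 (hw0 k i)
      linarith
  have hcard : (∑ m : Fin d, if m.val < r then X ^ 2 else 0) = r * X ^ 2 := by
    rw [← Finset.sum_filter, Finset.sum_const, nsmul_eq_mul, Fin.card_filter_val_lt, min_eq_right hr]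
  have s1 : ∑ i, ∑ k, (if i.val < r then (a k - b i) ^ 2 * w k i else 0) ≤ r * X ^ 2 := by
    rw [← hcard]
    refine Finset.sum_le_sum fun i _ => ?_
    split_ifs
    · exact hcol i
    · simp
  have s2 : ∑ i, ∑ k, (if k.val < r then (a k - b i) ^ 2 * w k i else 0) ≤ r * X ^ 2 := by
    rw [← hcard, Finset.sum_comm]
    refine Finset.sum_le_sum fun k _ => ?_
    split_ifs
    · exact hrow k
    · simp
  have s3 : ∑ i, ∑ k, (if r ≤ k.val then a k ^ 2 else 0) * w k i =
      ∑ i : Fin d with r ≤ i.val, a i ^ 2 := by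
    rw [Finset.sum_comm, Finset.sum_filter]
    simp_rw [← Finset.mul_sum, hw2, mul_one]
  have s4 : ∑ i, ∑ k, (if r ≤ i.val then a i ^ 2 else 0) * w k i =
      ∑ i : Fin d with r ≤ i.val, a i ^ 2 := by
    rw [Finset.sum_filter]
    simp_rw [← Finset.mul_sum, hw1, mul_one]
  calc ∑ i, ∑ k, (f (a k) - f (b i)) ^ 2 * w k i
      ≤ ∑ i, ∑ k, L⁻¹ ^ 2 * ((a k - b i) ^ 2 * w k i) :=
        Finset.sum_le_sum fun i _ => Finset.sum_le_sum fun k _ => hlip k i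
    _ = L⁻¹ ^ 2 * ∑ i, ∑ k, (a k - b i) ^ 2 * w k i := by simp_rw [Finset.mul_sum]
    _ ≤ L⁻¹ ^ 2 * (2 * r * X ^ 2 + 2 * ∑ i : Fin d with r ≤ i.val, a i ^ 2) := by
        refine mul_le_mul_of_nonneg_left ?_ (by positivity)
        have h1 := Finset.sum_le_sum fun (i : Fin d) (_ : i ∈ Finset.univ) =>
          Finset.sum_le_sum fun (k : Fin d) (_ : k ∈ Finset.univ) => hsplit k i
        simp only [Finset.sum_add_distrib] at h1
        rw [s3, s4] at h1
        linarith

/-! ### The Gram matrix -/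

theorem quad_gram {d : ℕ} {P : Measure (Vec d)} [IsProbabilityMeasure P]
    (hP : Integrable (fun x => ‖x‖ ^ 4) P) (θ : Vec d) :
    quad (gram P) θ = ∫ x, (inner ℝ θ x) ^ 2 ∂P := by
  have hi : ∀ i j : Fin d, Integrable (fun x : Vec d => x i * x j) P := by
    intro i j
    refine integrable_of_le_quartic hP (by fun_prop) 1 fun x => ?_
    have h1 := PiLp.norm_apply_le x i
    have h2 := PiLp.norm_apply_le x j
    rw [Real.norm_eq_abs] at h1 h2
    rw [abs_mul]
    calc |x i| * |x j| ≤ ‖x‖ * ‖x‖ := by gcongr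
      _ ≤ 1 * (1 + ‖x‖ ^ 4) := by nlinarith [sq_nonneg (‖x‖ ^ 2 - 1), sq_nonneg ‖x‖]
  have h1 : ∀ x : Vec d, (inner ℝ θ x) ^ 2 = ∑ i, ∑ j, (θ i * θ j) * (x i * x j) := by
    intro x
    simp only [PiLp.inner_apply, sq, Finset.sum_mul_sum, RCLike.inner_apply, conj_trivial]
    refine Finset.sum_congr rfl fun i _ => Finset.sum_congr rfl fun j _ => ?_
    ring
  simp_rw [h1]
  rw [integral_finsetSum _ fun i _ => integrable_finsetSum _ fun j _ => (hi i j).const_mul _]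
  simp only [quad, dotProduct, Matrix.mulVec, gram, Matrix.of_apply, Finset.mul_sum]
  refine Finset.sum_congr rfl fun i _ => ?_
  rw [integral_finsetSum _ fun j _ => (hi i j).const_mul _]
  refine Finset.sum_congr rfl fun j _ => ?_
  rw [integral_const_mul]
  ring

theorem quad_smul {d : ℕ} (M : Matrix (Fin d) (Fin d) ℝ) (α : ℝ) (θ : Vec d) :
    quad M (α • θ) = α ^ 2 * quad M θ := by
  rw [quad_eq_inner, quad_eq_inner, map_smul, real_inner_smul_left, real_inner_smul_right]
  ring

theorem quad_gram_nonneg {d : ℕ} {P : Measure (Vec d)} [IsProbabilityMeasure P]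
    (hP : Integrable (fun x => ‖x‖ ^ 4) P) (θ : Vec d) : 0 ≤ quad (gram P) θ := by
  rw [quad_gram hP]
  exact integral_nonneg fun x => sq_nonneg _

theorem quad_gram_le {d : ℕ} {P : Measure (Vec d)} [IsProbabilityMeasure P]
    (hP : Integrable (fun x => ‖x‖ ^ 4) P) {θ : Vec d} (hθ : ‖θ‖ = 1) :
    quad (gram P) θ ≤ s4sq P := by
  rw [quad_gram hP]
  have h2 := integrable_norm_sq hP
  set m := ∫ x, ‖x‖ ^ 2 ∂P with hm
  have h1 : ∫ x, (inner ℝ θ x) ^ 2 ∂P ≤ m := by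
    refine integral_mono (integrable_inner_sq hP θ) h2 fun x => ?_
    have := abs_real_inner_le_norm θ x
    rw [hθ, one_mul] at this
    have := pow_le_pow_left₀ (abs_nonneg _) this 2
    rwa [sq_abs] at this
  refine h1.trans (Real.le_sqrt_of_sq_le ?_)
  have h3 : ∀ x : Vec d, 2 * m * ‖x‖ ^ 2 - m ^ 2 ≤ ‖x‖ ^ 4 := fun x => by
    nlinarith [sq_nonneg (‖x‖ ^ 2 - m)]
  have h4 := integral_mono ((h2.const_mul (2 * m)).sub (integrable_const _)) hP h3
  rw [integral_sub' (h2.const_mul (2 * m)) (integrable_const _), integral_const_mul, integral_const,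
    probReal_univ, one_smul, ← hm] at h4
  linarith

/-! ### Accuracy of the estimators -/

theorem mem_confRegion_of_critBound {d n : ℕ} {T : Tuning} (hT : T.Admissible n)
    {G : Matrix (Fin d) (Fin d) ℝ} (hG0 : ∀ θ, 0 ≤ quad G θ) {x : Fin n → Vec d}
    (hx : ∀ j < gridSize n T, CritBound T j (quad G) x) {θ : Vec d} (hθ : ‖θ‖ = 1) :
    quad G θ ∈ confRegion T x θ :=
  ⟨hG0 θ, fun j hj => ⟨phiMinus_Nhat_le (hx j hj) hT (quad_smul G) hG0 hθ,
    phiPlus_le_Nhat (hx j hj) hT (quad_smul G) hG0 hθ⟩⟩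

theorem isSolution_Qhat {d n : ℕ} {T : Tuning} {Θ : Finset (Vec d)} {x : Fin n → Vec d}
    (h : ∃ Q, IsSolution T Θ x Q) : IsSolution T Θ x (Qhat T Θ x) := by
  rw [Qhat, dif_pos h]
  exact h.choose_spec

/-- Uniform accuracy of the positive part of the solution of the convex program. -/
theorem abs_quad_sub_quad_Ghat_le {d n : ℕ} {T : Tuning} {σ δ : ℝ} (hT : T.Precise n σ)
    {Θ : Finset (Vec d)} (hΘ : IsSphereNet δ Θ) {G : Matrix (Fin d) (Fin d) ℝ}
    (hG : G.IsHermitian) (hG0 : ∀ θ, 0 ≤ quad G θ) (hGs : ∀ θ, ‖θ‖ = 1 → quad G θ ≤ T.s)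
    {x : Fin n → Vec d} (hx : ∀ j < gridSize n T, CritBound T j (quad G) x) {θ : Vec d}
    (hθ : ‖θ‖ = 1) :
    |quad G θ - quad (Ghat T Θ x) θ| ≤ Bfun n T σ δ (frob G) (quad G θ) := by
  have hregion : ∀ θ, ‖θ‖ = 1 → quad G θ ∈ confRegion T x θ := fun θ hθ =>
    mem_confRegion_of_critBound hT.toAdmissible hG0 hx hθ
  have hfeas : Feasible T Θ x G :=
    ⟨by simpa [Matrix.IsSymm, Matrix.IsHermitian] using hG, fun θ hθ => hregion θ (hΘ.1 θ hθ)⟩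
  have hsol := isSolution_Qhat (exists_isSolution hT.toAdmissible Θ x hfeas)
  unfold Ghat
  set Q := Qhat T Θ x
  have hQ : Q.IsHermitian := by
    simpa [Matrix.IsSymm, Matrix.IsHermitian] using hsol.1.1
  have hQG : frob Q ≤ frob G := hsol.2 G hfeas
  set F := frob G
  have hclose : ∀ (M : Matrix (Fin d) (Fin d) ℝ), M.IsHermitian → frob M ≤ F →
      ∀ θ θ' : Vec d, ‖θ‖ = 1 → ‖θ'‖ = 1 → ‖θ - θ'‖ ≤ δ → |quad M θ - quad M θ'| ≤ 2 * δ * F := by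
    intro M hM hMF θ θ' hθ hθ' hd
    refine (abs_quad_sub_le hM hθ hθ').trans ?_
    have := frob_nonneg M
    have := (norm_nonneg _).trans hd
    gcongr
  have hδ : 0 ≤ δ * F := by
    obtain ⟨θ', _, h⟩ := hΘ.2 θ hθ
    exact mul_nonneg ((norm_nonneg _).trans h) (frob_nonneg G)
  have hQlow : ∀ θ, ‖θ‖ = 1 → -(2 * δ * F) ≤ quad Q θ := by
    intro θ hθ
    obtain ⟨θ', hθ', h⟩ := hΘ.2 θ hθ
    have h1 := (hsol.1.2 θ' hθ').1
    have h2 := (abs_le.1 (hclose Q hQ hQG θ θ' hθ (hΘ.1 θ' hθ') h)).1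
    linarith
  obtain ⟨θ', hθ', hd⟩ := hΘ.2 θ hθ
  have hθ'1 := hΘ.1 θ' hθ'
  have h1 := hT.abs_sub_le_width (hregion θ' hθ'1) (hsol.1.2 θ' hθ') (hGs θ' hθ'1)
  have h2 := hclose G hG le_rfl θ θ' hθ hθ'1 hd
  -- The budget 7δ‖G‖_F: 2 for moving G to the net, 2 for moving Q, 2 for the positive part, 1 for
  -- the change of the width. The extra σ comes from undoing the truncation max(·, σ).
  have h3 := hclose Q hQ hQG θ θ' hθ hθ'1 hd
  have h4 : width n T σ (quad G θ') ≤ width n T σ (quad G θ) + δ * F := by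
    have h5 := hT.width_add_le (quad G θ) (r := 2 * δ * F) (by linarith)
    have h6 := hT.width_mono (show quad G θ' ≤ quad G θ + 2 * δ * F by linarith [(abs_le.1 h2).1])
    linarith
  have hmax : ∀ u v : ℝ, |max u σ - max v σ| ≤ |u - v| := fun u v => abs_max_sub_max_le_abs u v σ
  obtain ⟨e, he⟩ := exists_diagonalizes hQ
  set a : Fin d → ℝ := fun i => hQ.eigenvalues₀ (Fin.cast (Fintype.card_fin d).symm i)
  have hpos := he.cfc hQ (fun t : ℝ => max t 0)
  set Q' := cfc (fun t : ℝ => max t 0) Q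
  have hQ' : Q'.IsHermitian := isHermitian_cfc _ _
  have hQ'0 : 0 ≤ quad Q' θ := hpos.le_quad hQ' hθ fun k _ => le_max_right _ _
  have hQQ' : |quad Q θ - quad Q' θ| ≤ 2 * δ * F := by
    have h5 : quad Q' θ - quad Q θ = ∑ i, (max (a i) 0 - a i) * (inner ℝ (e i) θ) ^ 2 := by
      rw [hpos.quad_eq hQ', he.quad_eq hQ, ← Finset.sum_sub_distrib]
      exact Finset.sum_congr rfl fun i _ => (sub_mul _ _ _).symm
    have h6 : 0 ≤ quad Q' θ - quad Q θ := by
      rw [h5]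
      exact Finset.sum_nonneg fun i _ =>
        mul_nonneg (sub_nonneg.2 (le_max_left _ _)) (sq_nonneg _)
    have h7 : quad Q' θ - quad Q θ ≤ 2 * δ * F := by
      have h8 := norm_sq_eq_sum_inner e θ
      rw [hθ, one_pow] at h8
      rw [h5]
      calc ∑ i, (max (a i) 0 - a i) * (inner ℝ (e i) θ) ^ 2
          ≤ ∑ i, 2 * δ * F * (inner ℝ (e i) θ) ^ 2 := by
            refine Finset.sum_le_sum fun i _ => mul_le_mul_of_nonneg_right ?_ (sq_nonneg _)
            have h9 := hQlow (e i) (e.norm_eq_one i)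
            rw [he.quad_basis] at h9
            rw [sub_le_iff_le_add]
            exact max_le (by linarith) (by linarith)
        _ = 2 * δ * F := by rw [← Finset.mul_sum, ← h8, mul_one]
    rw [abs_sub_comm, abs_of_nonneg h6]
    exact h7
  have h10 := (hmax _ _).trans h2
  have h11 := (hmax _ _).trans h3
  have h12 := (hmax _ _).trans hQQ'
  rw [Bfun_eq]
  have hN := hG0 θ
  have hm1 := le_max_left (quad G θ) σ
  have hm2 := le_max_left (quad Q' θ) σ
  have hσ := hT.σ_pos
  have hm3 : max (quad G θ) σ ≤ quad G θ + σ := max_le (by linarith) (by linarith)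
  have hm4 : max (quad Q' θ) σ ≤ quad Q' θ + σ := max_le (by linarith) (by linarith)
  rw [abs_le] at h1 h10 h11 h12 ⊢
  constructor <;> linarith [h1.1, h1.2, h10.1, h10.2, h11.1, h11.2, h12.1, h12.2]

/-- The deterministic part of the spectral bound: a uniform control of the quadratic form yields a
control of functions of the shrunk estimator. -/
theorem frob_cfc_sub_cfc_shrink_le {d : ℕ} [NeZero d] {G Q : Matrix (Fin d) (Fin d) ℝ}
    (hG : G.IsHermitian) (hQ : Q.IsHermitian) (hG0 : ∀ θ, 0 ≤ quad G θ) {B : ℝ → ℝ}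
    (hB0 : ∀ t, 0 ≤ B t) (hBm : Monotone B) (hBl : ∀ t r, 0 ≤ r → B (t + r) ≤ B t + r / 2)
    (hGQ : ∀ θ, ‖θ‖ = 1 → |quad G θ - quad (cfc (fun t : ℝ => max t 0) Q) θ| ≤ B (quad G θ))
    {f : ℝ → ℝ} {L : ℝ} (hL : 0 < L) (hf : ∀ s t : ℝ, |f s - f t| ≤ 1 / L * |s - t|) {r : ℕ}
    (hr : r ≤ d) :
    frob (cfc f G - cfc f (cfc (fun t : ℝ => max (t - B t) 0) (cfc (fun t : ℝ => max t 0) Q))) ≤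
      L⁻¹ * Real.sqrt (13 * r *
        B (hG.eigenvalues₀ (Fin.cast (Fintype.card_fin d).symm 0)) ^ 2 +
        2 * ∑ i : Fin d with r ≤ i.val,
          hG.eigenvalues₀ (Fin.cast (Fintype.card_fin d).symm i) ^ 2) := by
  obtain ⟨p, hp⟩ := exists_diagonalizes hG
  have hanti := eigenvalues₀_cast_antitone hG
  set a : Fin d → ℝ := fun i => hG.eigenvalues₀ (Fin.cast (Fintype.card_fin d).symm i) with ha
  obtain ⟨e, he⟩ := exists_diagonalizes hQ
  have hqanti := eigenvalues₀_cast_antitone hQ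
  set q : Fin d → ℝ := fun i => hQ.eigenvalues₀ (Fin.cast (Fintype.card_fin d).symm i)
  have he1 := he.cfc hQ (fun t : ℝ => max t 0)
  set H := cfc (fun t : ℝ => max t 0) Q with hH
  have hHh : H.IsHermitian := isHermitian_cfc _ _
  set b : Fin d → ℝ := fun i => max (q i) 0 with hb
  have hbanti : Antitone b := fun i j hij => max_le_max (hqanti hij) le_rfl
  have he2 := he1.cfc hHh (fun t : ℝ => max (t - B t) 0)
  set S := cfc (fun t : ℝ => max (t - B t) 0) H with hS
  have hSh : S.IsHermitian := isHermitian_cfc _ _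
  have ha0 : ∀ i, 0 ≤ a i := fun i => by
    have := hG0 (p i)
    rwa [hp.quad_basis] at this
  -- Courant-Fischer: the test vector sees only eigenvalues of G up to a i and only eigenvalues of
  -- the estimator from b i upwards.
  have hba : ∀ i, b i ≤ a i + B (a i) := by
    intro i
    obtain ⟨θ, hθ, h1, h2⟩ := exists_unit_vector_orthogonal p e i
    have h3 : quad G θ ≤ a i := hp.quad_le hG hθ fun k hk => hanti (by
      by_contra hc
      exact hk (h1 k (not_le.1 hc)))
    have h4 : b i ≤ quad H θ := he1.le_quad hHh hθ fun k hk => hbanti (by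
      by_contra hc
      exact hk (h2 k (not_le.1 hc)))
    have h5 := (abs_le.1 (hGQ θ hθ)).1
    have h6 := hBm h3
    linarith
  -- The purpose of the shrinkage: if b i exceeds a i, then B (b i) ≥ B (a i) absorbs the excess.
  -- This is the domination that the tail estimate needs.
  have hca : ∀ i, max (b i - B (b i)) 0 ≤ a i := by
    intro i
    refine max_le ?_ (ha0 i)
    rcases le_total (b i) (a i) with h | h
    · linarith [hB0 (b i)]
    · linarith [hBm h, hba i]
  set D := B (a 0) with hD
  have hD0 : 0 ≤ D := hB0 _
  have hbD : ∀ i, B (b i) ≤ D + D / 2 := by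
    intro i
    have h1 : b i ≤ a 0 + D := (hbanti (Fin.zero_le i)).trans (hba 0)
    exact (hBm h1).trans (hBl _ _ hD0)
  -- The estimation error is at most D and the shrinkage at most 3D/2. The constant 13 then covers 2
  -- · (5/2)² = 25/2.
  have hX : ∀ θ : Vec d, ‖θ‖ = 1 → |quad (G - S) θ| ≤ 5 / 2 * D := by
    intro θ hθ
    have h1 : quad G θ ≤ a 0 := hp.quad_le hG hθ fun k _ => hanti (Fin.zero_le k)
    have h2 := (hGQ θ hθ).trans (hBm h1)
    have h3 : quad (H - S) θ = ∑ i, (b i - max (b i - B (b i)) 0) * (inner ℝ (e i) θ) ^ 2 := by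
      rw [quad_sub, he1.quad_eq hHh, he2.quad_eq hSh, ← Finset.sum_sub_distrib]
      exact Finset.sum_congr rfl fun i _ => (sub_mul _ _ _).symm
    have h4 : 0 ≤ quad (H - S) θ := by
      rw [h3]
      refine Finset.sum_nonneg fun i _ => mul_nonneg (sub_nonneg.2 ?_) (sq_nonneg _)
      exact max_le (by linarith [hB0 (b i)]) (le_max_right _ _)
    have h5 : quad (H - S) θ ≤ D + D / 2 := by
      have h8 := norm_sq_eq_sum_inner e θ
      rw [hθ, one_pow] at h8
      rw [h3]
      calc ∑ i, (b i - max (b i - B (b i)) 0) * (inner ℝ (e i) θ) ^ 2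
          ≤ ∑ i, (D + D / 2) * (inner ℝ (e i) θ) ^ 2 := by
            refine Finset.sum_le_sum fun i _ => mul_le_mul_of_nonneg_right ?_ (sq_nonneg _)
            linarith [le_max_left (b i - B (b i)) 0, hbD i]
        _ = D + D / 2 := by rw [← Finset.mul_sum, ← h8, mul_one]
    rw [quad_sub] at h4 h5 ⊢
    rw [abs_le] at h2 ⊢
    constructor <;> linarith [h2.1, h2.2]
  have key := frob_cfc_sub_cfc_sq_le hG hSh hp he2 (fun i => le_max_right _ _) hca hX hL hf hr
  have hY : (2 * r * (5 / 2 * D) ^ 2 + 2 * ∑ i : Fin d with r ≤ i.val, a i ^ 2) ≤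
      13 * r * D ^ 2 + 2 * ∑ i : Fin d with r ≤ i.val, a i ^ 2 := by
    have : (0 : ℝ) ≤ r * D ^ 2 := by positivity
    nlinarith
  have hL' : 0 ≤ L⁻¹ := inv_nonneg.2 hL.le
  refine le_of_sq_le_sq ?_ (mul_nonneg hL' (Real.sqrt_nonneg _))
  have hnn : 0 ≤ 13 * r * D ^ 2 + 2 * ∑ i : Fin d with r ≤ i.val, a i ^ 2 :=
    add_nonneg (by positivity)
      (mul_nonneg zero_le_two (Finset.sum_nonneg fun i _ => sq_nonneg _))
  rw [mul_pow, Real.sq_sqrt hnn]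
  exact key.trans (mul_le_mul_of_nonneg_left hY (by positivity))

/-! ### The favourable event -/

theorem exists_event_critBound {d n : ℕ} (P : Measure (Vec d)) [IsProbabilityMeasure P]
    (hP : Integrable (fun x => ‖x‖ ^ 4) P) {Ω : Type*} [MeasurableSpace Ω] (μ : Measure Ω)
    [IsProbabilityMeasure μ] (X : Fin n → Ω → Vec d) (hXm : ∀ i, Measurable (X i))
    (hXlaw : ∀ i, μ.map (X i) = P) (hXind : iIndepFun X μ) {a ε : ℝ} (hε : 0 < ε)
    (hT : (tuning P a ε).Admissible n) :
    ∃ E : Set Ω, MeasurableSet E ∧ ENNReal.ofReal (1 - 2 * ε) ≤ μ E ∧ ∀ ω ∈ E,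
      ∀ j < gridSize n (tuning P a ε),
        CritBound (tuning P a ε) j (quad (gram P)) (fun i => X i ω) := by
  set T := tuning P a ε with hTdef
  set K := gridSize n T with hK
  have hK0 : (0 : ℝ) < K := by
    rw [hK, gridSize]
    positivity
  have hε' : 0 < ε / K := by positivity
  have hκ : 0 < kurt P := lt_of_lt_of_le (by norm_num) hT.κ_ge
  have hev := fun (j : ℕ) {ς : ℝ} (hς : ς = 1 ∨ ς = -1) =>
    exists_event_crit_le hT.n_pos P hP hκ hT.s_pos μ X hXm hXlaw hXind hς (gridL n T j)
      (hT.gridBeta_pos j) hε'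
  choose E₁ hE₁ hμ₁ hb₁ using fun j => hev j (Or.inl rfl)
  choose E₂ hE₂ hμ₂ hb₂ using fun j => hev j (Or.inr rfl)
  refine ⟨⋂ j ∈ Finset.range K, (E₁ j ∩ E₂ j), ?_, ?_, ?_⟩
  · exact Finset.measurableSet_biInter _ fun j _ => (hE₁ j).inter (hE₂ j)
  · have hm : MeasurableSet (⋂ j ∈ Finset.range K, (E₁ j ∩ E₂ j)) :=
      Finset.measurableSet_biInter _ fun j _ => (hE₁ j).inter (hE₂ j)
    have hc : μ (⋂ j ∈ Finset.range K, (E₁ j ∩ E₂ j))ᶜ ≤ ENNReal.ofReal (2 * ε) := by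
      simp only [Set.compl_iInter, Set.compl_inter]
      calc μ (⋃ j ∈ Finset.range K, ((E₁ j)ᶜ ∪ (E₂ j)ᶜ))
          ≤ ∑ j ∈ Finset.range K, μ ((E₁ j)ᶜ ∪ (E₂ j)ᶜ) := measure_biUnion_finset_le _ _
        _ ≤ ∑ _j ∈ Finset.range K, ENNReal.ofReal (2 * (ε / K)) := by
            refine Finset.sum_le_sum fun j _ => (measure_union_le _ _).trans ?_
            rw [two_mul, ENNReal.ofReal_add hε'.le hε'.le]
            exact add_le_add (hμ₁ j) (hμ₂ j)
        _ = ENNReal.ofReal (2 * ε) := by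
            rw [Finset.sum_const, Finset.card_range, nsmul_eq_mul, ← ENNReal.ofReal_natCast,
              ← ENNReal.ofReal_mul hK0.le]
            congr 1
            field_simp
    have hadd := prob_add_prob_compl (μ := μ) hm
    rw [ENNReal.ofReal_sub _ (by positivity), ENNReal.ofReal_one, tsub_le_iff_right, ← hadd]
    gcongr
  · intro ω hω j hj ς hς θ
    have hmem := Set.mem_iInter₂.1 hω j (Finset.mem_range.2 hj)
    have hlog : Real.log (1 / (ε / K)) = Real.log ((K : ℝ) / ε) := by rw [one_div_div]
    rw [quad_gram hP]
    rcases hς with rfl | rfl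
    · have := hb₁ j ω hmem.1 θ
      rw [hlog] at this
      exact this
    · have := hb₂ j ω hmem.2 θ
      rw [hlog] at this
      exact this

theorem sample_size_pos {n : ℕ} {T : Tuning} {σ : ℝ} (hκ : 3 / 2 ≤ T.κ) (hσ : 0 < σ)
    (hs : σ ≤ T.s) (hζ : 8 * zeta n T σ ≤ Real.sqrt n) : 0 < n := by
  rcases Nat.eq_zero_or_pos n with rfl | h
  · have h1 : 0 < Real.sqrt (2 * (2 + cst) * Real.sqrt T.κ * T.s / σ) * Real.cosh (T.a / 2) := by
      have := cst_pos
      have := Real.sqrt_pos.2 (lt_of_lt_of_le (by norm_num) hκ)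
      have := hσ.trans_le hs
      have := Real.cosh_pos (T.a / 2)
      positivity
    have h2 : 0 < zeta 0 T σ :=
      add_pos_of_nonneg_of_pos (mul_nonneg (Real.sqrt_nonneg _) (Real.cosh_pos _).le) h1
    rw [Nat.cast_zero, Real.sqrt_zero] at hζ
    linarith
  · exact h

end RobustPCA

end

/-! ### Assembly of the event and the deterministic bound. -/

theorem corollary5p4
    {d : ℕ} [NeZero d] {n : ℕ}
    -- the law of the data
    (P : Measure (RobustPCA.Vec d)) [IsProbabilityMeasure P]
    (hP : Integrable (fun x => ‖x‖ ^ 4) P)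
    -- an i.i.d. sample of size `n`
    {Ω : Type*} [MeasurableSpace Ω] (μ : Measure Ω) [IsProbabilityMeasure μ]
    (X : Fin n → Ω → RobustPCA.Vec d)
    (hXm : ∀ i, Measurable (X i)) (hXlaw : ∀ i, μ.map (X i) = P) (hXind : iIndepFun X μ)
    -- the parameters
    (a ε σ δ L : ℝ) (ha : 0 < a) (hε : 0 < ε) (hL : 0 < L)
    (hσ : 0 < σ) (hσs : σ ≤ RobustPCA.s4sq P)
    (hκ : 3 / 2 ≤ RobustPCA.kurt P)
    (hζ : 8 * RobustPCA.zeta n (RobustPCA.tuning P a ε) σ ≤ Real.sqrt n)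
    (Θ : Finset (RobustPCA.Vec d)) (hΘ : RobustPCA.IsSphereNet δ Θ) :
    ∃ E : Set Ω, MeasurableSet E ∧ ENNReal.ofReal (1 - 2 * ε) ≤ μ E ∧
      ∀ ω ∈ E, ∀ f : ℝ → ℝ, (∀ s t : ℝ, |f s - f t| ≤ 1 / L * |s - t|) →
        ∀ r ∈ Finset.Icc 1 d,
          RobustPCA.frob
              (cfc f (RobustPCA.gram P) -
                cfc f (RobustPCA.Gtilde (RobustPCA.tuning P a ε) Θ σ δ
                  (RobustPCA.frob (RobustPCA.gram P)) (fun i => X i ω))) ≤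
            L⁻¹ * Real.sqrt
              (13 * r *
                  RobustPCA.Bfun n (RobustPCA.tuning P a ε) σ δ
                    (RobustPCA.frob (RobustPCA.gram P)) (RobustPCA.eig P 0) ^ 2 +
                2 * ∑ i : Fin d with r ≤ i.val, RobustPCA.eig P i ^ 2) := by
  -- For ε ≥ 1/2 the probability bound is void; otherwise K/ε > 1, so the logarithm in the constants
  -- is positive.
  rcases le_or_gt (1 / 2) ε with hε2 | hε2
  · refine ⟨∅, MeasurableSet.empty, ?_, fun ω hω => hω.elim⟩
    rw [ENNReal.ofReal_of_nonpos (by linarith)]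
    exact zero_le
  set T := RobustPCA.tuning P a ε with hT
  have hn : 0 < n := RobustPCA.sample_size_pos (T := T) hκ hσ hσs hζ
  have hadm : T.Admissible n :=
    { n_pos := hn
      κ_ge := hκ
      s_pos := hσ.trans_le hσs
      a_pos := ha
      log_pos := by
        refine Real.log_pos ?_
        have h1 : (1 : ℝ) ≤ RobustPCA.gridSize n T := by
          rw [RobustPCA.gridSize]
          push_cast
          linarith [Nat.cast_nonneg (α := ℝ)
            ⌈T.a⁻¹ * Real.log ((n : ℝ) / (72 * (2 + RobustPCA.cst) * Real.sqrt T.κ))⌉₊]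
        change 1 < (RobustPCA.gridSize n T : ℝ) / ε
        rw [lt_div_iff₀ hε]
        linarith }
  have hpre : T.Precise n σ := ⟨hadm, hσ, hσs, hζ⟩
  obtain ⟨E, hE, hμE, hcrit⟩ :=
    RobustPCA.exists_event_critBound P hP μ X hXm hXlaw hXind hε hadm
  refine ⟨E, hE, hμE, fun ω hω f hf r hr => ?_⟩
  have hG0 := RobustPCA.quad_gram_nonneg hP
  -- The sign of δ is not assumed: a net of the nonempty sphere forces δ ≥ 0.
  have hδ : 0 ≤ δ * RobustPCA.frob (RobustPCA.gram P) := by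
    have h1 : ‖EuclideanSpace.single (0 : Fin d) (1 : ℝ)‖ = 1 := by simp
    obtain ⟨θ', _, h⟩ := hΘ.2 _ h1
    exact mul_nonneg ((norm_nonneg _).trans h) (RobustPCA.frob_nonneg _)
  have hQ : (RobustPCA.Qhat T Θ fun i => X i ω).IsHermitian := by
    have hfeas : RobustPCA.Feasible T Θ (fun i => X i ω) (RobustPCA.gram P) :=
      ⟨by simpa [Matrix.IsSymm, Matrix.IsHermitian] using RobustPCA.gram_isHermitian P,
        fun θ hθ => RobustPCA.mem_confRegion_of_critBound hadm hG0 (hcrit ω hω) (hΘ.1 θ hθ)⟩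
    have := (RobustPCA.isSolution_Qhat
      (RobustPCA.exists_isSolution hadm Θ (fun i => X i ω) hfeas)).1.1
    simpa [Matrix.IsSymm, Matrix.IsHermitian] using this
  refine RobustPCA.frob_cfc_sub_cfc_shrink_le (RobustPCA.gram_isHermitian P) hQ hG0
    (B := RobustPCA.Bfun n T σ δ (RobustPCA.frob (RobustPCA.gram P)))
    (fun t => ?_) (fun s t hst => ?_) (fun t s hs => ?_) (fun θ hθ => ?_) hL hf
    (Finset.mem_Icc.1 hr).2
  · rw [RobustPCA.Bfun_eq]
    linarith [hpre.width_nonneg t]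
  · rw [RobustPCA.Bfun_eq, RobustPCA.Bfun_eq]
    linarith [hpre.width_mono hst]
  · rw [RobustPCA.Bfun_eq, RobustPCA.Bfun_eq]
    linarith [hpre.width_add_le t hs]
  · exact RobustPCA.abs_quad_sub_quad_Ghat_le hpre hΘ (RobustPCA.gram_isHermitian P) hG0
      (fun θ hθ => RobustPCA.quad_gram_le hP hθ) (hcrit ω hω) hθ
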